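/- **Inversion formula (size $2$).** Let $k$ be a $\mathfrak p$-adic field of odd residual characteristic, with ring of integers $\mathfrak o$, prime element $\pi$, residue field of $q$ elements, and absolute value normalized by $|\pi|=q^{-1}$. Let $D=k\oplus k\varepsilon\oplus k\Pi\oplus k\Pi\varepsilon$ be the division quaternion algebra over $k$, where $\varepsilon^2\in\mathfrak o^\times$ is not a square in $k$, $\Pi^2=\pi$, $\Pi\varepsilon=-\varepsilon\Pi$; let $\mathcal O=\mathfrak o\oplus\mathfrak o\varepsilon\oplus\mathfrak o\Pi\oplus\mathfrak o\Pi\varepsilon$ be its maximal order, $*$ its canonical involution (extended to matrices by $(a_{ij})^*=(a_{ji}^*)$), and $\mathrm{Nrd}$ the reduced norm on $M_n(D)$. Put $K=GL_2(\mathcal O)$ and $X=\{x\in GL_2(D): x^*=x\}$, on which $K$ acts by $g\cdot x=gxg^*$. Let $dx$ be the $GL_2(D)$-invariant measure on $X$, i.e. the multiple of $|\mathrm{Nrd}(x)|^{-3/2}\,dx_{11}\,dx_{22}\,dx_{12}$ ($x_{11},x_{22}\in k$, $x_{12}\in D$) for which $K\cdot 1_2$ has volume $1$; let $v$ denote the volume.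 Let $\mathcal S(K\backslash X)$ be the space of $K$-invariant compactly supported functions $X\to\mathbb C$. For $x\in X$ and $s\in\mathbb C^2$ with $\mathrm{Re}(s_1)\ge 0$ put $$\omega(x;s)=\int_K |d_1(h\cdot x)|^{s_1}|d_2(h\cdot x)|^{s_2}\,dh,$$ where $dh$ is the Haar measure on $K$ of total mass $1$, $|d_i(y)|=|\mathrm{Nrd}(y^{(i)})|^{1/2}$ with $y^{(i)}$ the upper left $i\times i$ block of $y$, and the integrand is $0$ where $d_1d_2=0$. With $s_1=-z_1+z_2-2$, $s_2=-z_2+1$, there is for each $x$ a unique symmetric Laurent polynomial $\Psi(x;z)\in\mathbb C[q^{\pm z_1},q^{\pm z_2}]^{S_2}$ such that $\Psi(x;z)=(q^{z_2}-q^{z_1+1})\,\omega(x;s)$ whenever $\mathrm{Re}(s_1)\ge 0$. For $\varphi\in\mathcal S(K\backslash X)$ put $$F(\varphi)(z)=\int_X\varphi(x)\Psi(x^{-1};z)\,dx .$$ Write $x=\frac{z_2+z_1}2$, $y=\frac{z_2-z_1}2$ for the variables, and for symmetric Laurent polynomials $f,g$ in $q^{z_1},q^{z_2}$ define $$\langle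 f,g\rangle=\int_T dx\int_U f\,\overline g\,w(y)\,dy,\qquad w(y)=\frac{1-q^{2y}}{(1-q^{2y+1})(1-q^{2y-2})}\cdot\frac{1-q^{-2y}}{(1-q^{-2y+1})(1-q^{-2y-2})}.$$ Here $T=\{\sqrt{-1}\,t: 0\le t\le 2\pi/\log q\}$; $U$ is any $C^1$ parametrized path from a point $y_0$ to $y_0+2\pi\sqrt{-1}/\log q$ such that the closed curve $q^y$, $y\in U$, avoids $\pm q^{\pm1/2},\pm q^{\pm1}$ and has winding number $1$ around each of $\pm q^{-1},\pm q^{1/2}$ and $0$ around each of $\pm q^{-1/2},\pm q$; $\overline g$ denotes the holomorphic function $z\mapsto\overline{g(-\overline{z})}$, which is the complex conjugate of $g$ for purely imaginary $z$; and the measures are the constant multiples of the line elements for which $\int_{T\times U}dx\,dy=\frac{(1+q^{-2})^2}{2(1-q^{-1})}$. Then for every $\varphi\in\mathcal S(K\backslash X)$ and every $x\in X$, $$\varphi(x)=\frac1{v(K\cdot x)}\,\langle F(\varphi),F(ch_x)\rangle,$$ where $ch_x$ is the characteristic function of the orbit $K\cdot x$. -/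

import Mathlib

open MeasureTheory TopologicalSpace
open scoped NormedField Matrix

noncomputable section

namespace QHerm

/-! ### The base field, the division quaternion algebra and its maximal order -/

section Algebra

variable {k : Type*} [NontriviallyNormedField k] [IsUltrametricDist k]

/-- The number `q` of elements of the residue field of `k`. -/
def resCard (k : Type*) [NontriviallyNormedField k] [IsUltrametricDist k] : ℕ :=
  Nat.card (IsLocalRing.ResidueField (Valued.integer k))

/-- The quaternion algebra `D = k ⊕ kε ⊕ kΠ ⊕ kΠε` with `ε² = u`, `Π² = ϖ`, `Πε = -εΠ`.
In Mathlib's basis `1, i, j, ij` one has `i = ε`, `j = Π`, `ij = -Πε`; the canonical involution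
is `star`. -/
abbrev D (u ϖ : Valued.integer k) : Type _ := QuaternionAlgebra k (u : k) 0 (ϖ : k)

/-- The maximal order `𝒪 = 𝔬 ⊕ 𝔬ε ⊕ 𝔬Π ⊕ 𝔬Πε` of `D`. -/
def order (u ϖ : Valued.integer k) : Subring (D u ϖ) where
  carrier := {a | a.re ∈ Valued.integer k ∧ a.imI ∈ Valued.integer k ∧
    a.imJ ∈ Valued.integer k ∧ a.imK ∈ Valued.integer k}
  zero_mem' := by simp [zero_mem]
  one_mem' := by simp [zero_mem, one_mem]
  add_mem' := by
    rintro a b ⟨h1, h2, h3, h4⟩ ⟨g1, g2, g3, g4⟩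
    exact ⟨add_mem h1 g1, add_mem h2 g2, add_mem h3 g3, add_mem h4 g4⟩
  neg_mem' := by
    rintro a ⟨h1, h2, h3, h4⟩
    exact ⟨neg_mem h1, neg_mem h2, neg_mem h3, neg_mem h4⟩
  mul_mem' := by
    rintro a b ⟨h1, h2, h3, h4⟩ ⟨g1, g2, g3, g4⟩
    have hu := u.2
    have hϖ := ϖ.2
    refine ⟨?_, ?_, ?_, ?_⟩
    · rw [QuaternionAlgebra.re_mul]
      exact sub_mem (add_mem (add_mem (add_mem (mul_mem h1 g1) (mul_mem (mul_mem hu h2) g2))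
        (mul_mem (mul_mem hϖ h3) g3)) (mul_mem (mul_mem (mul_mem (zero_mem _) hϖ) h3) g4))
        (mul_mem (mul_mem (mul_mem hu hϖ) h4) g4)
    · rw [QuaternionAlgebra.imI_mul]
      exact add_mem (sub_mem (add_mem (add_mem (mul_mem h1 g2) (mul_mem h2 g1))
        (mul_mem (mul_mem (zero_mem _) h2) g2)) (mul_mem (mul_mem hϖ h3) g4))
        (mul_mem (mul_mem hϖ h4) g3)
    · rw [QuaternionAlgebra.imJ_mul]
      exact sub_mem (add_mem (add_mem (add_mem (mul_mem h1 g3) (mul_mem (mul_mem hu h2) g4))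
        (mul_mem h3 g1)) (mul_mem (mul_mem (zero_mem _) h3) g2)) (mul_mem (mul_mem hu h4) g2)
    · rw [QuaternionAlgebra.imK_mul]
      exact add_mem (sub_mem (add_mem (add_mem (mul_mem h1 g4) (mul_mem h2 g3))
        (mul_mem (mul_mem (zero_mem _) h2) g4)) (mul_mem h3 g2)) (mul_mem h4 g1)

/-- The embedding `φ : D → M₂(k')`, `k' = k(ε)`, given by
`a + bε + cΠ + dΠε ↦ [a + bε, (c - dε)ϖ; c + dε, a - bε]`. -/
def split (u ϖ : Valued.integer k) (a : D u ϖ) :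
    Matrix (Fin 2) (Fin 2) (QuadraticAlgebra k (u : k) 0) :=
  !![⟨a.re, a.imI⟩, ⟨(ϖ : k) * a.imJ, (ϖ : k) * a.imK⟩;
     ⟨a.imJ, -a.imK⟩, ⟨a.re, -a.imI⟩]

/-- The reduced norm of `A ∈ Mₙ(D)`: the determinant of the image of `A` in `M₂ₙ(k')`, which
lies in `k`. -/
def nrd (u ϖ : Valued.integer k) {n : ℕ} (A : Matrix (Fin n) (Fin n) (D u ϖ)) : k :=
  (Matrix.det (Matrix.comp (Fin n) (Fin n) (Fin 2) (Fin 2) _ (A.map (split u ϖ)))).re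

/-- `G = GL₂(D)`. -/
abbrev G (u ϖ : Valued.integer k) : Type _ := (Matrix (Fin 2) (Fin 2) (D u ϖ))ˣ

/-- `K = GL₂(𝒪)`. -/
abbrev K (u ϖ : Valued.integer k) : Type _ := (Matrix (Fin 2) (Fin 2) (order u ϖ))ˣ

/-- The inclusion of `K` into `G`. -/
def inclK (u ϖ : Valued.integer k) : K u ϖ →* G u ϖ :=
  Units.map ((order u ϖ).subtype.mapMatrix (m := Fin 2)).toMonoidHom

/-- The space `X` of quaternion hermitian forms of size `2`. -/
abbrev X (u ϖ : Valued.integer k) : Type _ :=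
  {A : G u ϖ // (A : Matrix (Fin 2) (Fin 2) (D u ϖ))ᴴ = A}

variable {u ϖ : Valued.integer k}

/-- The action `g · A = g A g*` of `G` on `X`. -/
def act (g : G u ϖ) (A : X u ϖ) : X u ϖ :=
  ⟨g * A.1 * star g, by
    have h := A.2
    simp only [Units.val_mul, Units.coe_star, Matrix.star_eq_conjTranspose,
      Matrix.conjTranspose_mul, Matrix.conjTranspose_conjTranspose, h, mul_assoc]⟩

/-- The inverse matrix of a form, again a form. -/
def inv (A : X u ϖ) : X u ϖ :=
  ⟨(A.1)⁻¹, by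
    have h : star A.1 = A.1 := Units.ext A.2
    have h' : star (A.1)⁻¹ = (A.1)⁻¹ := by rw [star_inv, h]
    exact congrArg Units.val h'⟩

/-- The orbit `K · x`. -/
def orbitK (x : X u ϖ) : Set (X u ϖ) := Set.range fun κ : K u ϖ => act (inclK u ϖ κ) x

/-- The identity form `1₂`. -/
def oneX (u ϖ : Valued.integer k) : X u ϖ := ⟨1, by simp⟩

/-- `|d_{i+1}(x)|`, where `d_i(x)² = Nrd(x^{(i)})` and `x^{(i)}` is the upper left `i × i` block
of `x`. -/
def absd (x : X u ϖ) (i : Fin 2) : ℝ :=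
  Real.sqrt ‖nrd u ϖ ((x.1 : Matrix (Fin 2) (Fin 2) (D u ϖ)).submatrix
    (Fin.castLE (Nat.succ_le_of_lt i.isLt)) (Fin.castLE (Nat.succ_le_of_lt i.isLt)))‖

open Classical in
/-- `|𝐝(x)|^s = |d₁(x)|^{s₁} |d₂(x)|^{s₂}` if `d₁(x) d₂(x) ≠ 0`, and `0` otherwise. -/
def absPow (s : Fin 2 → ℂ) (x : X u ϖ) : ℂ :=
  if ∀ i, absd x i ≠ 0 then ∏ i, (absd x i : ℂ) ^ s i else 0

/-- The coordinates `(x₁₁, x₂₂, x₁₂) ∈ k × k × D ≅ k⁶` of a form. -/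
def coord (x : X u ϖ) : k × k × (Fin 4 → k) :=
  let M : Matrix (Fin 2) (Fin 2) (D u ϖ) := x.1
  ((M 0 0).re, (M 1 1).re, QuaternionAlgebra.equivTuple _ _ _ (M 0 1))

end Algebra

/-! ### Topology and measures -/

section Topology

variable {k : Type*} [NontriviallyNormedField k] [IsUltrametricDist k]

/-- The topology of `D`, that of `k⁴`. -/
instance (u ϖ : Valued.integer k) : TopologicalSpace (D u ϖ) :=
  TopologicalSpace.induced (QuaternionAlgebra.equivTuple (u : k) 0 (ϖ : k)) inferInstance

variable {u ϖ : Valued.integer k}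

theorem continuous_equivTuple :
    Continuous (QuaternionAlgebra.equivTuple (u : k) 0 (ϖ : k)) := continuous_induced_dom

theorem continuous_re : Continuous fun a : D u ϖ => a.re :=
  (continuous_apply (0 : Fin 4)).comp (continuous_equivTuple (u := u) (ϖ := ϖ))

theorem continuous_imI : Continuous fun a : D u ϖ => a.imI :=
  (continuous_apply (1 : Fin 4)).comp (continuous_equivTuple (u := u) (ϖ := ϖ))

theorem continuous_imJ : Continuous fun a : D u ϖ => a.imJ :=
  (continuous_apply (2 : Fin 4)).comp (continuous_equivTuple (u := u) (ϖ := ϖ))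

theorem continuous_imK : Continuous fun a : D u ϖ => a.imK :=
  (continuous_apply (3 : Fin 4)).comp (continuous_equivTuple (u := u) (ϖ := ϖ))

theorem continuous_toD {α : Type*} [TopologicalSpace α] {f : α → D u ϖ}
    (h1 : Continuous fun a => (f a).re) (h2 : Continuous fun a => (f a).imI)
    (h3 : Continuous fun a => (f a).imJ) (h4 : Continuous fun a => (f a).imK) :
    Continuous f := by
  rw [continuous_induced_rng]
  refine continuous_pi fun i => ?_
  fin_cases i
  · exact h1
  · exact h2
  · exact h3
  · exact h4

instance : IsTopologicalRing (D u ϖ) where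
  continuous_add := by
    have := continuous_re (u := u) (ϖ := ϖ)
    have := continuous_imI (u := u) (ϖ := ϖ)
    have := continuous_imJ (u := u) (ϖ := ϖ)
    have := continuous_imK (u := u) (ϖ := ϖ)
    apply continuous_toD <;> simp only [QuaternionAlgebra.re_add, QuaternionAlgebra.imI_add,
      QuaternionAlgebra.imJ_add, QuaternionAlgebra.imK_add] <;> fun_prop
  continuous_mul := by
    have := continuous_re (u := u) (ϖ := ϖ)
    have := continuous_imI (u := u) (ϖ := ϖ)
    have := continuous_imJ (u := u) (ϖ := ϖ)
    have := continuous_imK (u := u) (ϖ := ϖ)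
    apply continuous_toD <;> simp only [QuaternionAlgebra.re_mul, QuaternionAlgebra.imI_mul,
      QuaternionAlgebra.imJ_mul, QuaternionAlgebra.imK_mul] <;> fun_prop
  continuous_neg := by
    have := continuous_re (u := u) (ϖ := ϖ)
    have := continuous_imI (u := u) (ϖ := ϖ)
    have := continuous_imJ (u := u) (ϖ := ϖ)
    have := continuous_imK (u := u) (ϖ := ϖ)
    apply continuous_toD <;> simp only [QuaternionAlgebra.re_neg, QuaternionAlgebra.imI_neg,
      QuaternionAlgebra.imJ_neg, QuaternionAlgebra.imK_neg] <;> fun_prop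

instance : T2Space (D u ϖ) :=
  T2Space.of_injective_continuous (QuaternionAlgebra.equivTuple (u : k) 0 (ϖ : k)).injective
    continuous_equivTuple

instance [ProperSpace k] : CompactSpace (order u ϖ) := by
  refine (isCompact_iff_compactSpace (s := ((order u ϖ : Subring (D u ϖ)) : Set (D u ϖ)))).mp ?_
  have hB : IsCompact (Set.univ.pi fun _ : Fin 4 => (Valued.integer k : Set k)) := by
    refine isCompact_univ_pi fun _ => ?_
    have : (Valued.integer k : Set k) = Metric.closedBall 0 1 := by
      ext x
      simp [Valued.integer, Valuation.mem_integer_iff, NormedField.valuation_apply,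
        ← NNReal.coe_le_coe]
    rw [this]
    exact isCompact_closedBall 0 1
  have hind : Topology.IsInducing (QuaternionAlgebra.equivTuple (u : k) 0 (ϖ : k)) := ⟨rfl⟩
  have hpre : ((order u ϖ : Subring (D u ϖ)) : Set (D u ϖ)) =
      QuaternionAlgebra.equivTuple (u : k) 0 (ϖ : k) ⁻¹'
        (Set.univ.pi fun _ : Fin 4 => (Valued.integer k : Set k)) := by
    ext x
    simp only [Set.mem_preimage, Set.mem_univ_pi, Fin.forall_fin_succ]
    simp [order, QuaternionAlgebra.equivTuple_apply]
  rw [hpre]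
  refine hind.isCompact_preimage' hB ?_
  rw [(QuaternionAlgebra.equivTuple (u : k) 0 (ϖ : k)).surjective.range_eq]
  exact Set.subset_univ _

instance [ProperSpace k] : CompactSpace (Matrix (Fin 2) (Fin 2) (order u ϖ)) :=
  inferInstanceAs (CompactSpace (Fin 2 → Fin 2 → order u ϖ))

instance (u ϖ : Valued.integer k) : MeasurableSpace (K u ϖ) := borel _

instance (u ϖ : Valued.integer k) : BorelSpace (K u ϖ) := ⟨rfl⟩

instance (u ϖ : Valued.integer k) : MeasurableSpace (X u ϖ) := borel _

instance (u ϖ : Valued.integer k) : BorelSpace (X u ϖ) := ⟨rfl⟩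

/-- The Haar measure `dk` on the compact group `K`, of total mass `1`. -/
def haarK [ProperSpace k] (u ϖ : Valued.integer k) : Measure (K u ϖ) :=
  Measure.haarMeasure (⊤ : PositiveCompacts (K u ϖ))

/-- The integral `ω(x; s) = ∫_K |𝐝(k·x)|^s dk`. -/
def omega [ProperSpace k] (x : X u ϖ) (s : Fin 2 → ℂ) : ℂ :=
  ∫ κ : K u ϖ, absPow s (act (inclK u ϖ κ) x) ∂(haarK u ϖ)

/-- The `G`-invariant measure `|Nrd(x)|^{-3/2} dx₁₁ dx₂₂ dx₁₂` on `X`, before normalization. -/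
def measX₀ [ProperSpace k] [MeasurableSpace k] [BorelSpace k] (u ϖ : Valued.integer k) :
    Measure (X u ϖ) :=
  (Measure.comap coord ((Measure.addHaar : Measure k).prod
    ((Measure.addHaar : Measure k).prod
      (Measure.pi fun _ : Fin 4 => (Measure.addHaar : Measure k))))).withDensity
    fun x => ENNReal.ofReal
      (‖nrd u ϖ (x.1 : Matrix (Fin 2) (Fin 2) (D u ϖ))‖ ^ (-(3 / 2) : ℝ))

/-- The `G`-invariant measure `dx` on `X`, normalized by `v(K · 1₂) = 1`. -/
def measX [ProperSpace k] [MeasurableSpace k] [BorelSpace k] (u ϖ : Valued.integer k) :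
    Measure (X u ϖ) :=
  (measX₀ u ϖ (orbitK (oneX u ϖ)))⁻¹ • measX₀ u ϖ

/-- The Schwartz space `S(K\X)` of `K`-invariant compactly supported functions on `X`. -/
def schwartz (u ϖ : Valued.integer k) : Set (X u ϖ → ℂ) :=
  {f | (∀ (κ : K u ϖ) (x : X u ϖ), f (act (inclK u ϖ κ) x) = f x) ∧ HasCompactSupport f}

/-- The characteristic function of `K · x`. -/
def ch (x : X u ϖ) : X u ϖ → ℂ := (orbitK x).indicator 1

end Topology

/-! ### Spherical functions and the spherical transform -/

section Spherical

/-- `ℂ[q^{±z₁}, q^{±z₂}]^{S₂}`, as a set of functions of `z ∈ ℂ²`. -/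
def symLaurent (q : ℝ) : Set ((Fin 2 → ℂ) → ℂ) :=
  {f | ∃ c : (ℤ × ℤ) →₀ ℂ, (∀ m n, c (m, n) = c (n, m)) ∧
    ∀ z, f z = c.sum fun m a => a * (q : ℂ) ^ ((m.1 : ℂ) * z 0 + (m.2 : ℂ) * z 1)}

/-- The variable `s` in terms of `z`: `s₁ = -z₁ + z₂ - 2`, `s₂ = -z₂ + 1`. -/
def sOfZ (z : Fin 2 → ℂ) : Fin 2 → ℂ := ![-z 0 + z 1 - 2, -z 1 + 1]

/-- `G₂(z) = q^{z₂} - q^{z₁+1}`. -/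
def Gfac (q : ℝ) (z : Fin 2 → ℂ) : ℂ := (q : ℂ) ^ (z 1) - (q : ℂ) ^ (z 0 + 1)

variable {k : Type*} [NontriviallyNormedField k] [IsUltrametricDist k] [ProperSpace k]
  {u ϖ : Valued.integer k}

/-- `f` is the symmetric Laurent polynomial continuing `G₂(z) ω(x; z)` from the domain
`Re s₁ ≥ 0`, where the integral `ω(x; s)` converges. -/
def IsNormalizedSpherical (x : X u ϖ) (f : (Fin 2 → ℂ) → ℂ) : Prop :=
  f ∈ symLaurent (resCard k) ∧
    ∀ z, 0 ≤ (sOfZ z 0).re → f z = Gfac (resCard k) z * omega x (sOfZ z)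

open Classical in
/-- The normalized spherical function `Ψ(x; z) = G₂(z) ω(x; z)`, continued to all `z ∈ ℂ²`. -/
def Psi (x : X u ϖ) : (Fin 2 → ℂ) → ℂ :=
  if h : ∃ f, IsNormalizedSpherical x f then h.choose else 0

/-- The normalized spherical transform `F(φ)(z) = ∫_X φ(x) Ψ(x⁻¹; z) dx`. -/
def sphTransform [MeasurableSpace k] [BorelSpace k] (φ : X u ϖ → ℂ) (z : Fin 2 → ℂ) : ℂ :=
  ∫ x, φ x * Psi (inv x) z ∂(measX u ϖ)

end Spherical

/-! ### The hermitian pairing -/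

section Pairing

/-- The winding number of the closed curve `q^γ` about the point `a` is `n`. -/
def WindingEq (q : ℝ) (γ : ℝ → ℂ) (a : ℝ) (n : ℤ) : Prop :=
  (∀ r ∈ Set.Icc (0 : ℝ) 1, (q : ℂ) ^ γ r ≠ a) ∧
    ∫ r in (0 : ℝ)..1, deriv (fun t => (q : ℂ) ^ γ t) r / ((q : ℂ) ^ γ r - a) =
      2 * Real.pi * Complex.I * n

/-- The integration paths `U` for the variable `y`: paths `γ` from a point `y₀` to
`y₀ + 2π√-1 / log q` such that the closed curve `Y = q^γ` is obtained from the positively oriented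
unit circle by moving it, across the zeros `±1` of the weight, so that the poles
`±q^{-1}, ±q^{1/2}` of the weight are inside and the poles `±q^{-1/2}, ±q` are outside. An
example is `γ(r) = (3/4) sin(4πr) + √-1 (2πr - (π/4) sin(4πr)) / log q`. -/
structure IsPath (q : ℝ) (γ : ℝ → ℂ) : Prop where
  smooth : ContDiff ℝ 1 γ
  period : γ 1 = γ 0 + 2 * Real.pi * Complex.I / Real.log q
  inside_inv : WindingEq q γ q⁻¹ 1 ∧ WindingEq q γ (-q⁻¹) 1
  inside_sqrt : WindingEq q γ (Real.sqrt q) 1 ∧ WindingEq q γ (-Real.sqrt q) 1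
  outside_inv_sqrt : WindingEq q γ (Real.sqrt q)⁻¹ 0 ∧ WindingEq q γ (-(Real.sqrt q)⁻¹) 0
  outside_self : WindingEq q γ q 0 ∧ WindingEq q γ (-q) 0

/-- The weight function `w(y)`. -/
def weight (q : ℝ) (y : ℂ) : ℂ :=
  (1 - (q : ℂ) ^ (2 * y)) / ((1 - (q : ℂ) ^ (2 * y + 1)) * (1 - (q : ℂ) ^ (2 * y - 2))) *
    ((1 - (q : ℂ) ^ (-2 * y)) / ((1 - (q : ℂ) ^ (-2 * y + 1)) * (1 - (q : ℂ) ^ (-2 * y - 2))))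

/-- `z` in terms of `x = (z₂ + z₁)/2` and `y = (z₂ - z₁)/2`. -/
def zOfXY (x y : ℂ) : Fin 2 → ℂ := ![x - y, x + y]

/-- The function `z ↦ conj (g (-conj z))`: on purely imaginary `z` it is `conj (g z)`, and it is
holomorphic if `g` is, so it is the analytic continuation of `conj ∘ g` from `√-1 ℝ²`. -/
def conjExt (g : (Fin 2 → ℂ) → ℂ) (z : Fin 2 → ℂ) : ℂ :=
  starRingEnd ℂ (g fun i => -starRingEnd ℂ (z i))

/-- The pairing `⟨f, g⟩ = ∫_T dx ∫_U f ḡ w(y) dy`, where `T = {√-1 t | 0 ≤ t ≤ 2π / log q}`, `U` is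
the path `γ`, and the measure `dx dy` is the multiple of the line elements of `T` and `U` for
which `∫_{T × U} dx dy = (1 + q⁻²)² / (2 (1 - q⁻¹))`. -/
def pairing (q : ℝ) (γ : ℝ → ℂ) (f g : (Fin 2 → ℂ) → ℂ) : ℂ :=
  ((1 + (q : ℂ)⁻¹ ^ 2) ^ 2 / (2 * (1 - (q : ℂ)⁻¹))) *
    ((2 * Real.pi / Real.log q) * (2 * Real.pi * Complex.I / Real.log q))⁻¹ *
    ∫ t in (0 : ℝ)..(2 * Real.pi / Real.log q), ∫ r in (0 : ℝ)..1,
      f (zOfXY (t * Complex.I) (γ r)) * conjExt g (zOfXY (t * Complex.I) (γ r)) *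
        weight q (γ r) * deriv γ r

end Pairing

end QHerm

end

/-! The proof is an explicit Plancherel computation: the `K`-orbits are classified, the spherical
functions are found in closed form, and their orthogonality is matched with the volumes of the
orbits.

Orbits. Let `m` be least such that the form has level `m` (`Lev`), and write the norm of the
determinant as `q ^ (2 * m + 1 - n)`. Both numbers are `K`-invariant. Row operations, surjectivity
of the norm of the unramified quadratic extension on units, and square roots of elements near `1`
bring a form with `m = 0` to `diag(1, ϖ ^ (n - 1))` if `n ≥ 1` and to the antidiagonal form with
entry `Π⁻¹` if `n = 0`. Scaling handles the other `m`, so `(m, n)` classifies the orbits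
(`IsType.kEq`).

Spherical functions. The integral over `K` involves only the first row of the group element. Where
the second entry of the row is a unit, the quotient of the entries is equidistributed in the maximal
order; elsewhere the opposite quotient is equidistributed in the maximal ideal (`integral_val`). For
a function behaving like `|t| ^ s`, suitable representatives of the orbits turn the integral into
averages of `N(w) + Tr(Π ^ l w*)`, and the substitution `w = w' Π` lowers `l`. The resulting
recursion gives, up to elementary factors, symmetric polynomials `P_n` (`sphPoly`) with `P_(n+3) =
(a + b) P_(n+2) - a b P_(n+1)`, evaluated at `a = q ^ z₁`, `b = q ^ z₂`
(`QuasiChar.avgK_eq_sphPoly`, `Psi_eq`).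

Orthogonality. In the variables `x, y` the spherical function of type `(m, n)` is a constant times
`q ^ ((n - 2 * m) x)` times `P_n(Y⁻¹, Y)`, `Y = q ^ y`. The `x`-integral separates the values of `n
- 2 * m`, which leaves only pairs of indices `n` of equal parity. The weight is `h(Y²) h(Y⁻²)`, and
for `n ≥ 1` one has `P_n h(Y²) h(Y⁻²) = Y ^ n h(Y²) + Y⁻¹ ^ n h(Y⁻²)` (`sphPoly_mul_halfWeight`).
The path is chosen so that `h(Y²)` integrates like its power series in `Y²` and `h(Y⁻²)` like its
power series in `Y⁻²`. Pairing with a `P_j`, `j ≤ n`, then extracts a constant term, which vanishes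
unless `j = n` (`IsPath.pathInt_curvePoly`).

Conclusion. The volume of an orbit depends only on `n` (`measX_isType`) and is inverse to the square
norm of its spherical function (`volC_mul_sphNorm`). A function in the Schwartz space is a finite
combination of characteristic functions of orbits, and the transform of such a characteristic
function is the volume times one spherical function; the formula follows by linearity (`inversion`).
-/

noncomputable section

namespace QHerm

/-! ### Square roots and the unramified norm form over the base field -/

section BaseField

variable {k : Type*} [NontriviallyNormedField k] [IsUltrametricDist k]

/-- Everything that is used of the base field: the residue field has odd order `q`, `ϖ` is a prime
element of norm `q⁻¹`, and `u` is a unit whose square roots generate the unramified quadratic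
extension. -/
structure BaseData (u ϖ : Valued.integer k) : Prop where
  norm_two : ‖(2 : k)‖ = 1
  one_lt : 1 < (resCard k : ℝ)
  norm_prime : ‖(ϖ : k)‖ = (resCard k : ℝ)⁻¹
  exists_norm : ∀ t : k, t ≠ 0 → ∃ m : ℤ, ‖t‖ = (resCard k : ℝ) ^ m
  exists_sqrt : ∀ m : k, ‖m‖ < 1 → ∃ s : k, s ^ 2 = 1 + m ∧ ‖s - 1‖ < 1
  norm_form : ∀ r i : k, ‖r ^ 2 - u * i ^ 2‖ = max ‖r‖ ‖i‖ ^ 2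
  exists_form : ∀ a : k, ‖a‖ = 1 → ∃ r i : k, r ^ 2 - u * i ^ 2 = a

theorem norm_add_le_of_le {a b : k} {c : ℝ} (ha : ‖a‖ ≤ c) (hb : ‖b‖ ≤ c) : ‖a + b‖ ≤ c :=
  (IsUltrametricDist.norm_add_le_max a b).trans (max_le ha hb)

theorem norm_add_lt_of_lt {a b : k} {c : ℝ} (ha : ‖a‖ < c) (hb : ‖b‖ < c) : ‖a + b‖ < c :=
  (IsUltrametricDist.norm_add_le_max a b).trans_lt (max_lt ha hb)

theorem norm_sub_le_of_le {a b : k} {c : ℝ} (ha : ‖a‖ ≤ c) (hb : ‖b‖ ≤ c) : ‖a - b‖ ≤ c := by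
  rw [sub_eq_add_neg]; exact norm_add_le_of_le ha (by rwa [norm_neg])

theorem norm_sub_lt_of_lt {a b : k} {c : ℝ} (ha : ‖a‖ < c) (hb : ‖b‖ < c) : ‖a - b‖ < c := by
  rw [sub_eq_add_neg]; exact norm_add_lt_of_lt ha (by rwa [norm_neg])

theorem norm_add_eq_left {a b : k} (h : ‖b‖ < ‖a‖) : ‖a + b‖ = ‖a‖ := by
  rw [IsUltrametricDist.norm_add_eq_max_of_norm_ne_norm h.ne', max_eq_left h.le]

theorem norm_sub_eq_left {a b : k} (h : ‖b‖ < ‖a‖) : ‖a - b‖ = ‖a‖ := by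
  rw [sub_eq_add_neg]; exact norm_add_eq_left (by rwa [norm_neg])

theorem norm_sub_eq_max {a b : k} (h : ‖a‖ ≠ ‖b‖) : ‖a - b‖ = max ‖a‖ ‖b‖ := by
  rw [sub_eq_add_neg, IsUltrametricDist.norm_add_eq_max_of_norm_ne_norm (by rwa [norm_neg]),
    norm_neg]

/-- Units congruent to `1` are squares if `2` is a unit. -/
theorem exists_sqrt_one_add [CompleteSpace k] (h2 : ‖(2 : k)‖ = 1) (m : k) (hm : ‖m‖ < 1) :
    ∃ s : k, s ^ 2 = 1 + m ∧ ‖s - 1‖ < 1 := by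
  have h20 : (2 : k) ≠ 0 := norm_ne_zero_iff.mp (by rw [h2]; exact one_ne_zero)
  set B : Set k := Metric.closedBall 0 ‖m‖ with hB
  -- A fixed point `t` satisfies `t ^ 2 + 2 * t = m`, that is `(1 + t) ^ 2 = 1 + m`. The map is
  -- contracting because `2` is a unit and `‖m‖ < 1`.
  set f : k → k := fun t => (m - t ^ 2) / 2 with hf
  have hmB : ∀ t, t ∈ B ↔ ‖t‖ ≤ ‖m‖ := fun t => by simp [hB]
  have hmaps : Set.MapsTo f B B := by
    intro t ht
    rw [hmB] at ht ⊢
    simp only [hf, norm_div, h2, div_one]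
    refine norm_sub_le_of_le le_rfl ?_
    rw [norm_pow, pow_two]
    nlinarith [norm_nonneg t, norm_nonneg m]
  have hlip : ContractingWith ⟨‖m‖, norm_nonneg m⟩ (hmaps.restrict f B B) := by
    refine ⟨by exact_mod_cast hm, LipschitzWith.of_dist_le_mul ?_⟩
    rintro ⟨a, ha⟩ ⟨b, hb⟩
    rw [hmB] at ha hb
    simp only [Subtype.dist_eq, Set.MapsTo.val_restrict_apply, hf, dist_eq_norm]
    have : (m - a ^ 2) / 2 - (m - b ^ 2) / 2 = (-(a + b) / 2) * (a - b) := by field_simp; ring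
    rw [this, norm_mul, norm_div, h2, div_one, norm_neg]
    exact mul_le_mul_of_nonneg_right (norm_add_le_of_le ha hb) (norm_nonneg _)
  have h0 : (0 : k) ∈ B := by simp [hB]
  obtain ⟨t, htB, htf, -⟩ := hlip.exists_fixedPoint' (Metric.isClosed_closedBall.isComplete)
    hmaps h0 (edist_ne_top _ _)
  refine ⟨1 + t, ?_, ?_⟩
  · have : (m - t ^ 2) / 2 = t := htf
    rw [div_eq_iff h20] at this
    linear_combination -this
  · rw [add_sub_cancel_left]
    exact ((hmB t).mp htB).trans_lt hm

theorem isDiscreteValuationRing_integer [ProperSpace k] :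
    IsDiscreteValuationRing (Valued.integer k) ∧
      Finite (IsLocalRing.ResidueField (Valued.integer k)) := by
  have hc : CompactSpace (Valued.integer k) := by
    refine isCompact_iff_compactSpace.mp ?_
    have : (Valued.integer k : Set k) = Metric.closedBall 0 1 := by
      ext x; simp [Valued.integer.mem_iff]
    rw [this]
    exact isCompact_closedBall 0 1
  have : (Valued.v : Valuation k NNReal).RankOne :=
    inferInstanceAs (NormedField.valuation (K := k)).RankOne
  have := Valued.integer.compactSpace_iff_completeSpace_and_isDiscreteValuationRing_and_finite_residueField.mp
    hc
  exact this.2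

theorem residue_eq_zero_iff (a : Valued.integer k) :
    IsLocalRing.residue (Valued.integer k) a = 0 ↔ ‖(a : k)‖ < 1 := by
  rw [IsLocalRing.residue_eq_zero_iff, IsLocalRing.mem_maximalIdeal, mem_nonunits_iff,
    Valued.integer.isUnit_iff_norm_eq_one]
  have h := Valued.integer.norm_le_one a
  exact ⟨fun h' => lt_of_le_of_ne h h', fun h' => h'.ne⟩

theorem exists_norm_eq_zpow [ProperSpace k] {ϖ : Valued.integer k} (hϖ : Irreducible ϖ) (t : k)
    (ht : t ≠ 0) : ∃ m : ℤ, ‖t‖ = ‖(ϖ : k)‖ ^ m := by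
  have := (isDiscreteValuationRing_integer (k := k)).1
  have key : ∀ t : k, t ≠ 0 → ‖t‖ ≤ 1 → ∃ m : ℤ, ‖t‖ = ‖(ϖ : k)‖ ^ m := by
    intro t ht h1
    obtain ⟨n, v, hv⟩ := IsDiscreteValuationRing.eq_unit_mul_pow_irreducible
      (x := (⟨t, Valued.integer.mem_iff.mpr h1⟩ : Valued.integer k))
      (by simpa [Subtype.ext_iff] using ht) hϖ
    refine ⟨n, ?_⟩
    have := congrArg (fun a : Valued.integer k => ‖(a : k)‖) hv
    simpa using this
  rcases le_total ‖t‖ 1 with h | h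
  · exact key t ht h
  · obtain ⟨m, hm⟩ := key t⁻¹ (inv_ne_zero ht) (by rw [norm_inv]; exact inv_le_one_of_one_le₀ h)
    refine ⟨-m, ?_⟩
    rw [zpow_neg, ← hm, norm_inv, inv_inv]

theorem norm_two_eq_one (hodd : ringChar (IsLocalRing.ResidueField (Valued.integer k)) ≠ 2) :
    ‖(2 : k)‖ = 1 := by
  have h := Ring.two_ne_zero hodd
  have h1 : ¬ ‖((2 : Valued.integer k) : k)‖ < 1 := by
    rw [← residue_eq_zero_iff, map_ofNat]
    exact h
  have h2 := Valued.integer.norm_le_one (2 : Valued.integer k)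
  exact le_antisymm h2 (not_lt.mp h1)

/-- Cancellation is possible only if `‖r‖ = ‖i‖`. A smaller value would make `(r / i) ^ 2 / u`
congruent to `1`, hence a square, and `u` would be a square too. -/
theorem norm_sq_sub_mul_sq [CompleteSpace k] (h2 : ‖(2 : k)‖ = 1) {u : k} (hu : ‖u‖ = 1)
    (hu' : ¬ IsSquare u) (r i : k) : ‖r ^ 2 - u * i ^ 2‖ = max ‖r‖ ‖i‖ ^ 2 := by
  have hsq : ∀ {a b : ℝ}, 0 ≤ a → 0 ≤ b → a ≠ b → a ^ 2 ≠ b ^ 2 := by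
    intro a b ha hb hab h
    exact hab ((pow_left_inj₀ ha hb two_ne_zero).mp h)
  by_cases hri : ‖r‖ = ‖i‖
  · rw [hri, max_self]
    by_cases hi : i = 0
    · have : r = 0 := by rw [hi, norm_zero, norm_eq_zero] at hri; exact hri
      simp [this, hi]
    have hi0 : ‖i‖ ≠ 0 := norm_ne_zero_iff.mpr hi
    have hc : ‖(r / i) ^ 2‖ = 1 := by rw [norm_pow, norm_div, hri, div_self hi0, one_pow]
    have hu0 : u ≠ 0 := norm_ne_zero_iff.mp (by rw [hu]; exact one_ne_zero)
    have hr0 : r ≠ 0 := norm_ne_zero_iff.mp (by rw [hri]; exact hi0)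
    have hle : ‖1 - (r / i) ^ 2 / u‖ ≤ 1 := norm_sub_le_of_le (by simp) (by
      rw [norm_div, hc, hu]; simp)
    have hge : ¬ ‖1 - (r / i) ^ 2 / u‖ < 1 := by
      intro hlt
      obtain ⟨s, hs, -⟩ := exists_sqrt_one_add h2 (-(1 - (r / i) ^ 2 / u)) (by rwa [norm_neg])
      have hs' : s ^ 2 * u = (r / i) ^ 2 := by
        rw [hs]; field_simp; ring
      have hs0 : s ≠ 0 := by
        rintro rfl
        have h0 : (r / i) ^ 2 ≠ 0 := pow_ne_zero 2 (div_ne_zero hr0 hi)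
        exact h0 (by rw [← hs']; ring)
      refine hu' ⟨r / i / s, ?_⟩
      have : (r / i / s) * (r / i / s) = (r / i) ^ 2 / s ^ 2 := by rw [← div_pow, sq]
      rw [this, ← hs']
      field_simp
    have h1 : ‖1 - (r / i) ^ 2 / u‖ = 1 := le_antisymm hle (not_lt.mp hge)
    have hfac' : r ^ 2 - u * i ^ 2 = -(u * (1 - (r / i) ^ 2 / u)) * i ^ 2 := by
      field_simp
      ring
    rw [hfac', norm_mul, norm_neg, norm_mul, h1, hu, norm_pow]
    ring
  · rw [norm_sub_eq_max, norm_mul, hu, one_mul, norm_pow, norm_pow]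
    · rcases le_total ‖r‖ ‖i‖ with h | h
      · rw [max_eq_right h, max_eq_right (pow_le_pow_left₀ (norm_nonneg _) h 2)]
      · rw [max_eq_left h, max_eq_left (pow_le_pow_left₀ (norm_nonneg _) h 2)]
    · rw [norm_mul, hu, one_mul, norm_pow, norm_pow]
      exact hsq (norm_nonneg _) (norm_nonneg _) hri

/-- Over the finite residue field the equation is solvable by counting the values of two quadratic
polynomials. In a solution one of the two unknowns is a unit, and that one is corrected by a square
root of an element near `1` to lift the solution. -/
theorem exists_sq_sub_mul_sq [ProperSpace k]
    (hodd : ringChar (IsLocalRing.ResidueField (Valued.integer k)) ≠ 2)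
    (u : Valued.integer k) (hu : ‖(u : k)‖ = 1) (a : k) (ha : ‖a‖ = 1) :
    ∃ r i : k, r ^ 2 - u * i ^ 2 = a := by
  have h2 := norm_two_eq_one hodd
  have := (isDiscreteValuationRing_integer (k := k)).2
  have := Fintype.ofFinite (IsLocalRing.ResidueField (Valued.integer k))
  have hu0 : (u : k) ≠ 0 := norm_ne_zero_iff.mp (by rw [hu]; exact one_ne_zero)
  have ha0 : a ≠ 0 := norm_ne_zero_iff.mp (by rw [ha]; exact one_ne_zero)
  set a' : Valued.integer k := ⟨a, Valued.integer.mem_iff.mpr ha.le⟩ with ha'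
  set R := IsLocalRing.residue (Valued.integer k) with hR
  have hRu : R u ≠ 0 := by rw [Ne, hR, residue_eq_zero_iff, hu]; exact lt_irrefl _
  obtain ⟨x, y, hxy⟩ := FiniteField.exists_root_sum_quadratic
    (f := (Polynomial.X ^ 2 - Polynomial.C (R a')))
    (g := Polynomial.C (-R u) * Polynomial.X ^ 2)
    (Polynomial.degree_X_pow_sub_C (by norm_num) _)
    (by rw [Polynomial.degree_C_mul_X_pow _ (neg_ne_zero.mpr hRu)]; rfl)
    (FiniteField.odd_card_of_char_ne_two hodd)
  obtain ⟨r, rfl⟩ := IsLocalRing.residue_surjective x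
  obtain ⟨i, rfl⟩ := IsLocalRing.residue_surjective y
  have hz : ‖((r ^ 2 - u * i ^ 2 - a' : Valued.integer k) : k)‖ < 1 := by
    rw [← residue_eq_zero_iff]
    simp only [Polynomial.eval_sub, Polynomial.eval_pow, Polynomial.eval_X, Polynomial.eval_C,
      Polynomial.eval_mul] at hxy
    simp only [map_sub, map_pow, map_mul]
    linear_combination hxy
  have hz' : ‖(r : k) ^ 2 - u * (i : k) ^ 2 - a‖ < 1 := by simpa [ha'] using hz
  clear_value R
  have hr1 := Valued.integer.norm_le_one r
  have hi1 := Valued.integer.norm_le_one i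
  generalize hrr : (r : k) = r' at hz'
  generalize hii : (i : k) = i' at hz'
  change ‖(r : k)‖ ≤ 1 at hr1
  change ‖(i : k)‖ ≤ 1 at hi1
  rw [hrr] at hr1
  rw [hii] at hi1
  have key : ∀ w c : k, ‖w‖ = 1 → ‖w ^ 2 - c‖ < 1 → ∃ s, s ^ 2 = c := by
    intro w c hw hwc
    have hw0 : w ≠ 0 := norm_ne_zero_iff.mp (by rw [hw]; exact one_ne_zero)
    obtain ⟨s, hs, -⟩ := exists_sqrt_one_add h2 (-((w ^ 2 - c) / w ^ 2))
      (by rw [norm_neg, norm_div, norm_pow, hw]; simpa using hwc)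
    refine ⟨s * w, ?_⟩
    rw [mul_pow, hs]
    field_simp
    ring
  by_cases hr : ‖r'‖ = 1
  · obtain ⟨s, hs⟩ := key r' (a + u * i' ^ 2) hr (by rwa [← sub_sub, sub_right_comm])
    exact ⟨s, i', by rw [hs]; ring⟩
  · have hr' : ‖r' ^ 2‖ < 1 := by
      rw [norm_pow]
      exact pow_lt_one₀ (norm_nonneg _) (lt_of_le_of_ne hr1 hr) two_ne_zero
    have hui : ‖u * i' ^ 2 + a‖ < 1 := by
      have : (u : k) * i' ^ 2 + a = r' ^ 2 - (r' ^ 2 - u * i' ^ 2 - a) := by ring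
      rw [this]
      exact norm_sub_lt_of_lt hr' hz'
    have hi : ‖i'‖ = 1 := by
      by_contra hne
      have : ‖(u : k) * i' ^ 2‖ < 1 := by
        rw [norm_mul, hu, one_mul, norm_pow]
        exact pow_lt_one₀ (norm_nonneg _) (lt_of_le_of_ne hi1 hne) two_ne_zero
      have h3 : a = (u * i' ^ 2 + a) - u * i' ^ 2 := by ring
      have := norm_sub_lt_of_lt hui this
      rw [← h3, ha] at this
      exact lt_irrefl _ this
    obtain ⟨s, hs⟩ := key i' ((r' ^ 2 - a) / u) hi (by
      have : i' ^ 2 - (r' ^ 2 - a) / u = -(r' ^ 2 - u * i' ^ 2 - a) / u := by field_simp; ring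
      rw [this, norm_div, norm_neg, hu, div_one]
      exact hz')
    refine ⟨r', s, ?_⟩
    rw [hs]
    field_simp
    ring

theorem BaseData.of_hyp [ProperSpace k]
    (hodd : ringChar (IsLocalRing.ResidueField (Valued.integer k)) ≠ 2)
    {ϖ : Valued.integer k} (hϖ : Irreducible ϖ) (hnorm : ‖(ϖ : k)‖ = (resCard k : ℝ)⁻¹)
    {u : Valued.integer k} (hu : IsUnit u) (hu' : ¬ IsSquare (u : k)) : BaseData u ϖ := by
  have h2 := norm_two_eq_one hodd
  have hu1 : ‖(u : k)‖ = 1 := Valued.integer.isUnit_iff_norm_eq_one.mp hu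
  have hfin := (isDiscreteValuationRing_integer (k := k)).2
  refine ⟨h2, ?_, hnorm, ?_, exists_sqrt_one_add h2, norm_sq_sub_mul_sq h2 hu1 hu',
    exists_sq_sub_mul_sq hodd u hu1⟩
  · have : 1 < resCard k := Finite.one_lt_card
    exact_mod_cast this
  · intro t ht
    obtain ⟨m, hm⟩ := exists_norm_eq_zpow hϖ t ht
    exact ⟨-m, by rw [hm, hnorm, inv_zpow, zpow_neg]⟩

end BaseField

/-! ### The reduced norm on `D` and the filtration it defines -/

section ReducedNorm

variable {k : Type*} [NontriviallyNormedField k] [IsUltrametricDist k] {u ϖ : Valued.integer k}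

/-- The reduced norm `a a*` of a quaternion. -/
def nr (a : D u ϖ) : k :=
  a.re ^ 2 - u * a.imI ^ 2 - ϖ * (a.imJ ^ 2 - u * a.imK ^ 2)

@[simp] theorem nr_zero : nr (0 : D u ϖ) = 0 := by simp [nr]

@[simp] theorem nr_one : nr (1 : D u ϖ) = 1 := by simp [nr]

theorem nr_mul (a b : D u ϖ) : nr (a * b) = nr a * nr b := by
  simp only [nr, QuaternionAlgebra.re_mul, QuaternionAlgebra.imI_mul, QuaternionAlgebra.imJ_mul,
    QuaternionAlgebra.imK_mul]
  ring

@[simp] theorem nr_star (a : D u ϖ) : nr (star a) = nr a := by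
  simp [nr]

@[simp] theorem nr_neg (a : D u ϖ) : nr (-a) = nr a := by
  simp [nr]

theorem nr_smul (c : k) (a : D u ϖ) : nr (c • a) = c ^ 2 * nr a := by
  simp only [nr, QuaternionAlgebra.re_smul, QuaternionAlgebra.imI_smul,
    QuaternionAlgebra.imJ_smul, QuaternionAlgebra.imK_smul, smul_eq_mul]
  ring

theorem mul_star_eq_nr (a : D u ϖ) : a * star a = QuaternionAlgebra.coe (nr a) := by
  ext <;> simp only [QuaternionAlgebra.re_mul, QuaternionAlgebra.imI_mul,
    QuaternionAlgebra.imJ_mul, QuaternionAlgebra.imK_mul, QuaternionAlgebra.re_star,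
    QuaternionAlgebra.imI_star, QuaternionAlgebra.imJ_star, QuaternionAlgebra.imK_star,
    QuaternionAlgebra.re_coe, QuaternionAlgebra.imI_coe, QuaternionAlgebra.imJ_coe,
    QuaternionAlgebra.imK_coe, nr] <;> ring

theorem star_mul_eq_nr (a : D u ϖ) : star a * a = QuaternionAlgebra.coe (nr a) := by
  ext <;> simp only [QuaternionAlgebra.re_mul, QuaternionAlgebra.imI_mul,
    QuaternionAlgebra.imJ_mul, QuaternionAlgebra.imK_mul, QuaternionAlgebra.re_star,
    QuaternionAlgebra.imI_star, QuaternionAlgebra.imJ_star, QuaternionAlgebra.imK_star,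
    QuaternionAlgebra.re_coe, QuaternionAlgebra.imI_coe, QuaternionAlgebra.imJ_coe,
    QuaternionAlgebra.imK_coe, nr] <;> ring

theorem BaseData.q_pos (h : BaseData u ϖ) : 0 < (resCard k : ℝ) := zero_lt_one.trans h.one_lt

theorem BaseData.norm_le_zpow_of_lt (h : BaseData u ϖ) {t : k} {m : ℤ}
    (ht : ‖t‖ < (resCard k : ℝ) ^ (m + 1)) : ‖t‖ ≤ (resCard k : ℝ) ^ m := by
  rcases eq_or_ne t 0 with rfl | h0
  · simp only [norm_zero]; exact (zpow_pos h.q_pos _).le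
  obtain ⟨n, hn⟩ := h.exists_norm t h0
  rw [hn] at ht ⊢
  rw [zpow_lt_zpow_iff_right₀ h.one_lt] at ht
  exact zpow_le_zpow_right₀ h.one_lt.le (by omega)

theorem BaseData.norm_le_zpow_of_sq (h : BaseData u ϖ) {t : k} {m : ℤ}
    (ht : ‖t‖ ^ 2 ≤ (resCard k : ℝ) ^ (2 * m + 1)) : ‖t‖ ≤ (resCard k : ℝ) ^ m := by
  rcases eq_or_ne t 0 with rfl | h0
  · simp only [norm_zero]; exact (zpow_pos h.q_pos _).le
  obtain ⟨n, hn⟩ := h.exists_norm t h0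
  rw [hn, ← zpow_natCast, ← zpow_mul, zpow_le_zpow_iff_right₀ h.one_lt] at ht
  rw [hn]
  push_cast at ht
  exact zpow_le_zpow_right₀ h.one_lt.le (by omega)

theorem max_norm_eq {V : Type*} [Norm V] (a b : V) : ∃ c : V, max ‖a‖ ‖b‖ = ‖c‖ := by
  rcases le_total ‖a‖ ‖b‖ with h | h
  · exact ⟨b, max_eq_right h⟩
  · exact ⟨a, max_eq_left h⟩

/-- The two parts of the reduced norm have norms that are even and odd powers of `q`, so they cannot
cancel; they agree only if both vanish. -/
theorem BaseData.norm_nr (h : BaseData u ϖ) (a : D u ϖ) :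
    ‖nr a‖ = max (max ‖a.re‖ ‖a.imI‖ ^ 2)
      ((resCard k : ℝ)⁻¹ * max ‖a.imJ‖ ‖a.imK‖ ^ 2) := by
  have hA := h.norm_form a.re a.imI
  have hB := h.norm_form a.imJ a.imK
  have hq := h.q_pos
  by_cases heq : ‖a.re ^ 2 - u * a.imI ^ 2‖ = ‖ϖ * (a.imJ ^ 2 - u * a.imK ^ 2)‖
  · obtain ⟨c, hc⟩ := max_norm_eq a.re a.imI
    obtain ⟨d, hd⟩ := max_norm_eq a.imJ a.imK
    have heq' := heq
    rw [norm_mul, h.norm_prime, hA, hB, hc, hd] at heq'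
    have hcd : c = 0 ∧ d = 0 := by
      by_contra hne
      have hc0 : c ≠ 0 := by
        rintro rfl
        refine hne ⟨rfl, ?_⟩
        simpa [hq.ne'] using heq'
      have hd0 : d ≠ 0 := by
        rintro rfl
        exact hc0 (by simpa using heq')
      obtain ⟨m, hm⟩ := h.exists_norm c hc0
      obtain ⟨n, hn⟩ := h.exists_norm d hd0
      rw [hm, hn, ← zpow_natCast, ← zpow_natCast, ← zpow_mul, ← zpow_mul, ← zpow_neg_one,
        ← zpow_add₀ hq.ne'] at heq'
      have := zpow_right_injective₀ hq h.one_lt.ne' heq'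
      push_cast at this
      omega
    rw [hc, hd, hcd.1, hcd.2]
    rw [hc, hcd.1] at hA
    rw [hd, hcd.2] at hB
    have e1 : a.re ^ 2 - u * a.imI ^ 2 = 0 := by
      rw [← norm_eq_zero, hA]; simp
    have e2 : a.imJ ^ 2 - u * a.imK ^ 2 = 0 := by
      rw [← norm_eq_zero, hB]; simp
    simp [nr, e1, e2]
  · rw [nr, norm_sub_eq_max heq, norm_mul, h.norm_prime, hA, hB]

theorem BaseData.nr_add_le (h : BaseData u ϖ) {a b : D u ϖ} {c : ℝ} (ha : ‖nr a‖ ≤ c)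
    (hb : ‖nr b‖ ≤ c) : ‖nr (a + b)‖ ≤ c := by
  have hq := h.q_pos
  rw [h.norm_nr] at ha hb ⊢
  have aux : ∀ x y z w : k, max ‖x + z‖ ‖y + w‖ ≤ max (max ‖x‖ ‖y‖) (max ‖z‖ ‖w‖) := by
    intro x y z w
    refine max_le ?_ ?_
    · refine (IsUltrametricDist.norm_add_le_max x z).trans (max_le ?_ ?_) <;> simp
    · refine (IsUltrametricDist.norm_add_le_max y w).trans (max_le ?_ ?_) <;> simp
  have aux2 : ∀ x y z w : k, max ‖x + z‖ ‖y + w‖ ^ 2 ≤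
      max (max ‖x‖ ‖y‖ ^ 2) (max ‖z‖ ‖w‖ ^ 2) := by
    intro x y z w
    refine (pow_le_pow_left₀ (by positivity) (aux x y z w) 2).trans ?_
    rcases le_total (max ‖x‖ ‖y‖) (max ‖z‖ ‖w‖) with hh | hh
    · rw [max_eq_right hh]; exact le_max_right _ _
    · rw [max_eq_left hh]; exact le_max_left _ _
  have ha1 := (le_max_left _ _).trans ha
  have ha2 := (le_max_right _ _).trans ha
  have hb1 := (le_max_left _ _).trans hb
  have hb2 := (le_max_right _ _).trans hb
  simp only [QuaternionAlgebra.re_add, QuaternionAlgebra.imI_add, QuaternionAlgebra.imJ_add,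
    QuaternionAlgebra.imK_add]
  refine max_le ((aux2 _ _ _ _).trans (max_le ha1 hb1)) ?_
  refine (mul_le_mul_of_nonneg_left (aux2 _ _ _ _) (by positivity)).trans ?_
  rw [mul_max_of_nonneg _ _ (by positivity)]
  exact max_le ha2 hb2

theorem BaseData.nr_add_lt (h : BaseData u ϖ) {a b : D u ϖ} {c : ℝ} (ha : ‖nr a‖ < c)
    (hb : ‖nr b‖ < c) : ‖nr (a + b)‖ < c :=
  (h.nr_add_le (le_max_left _ _) (le_max_right ‖nr a‖ ‖nr b‖)).trans_lt (max_lt ha hb)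

/-- The norm of the reduced norm in terms of coordinates, at odd exponents. -/
theorem BaseData.nr_le_odd (h : BaseData u ϖ) {a : D u ϖ} {m : ℤ} :
    ‖nr a‖ ≤ (resCard k : ℝ) ^ (2 * m + 1) ↔
      ‖a.re‖ ≤ (resCard k : ℝ) ^ m ∧ ‖a.imI‖ ≤ (resCard k : ℝ) ^ m ∧
      ‖a.imJ‖ ≤ (resCard k : ℝ) ^ (m + 1) ∧ ‖a.imK‖ ≤ (resCard k : ℝ) ^ (m + 1) := by
  have hq := h.q_pos
  have hsq : ∀ n : ℤ, ((resCard k : ℝ) ^ n) ^ 2 = (resCard k : ℝ) ^ (2 * n) := by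
    intro n; rw [← zpow_natCast, ← zpow_mul]; congr 1; push_cast; ring
  rw [h.norm_nr, max_le_iff]
  have e1 : ∀ x y : k, max ‖x‖ ‖y‖ ^ 2 ≤ (resCard k : ℝ) ^ (2 * m + 1) ↔
      ‖x‖ ≤ (resCard k : ℝ) ^ m ∧ ‖y‖ ≤ (resCard k : ℝ) ^ m := by
    intro x y
    obtain ⟨c, hc⟩ := max_norm_eq x y
    rw [← max_le_iff, hc]
    refine ⟨h.norm_le_zpow_of_sq, fun hle => ?_⟩
    refine (pow_le_pow_left₀ (norm_nonneg _) hle 2).trans ?_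
    rw [hsq]
    exact zpow_le_zpow_right₀ h.one_lt.le (by omega)
  have e2 : ∀ x y : k, (resCard k : ℝ)⁻¹ * max ‖x‖ ‖y‖ ^ 2 ≤ (resCard k : ℝ) ^ (2 * m + 1) ↔
      ‖x‖ ≤ (resCard k : ℝ) ^ (m + 1) ∧ ‖y‖ ≤ (resCard k : ℝ) ^ (m + 1) := by
    intro x y
    obtain ⟨c, hc⟩ := max_norm_eq x y
    rw [← max_le_iff, hc, inv_mul_le_iff₀ hq, ← zpow_one_add₀ hq.ne']
    rw [show (1 : ℤ) + (2 * m + 1) = 2 * (m + 1) by ring, ← hsq]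
    exact pow_le_pow_iff_left₀ (norm_nonneg _) (zpow_pos hq _).le two_ne_zero
  rw [e1, e2, and_assoc]

/-- The norm of the reduced norm in terms of coordinates, at even exponents. -/
theorem BaseData.nr_le_even (h : BaseData u ϖ) {a : D u ϖ} {m : ℤ} :
    ‖nr a‖ ≤ (resCard k : ℝ) ^ (2 * m) ↔
      ‖a.re‖ ≤ (resCard k : ℝ) ^ m ∧ ‖a.imI‖ ≤ (resCard k : ℝ) ^ m ∧
      ‖a.imJ‖ ≤ (resCard k : ℝ) ^ m ∧ ‖a.imK‖ ≤ (resCard k : ℝ) ^ m := by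
  have hq := h.q_pos
  have hsq : ∀ n : ℤ, ((resCard k : ℝ) ^ n) ^ 2 = (resCard k : ℝ) ^ (2 * n) := by
    intro n; rw [← zpow_natCast, ← zpow_mul]; congr 1; push_cast; ring
  rw [h.norm_nr, max_le_iff]
  have e1 : ∀ x y : k, max ‖x‖ ‖y‖ ^ 2 ≤ (resCard k : ℝ) ^ (2 * m) ↔
      ‖x‖ ≤ (resCard k : ℝ) ^ m ∧ ‖y‖ ≤ (resCard k : ℝ) ^ m := by
    intro x y
    obtain ⟨c, hc⟩ := max_norm_eq x y
    rw [← max_le_iff, hc, ← hsq]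
    exact pow_le_pow_iff_left₀ (norm_nonneg _) (zpow_pos hq _).le two_ne_zero
  have e2 : ∀ x y : k, (resCard k : ℝ)⁻¹ * max ‖x‖ ‖y‖ ^ 2 ≤ (resCard k : ℝ) ^ (2 * m) ↔
      ‖x‖ ≤ (resCard k : ℝ) ^ m ∧ ‖y‖ ≤ (resCard k : ℝ) ^ m := by
    intro x y
    obtain ⟨c, hc⟩ := max_norm_eq x y
    rw [← max_le_iff, hc, inv_mul_le_iff₀ hq, ← zpow_one_add₀ hq.ne', add_comm]
    refine ⟨h.norm_le_zpow_of_sq, fun hle => ?_⟩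
    refine (pow_le_pow_left₀ (norm_nonneg _) hle 2).trans ?_
    rw [hsq]
    exact zpow_le_zpow_right₀ h.one_lt.le (by omega)
  rw [e1, e2, and_assoc]

/-- This makes integrality a multiplicative condition, and coordinates can be avoided from here on
in estimates of products. -/
theorem BaseData.mem_order_iff (h : BaseData u ϖ) {a : D u ϖ} : a ∈ order u ϖ ↔ ‖nr a‖ ≤ 1 := by
  have := h.nr_le_even (a := a) (m := 0)
  rw [mul_zero, zpow_zero] at this
  rw [this]
  exact and_congr Valued.integer.mem_iff (and_congr Valued.integer.mem_iff
    (and_congr Valued.integer.mem_iff Valued.integer.mem_iff))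

/-- The inverse of a quaternion. -/
def invD (a : D u ϖ) : D u ϖ := (nr a)⁻¹ • star a

theorem mul_invD {a : D u ϖ} (ha : nr a ≠ 0) : a * invD a = 1 := by
  rw [invD, mul_smul_comm, mul_star_eq_nr, ← QuaternionAlgebra.coe_smul, smul_eq_mul,
    inv_mul_cancel₀ ha, QuaternionAlgebra.coe_one]

theorem invD_mul {a : D u ϖ} (ha : nr a ≠ 0) : invD a * a = 1 := by
  rw [invD, smul_mul_assoc, star_mul_eq_nr, ← QuaternionAlgebra.coe_smul, smul_eq_mul,
    inv_mul_cancel₀ ha, QuaternionAlgebra.coe_one]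

theorem nr_invD (a : D u ϖ) : nr (invD a) = (nr a)⁻¹ := by
  rw [invD, nr_smul, nr_star]
  by_cases ha : nr a = 0
  · simp [ha]
  · field_simp

end ReducedNorm

/-! ### Hermitian forms in coordinates: determinant, inverse and group action -/

section Forms

variable {k : Type*} [NontriviallyNormedField k] [IsUltrametricDist k] {u ϖ : Valued.integer k}

theorem ext_entries {x y : X u ϖ}
    (h : ∀ i j, (x.1 : Matrix (Fin 2) (Fin 2) (D u ϖ)) i j = y.1.1 i j) : x = y :=
  Subtype.ext (Units.ext (Matrix.ext h))

/-- The entry `x₁₁ ∈ k`. -/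
def ent₁ (x : X u ϖ) : k := (x.1.1 0 0).re

/-- The entry `x₂₂ ∈ k`. -/
def ent₂ (x : X u ϖ) : k := (x.1.1 1 1).re

/-- The entry `x₁₂ ∈ D`. -/
def off (x : X u ϖ) : D u ϖ := x.1.1 0 1

/-- The determinant `x₁₁ x₂₂ - Nrd(x₁₂)`. -/
def disc (x : X u ϖ) : k := ent₁ x * ent₂ x - nr (off x)

variable (h : BaseData u ϖ)

theorem star_entry (x : X u ϖ) (i j : Fin 2) : star (x.1.1 i j) = x.1.1 j i := by
  conv_rhs => rw [← x.2]
  rfl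

theorem entry_ten (x : X u ϖ) : x.1.1 1 0 = star (off x) := (star_entry x 0 1).symm

include h

theorem BaseData.two_ne : (2 : k) ≠ 0 :=
  norm_ne_zero_iff.mp (by rw [h.norm_two]; exact one_ne_zero)

theorem BaseData.eq_coe_of_star {a : D u ϖ} (ha : star a = a) : a = QuaternionAlgebra.coe a.re := by
  have h2 := h.two_ne
  have aux : ∀ t : k, -t = t → t = 0 := by
    intro t ht
    have : 2 * t = 0 := by linear_combination -ht
    exact (mul_eq_zero.mp this).resolve_left h2
  ext
  · rfl
  · exact aux _ (congrArg QuaternionAlgebra.imI ha)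
  · exact aux _ (congrArg QuaternionAlgebra.imJ ha)
  · exact aux _ (congrArg QuaternionAlgebra.imK ha)

theorem BaseData.entry_zero (x : X u ϖ) : x.1.1 0 0 = QuaternionAlgebra.coe (ent₁ x) :=
  h.eq_coe_of_star (star_entry x 0 0)

theorem BaseData.entry_one (x : X u ϖ) : x.1.1 1 1 = QuaternionAlgebra.coe (ent₂ x) :=
  h.eq_coe_of_star (star_entry x 1 1)

theorem BaseData.ext_form {x y : X u ϖ} (h1 : ent₁ x = ent₁ y) (h2 : ent₂ x = ent₂ y)
    (h3 : off x = off y) : x = y := by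
  refine ext_entries fun i j => ?_
  fin_cases i <;> fin_cases j
  · exact (h.entry_zero x).trans ((congrArg _ h1).trans (h.entry_zero y).symm)
  · exact h3
  · exact (entry_ten x).trans ((congrArg _ h3).trans (entry_ten y).symm)
  · exact (h.entry_one x).trans ((congrArg _ h2).trans (h.entry_one y).symm)

omit h

/-- The hermitian matrix with given entries. -/
def formMat (α γ : k) (β : D u ϖ) : Matrix (Fin 2) (Fin 2) (D u ϖ) :=
  !![QuaternionAlgebra.coe α, β; star β, QuaternionAlgebra.coe γ]

/-- The adjugate formula survives over `D` because the diagonal entries are central and `β` commutes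
with `star β`. -/
theorem formMat_mul_adj (α γ : k) (β : D u ϖ) :
    formMat α γ β * formMat γ α (-β) = (α * γ - nr β) • (1 : Matrix (Fin 2) (Fin 2) (D u ϖ)) := by
  refine Matrix.ext fun i j => ?_
  fin_cases i <;> fin_cases j <;>
    simp only [formMat, Matrix.mul_apply, Fin.sum_univ_two, Matrix.smul_apply, Fin.zero_eta,
      Fin.mk_one, Matrix.of_apply, Matrix.cons_val', Matrix.cons_val_zero, Matrix.cons_val_one,
      Matrix.cons_val_fin_one, Matrix.one_apply_eq, ne_eq, zero_ne_one, one_ne_zero,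
      not_false_eq_true, Matrix.one_apply_ne, star_neg, smul_zero, mul_neg, mul_star_eq_nr,
      star_mul_eq_nr] <;>
    ext <;> simp <;> ring

/-- The form with given entries. -/
def mkX (α γ : k) (β : D u ϖ) (hd : α * γ - nr β ≠ 0) : X u ϖ :=
  ⟨⟨formMat α γ β, (α * γ - nr β)⁻¹ • formMat γ α (-β), by
      rw [mul_smul_comm, formMat_mul_adj, smul_smul, inv_mul_cancel₀ hd, one_smul], by
      have := formMat_mul_adj γ α (-β)
      rw [nr_neg, neg_neg, mul_comm γ α] at this
      rw [smul_mul_assoc, this, smul_smul, inv_mul_cancel₀ hd, one_smul]⟩, by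
    refine Matrix.ext fun i j => ?_
    fin_cases i <;> fin_cases j <;> simp [formMat, Matrix.conjTranspose_apply]⟩

@[simp] theorem ent₁_mkX {α γ : k} {β : D u ϖ} (hd : α * γ - nr β ≠ 0) :
    ent₁ (mkX α γ β hd) = α := rfl

@[simp] theorem ent₂_mkX {α γ : k} {β : D u ϖ} (hd : α * γ - nr β ≠ 0) :
    ent₂ (mkX α γ β hd) = γ := rfl

@[simp] theorem off_mkX {α γ : k} {β : D u ϖ} (hd : α * γ - nr β ≠ 0) :
    off (mkX α γ β hd) = β := rfl

@[simp] theorem disc_mkX {α γ : k} {β : D u ϖ} (hd : α * γ - nr β ≠ 0) :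
    disc (mkX α γ β hd) = α * γ - nr β := rfl

include h

theorem BaseData.val_eq_formMat (x : X u ϖ) : x.1.1 = formMat (ent₁ x) (ent₂ x) (off x) := by
  refine Matrix.ext fun i j => ?_
  fin_cases i <;> fin_cases j
  · exact h.entry_zero x
  · rfl
  · exact entry_ten x
  · exact h.entry_one x

/-- If the determinant vanished, the invertible matrix would annihilate its own adjugate, so the
adjugate and with it the form would be zero. -/
theorem BaseData.disc_ne_zero (x : X u ϖ) : disc x ≠ 0 := by
  intro hd
  have h1 := formMat_mul_adj (ent₁ x) (ent₂ x) (off x)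
  rw [← h.val_eq_formMat x, show ent₁ x * ent₂ x - nr (off x) = 0 from hd, zero_smul,
    Units.mul_right_eq_zero] at h1
  have e1 : ent₂ x = 0 := by
    have := congrFun (congrFun h1 0) 0
    simpa [formMat] using congrArg QuaternionAlgebra.re this
  have e2 : ent₁ x = 0 := by
    have := congrFun (congrFun h1 1) 1
    simpa [formMat] using congrArg QuaternionAlgebra.re this
  have e3 : off x = 0 := by
    have := congrFun (congrFun h1 0) 1
    simpa [formMat] using this
  have h0 : x.1.1 = 0 := by
    rw [h.val_eq_formMat x, e1, e2, e3]
    refine Matrix.ext fun i j => ?_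
    fin_cases i <;> fin_cases j <;> simp [formMat]
  exact x.1.ne_zero h0

theorem BaseData.inv_eq (x : X u ϖ) :
    ent₁ (inv x) = (disc x)⁻¹ * ent₂ x ∧ ent₂ (inv x) = (disc x)⁻¹ * ent₁ x ∧
      off (inv x) = -((disc x)⁻¹ • off x) ∧ disc (inv x) = (disc x)⁻¹ := by
  have hd := h.disc_ne_zero x
  have hinv : (inv x).1.1 = (disc x)⁻¹ • formMat (ent₂ x) (ent₁ x) (-off x) := by
    have : (inv x).1 = (x.1)⁻¹ := rfl
    rw [this]
    refine Units.inv_eq_of_mul_eq_one_right ?_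
    rw [h.val_eq_formMat x, mul_smul_comm, formMat_mul_adj, smul_smul,
      show ent₁ x * ent₂ x - nr (off x) = disc x from rfl, inv_mul_cancel₀ hd, one_smul]
  have e1 : ent₁ (inv x) = (disc x)⁻¹ * ent₂ x := by
    rw [ent₁, hinv]; simp [formMat]
  have e2 : ent₂ (inv x) = (disc x)⁻¹ * ent₁ x := by
    rw [ent₂, hinv]; simp [formMat]
  have e3 : off (inv x) = -((disc x)⁻¹ • off x) := by
    rw [off, hinv]; simp [formMat]
  refine ⟨e1, e2, e3, ?_⟩
  rw [disc, e1, e2, e3, nr_neg, nr_smul]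
  have : (disc x)⁻¹ * ent₂ x * ((disc x)⁻¹ * ent₁ x) - (disc x)⁻¹ ^ 2 * nr (off x) =
      (disc x)⁻¹ ^ 2 * disc x := by simp only [disc]; ring
  rw [this, sq, mul_assoc, inv_mul_cancel₀ hd, mul_one]

omit h

/-- The value `v x v*` of the form `x` at the row vector `v = (a, b)`. -/
def val (x : X u ϖ) (a b : D u ϖ) : k :=
  ent₁ x * nr a + ent₂ x * nr b + 2 * (a * off x * star b).re

/-- The value `v x w*` of the sesquilinear form `x`. -/
def sesq (x : X u ϖ) (a b c d : D u ϖ) : D u ϖ :=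
  ent₁ x • (a * star c) + ent₂ x • (b * star d) + a * off x * star d + b * star (off x) * star c

theorem sesq_self (x : X u ϖ) (a b : D u ϖ) : sesq x a b a b = QuaternionAlgebra.coe (val x a b) := by
  have : b * star (off x) * star a = star (a * off x * star b) := by
    simp only [star_mul, star_star, mul_assoc]
  rw [sesq, this, mul_star_eq_nr, mul_star_eq_nr, val, add_assoc]
  generalize a * off x * star b = c
  ext <;> simp [QuaternionAlgebra.re_ofNat, QuaternionAlgebra.imI_ofNat,
    QuaternionAlgebra.imJ_ofNat, QuaternionAlgebra.imK_ofNat]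
  ring

include h

theorem BaseData.act_entry (g : G u ϖ) (x : X u ϖ) (i j : Fin 2) :
    (act g x).1.1 i j = sesq x (g.1 i 0) (g.1 i 1) (g.1 j 0) (g.1 j 1) := by
  have : (act g x).1.1 = g.1 * x.1.1 * (g.1)ᴴ := rfl
  rw [this, h.val_eq_formMat x]
  simp only [Matrix.mul_apply, Fin.sum_univ_two, Matrix.conjTranspose_apply, formMat,
    Matrix.of_apply, Matrix.cons_val', Matrix.cons_val_zero, Matrix.cons_val_one,
    Matrix.cons_val_fin_one, sesq, QuaternionAlgebra.mul_coe_eq_smul, add_mul, smul_mul_assoc]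
  abel

theorem BaseData.ent₁_act (g : G u ϖ) (x : X u ϖ) :
    ent₁ (act g x) = val x (g.1 0 0) (g.1 0 1) := by
  rw [ent₁, h.act_entry, sesq_self, QuaternionAlgebra.re_coe]

theorem BaseData.ent₂_act (g : G u ϖ) (x : X u ϖ) :
    ent₂ (act g x) = val x (g.1 1 0) (g.1 1 1) := by
  rw [ent₂, h.act_entry, sesq_self, QuaternionAlgebra.re_coe]

theorem BaseData.off_act (g : G u ϖ) (x : X u ϖ) :
    off (act g x) = sesq x (g.1 0 0) (g.1 0 1) (g.1 1 0) (g.1 1 1) := h.act_entry g x 0 1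

omit h

theorem act_mul (g g' : G u ϖ) (x : X u ϖ) : act (g * g') x = act g (act g' x) := by
  refine Subtype.ext ?_
  simp only [act, star_mul, mul_assoc]

theorem act_one (x : X u ϖ) : act 1 x = x := by
  refine Subtype.ext ?_
  simp [act]

theorem act_inclK_inv (κ : K u ϖ) (x : X u ϖ) : act (inclK u ϖ κ⁻¹) (act (inclK u ϖ κ) x) = x := by
  rw [← act_mul, ← map_mul, inv_mul_cancel, map_one, act_one]

theorem inv_act (g : G u ϖ) (x : X u ϖ) : inv (act g x) = act (star g⁻¹) (inv x) := by
  refine Subtype.ext ?_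
  simp only [act, inv, mul_inv_rev, star_star, star_inv, mul_assoc]

theorem inclK_apply (κ : K u ϖ) (i j : Fin 2) : (inclK u ϖ κ).1 i j = (κ.1 i j : D u ϖ) := rfl

/-- The reduced norm of a scalar in `k`. -/
theorem nrd_one_block (M : Matrix (Fin 1) (Fin 1) (D u ϖ)) (a : k)
    (ha : M 0 0 = QuaternionAlgebra.coe a) : nrd u ϖ M = a ^ 2 := by
  rw [nrd, ← Matrix.det_reindex_self (finProdFinEquiv : Fin 1 × Fin 2 ≃ Fin (1 * 2))]
  have : ∀ N : Matrix (Fin (1 * 2)) (Fin (1 * 2)) (QuadraticAlgebra k (u : k) 0),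
    N.det = N 0 0 * N 1 1 - N 0 1 * N 1 0 := fun N => Matrix.det_fin_two N
  rw [this]
  have e0 : (finProdFinEquiv.symm (0 : Fin (1 * 2)) : Fin 1 × Fin 2) = (0, 0) := by decide
  have e1 : (finProdFinEquiv.symm (1 : Fin (1 * 2)) : Fin 1 × Fin 2) = (0, 1) := by decide
  simp [Matrix.comp_apply, e0, e1, ha, split, sq]

/-- Splitting `D` sends a `2 × 2` hermitian form to a `4 × 4` matrix of this shape, with scalar
diagonal blocks. -/
theorem det_four_scalar_blocks {R : Type*} [CommRing R] (a m b c d e f g p r : R) :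
    Matrix.det !![a, 0, b, c; 0, a, d, e; f, g, m, 0; p, r, 0, m] =
      (a * m) ^ 2 - a * m * (b * f + c * p + d * g + e * r) + (b * e - c * d) * (f * r - g * p) := by
  simp [Matrix.det_succ_row_zero, Fin.sum_univ_succ, Fin.succAbove]
  ring

theorem nrd_formMat (α γ : k) (β : D u ϖ) : nrd u ϖ (formMat α γ β) = (α * γ - nr β) ^ 2 := by
  rw [nrd, ← Matrix.det_reindex_self (finProdFinEquiv : Fin 2 × Fin 2 ≃ Fin (2 * 2))]
  have e0 : (finProdFinEquiv.symm (0 : Fin (2 * 2)) : Fin 2 × Fin 2) = (0, 0) := by decide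
  have e1 : (finProdFinEquiv.symm (1 : Fin (2 * 2)) : Fin 2 × Fin 2) = (0, 1) := by decide
  have e2 : (finProdFinEquiv.symm (2 : Fin (2 * 2)) : Fin 2 × Fin 2) = (1, 0) := by decide
  have e3 : (finProdFinEquiv.symm (3 : Fin (2 * 2)) : Fin 2 × Fin 2) = (1, 1) := by decide
  set N := (Matrix.reindex finProdFinEquiv finProdFinEquiv)
    (Matrix.comp (Fin 2) (Fin 2) (Fin 2) (Fin 2) _ ((formMat α γ β).map (split u ϖ))) with hN
  change (Matrix.det (n := Fin 4) N).re = _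
  have hN' : (N : Matrix (Fin 4) (Fin 4) (QuadraticAlgebra k (u : k) 0)) =
      !![⟨α, 0⟩, 0, ⟨β.re, β.imI⟩, ⟨ϖ * β.imJ, ϖ * β.imK⟩;
         0, ⟨α, 0⟩, ⟨β.imJ, -β.imK⟩, ⟨β.re, -β.imI⟩;
         ⟨β.re, -β.imI⟩, ⟨-(ϖ * β.imJ), -(ϖ * β.imK)⟩, ⟨γ, 0⟩, 0;
         ⟨-β.imJ, β.imK⟩, ⟨β.re, β.imI⟩, 0, ⟨γ, 0⟩] := by
    refine Matrix.ext fun i j => ?_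
    fin_cases i <;> fin_cases j <;>
      simp [hN, Matrix.comp_apply, e0, e1, e2, e3, split, formMat] <;> ext <;> simp
  rw [hN']
  rw [det_four_scalar_blocks]
  simp [sq]
  simp only [nr]
  ring

include h

theorem BaseData.absd_zero (x : X u ϖ) : absd x 0 = ‖ent₁ x‖ := by
  rw [absd, nrd_one_block _ (ent₁ x) (h.entry_zero x), norm_pow, Real.sqrt_sq (norm_nonneg _)]

theorem BaseData.nrd_eq (x : X u ϖ) : nrd u ϖ x.1.1 = disc x ^ 2 := by
  rw [h.val_eq_formMat x, nrd_formMat]; rfl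

theorem BaseData.absd_one (x : X u ϖ) : absd x 1 = ‖disc x‖ := by
  have : nrd u ϖ ((x.1 : Matrix (Fin 2) (Fin 2) (D u ϖ)).submatrix
      (Fin.castLE (Nat.succ_le_of_lt (1 : Fin 2).isLt))
      (Fin.castLE (Nat.succ_le_of_lt (1 : Fin 2).isLt))) = disc x ^ 2 := h.nrd_eq x
  rw [absd, this, norm_pow, Real.sqrt_sq (norm_nonneg _)]

end Forms

/-! ### The invariants `(m, n)` of a `K`-orbit -/

section Orbits

variable {k : Type*} [NontriviallyNormedField k] [IsUltrametricDist k] {u ϖ : Valued.integer k}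

/-- All values of the form at integral vectors have norm at most `q ^ m`. -/
def Lev (m : ℤ) (x : X u ϖ) : Prop :=
  ‖ent₁ x‖ ≤ (resCard k : ℝ) ^ m ∧ ‖ent₂ x‖ ≤ (resCard k : ℝ) ^ m ∧
    ‖nr (off x)‖ ≤ (resCard k : ℝ) ^ (2 * m + 1)

/-- The invariants of a `K`-orbit: the largest value `q ^ m` at integral vectors, and the norm
`q ^ (2 * m + 1 - n)` of the determinant. -/
def IsType (m : ℤ) (n : ℕ) (x : X u ϖ) : Prop :=
  Lev m x ∧ ¬ Lev (m - 1) x ∧ ‖disc x‖ = (resCard k : ℝ) ^ (2 * m + 1 - n)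

variable (h : BaseData u ϖ)

include h

theorem Lev.mono {m m' : ℤ} (hm : m ≤ m') {x : X u ϖ} (hx : Lev m x) : Lev m' x := by
  have h1 := h.one_lt.le
  exact ⟨hx.1.trans (zpow_le_zpow_right₀ h1 hm), hx.2.1.trans (zpow_le_zpow_right₀ h1 hm),
    hx.2.2.trans (zpow_le_zpow_right₀ h1 (by omega))⟩

/-- The trace is integral on `Π⁻¹` times the maximal order, not only on the order itself. This is
why `Lev` allows the exponent `2 * m + 1` for the off-diagonal entry. -/
theorem BaseData.norm_re_le {a : D u ϖ} {m : ℤ} (ha : ‖nr a‖ ≤ (resCard k : ℝ) ^ (2 * m + 1)) :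
    ‖2 * a.re‖ ≤ (resCard k : ℝ) ^ m := by
  rw [norm_mul, h.norm_two, one_mul]
  exact (h.nr_le_odd.mp ha).1

omit h

theorem norm_mul_nr_le {t : k} {a : D u ϖ} {c : ℝ} (ht : ‖t‖ ≤ c) (ha : ‖nr a‖ ≤ 1) :
    ‖t * nr a‖ ≤ c := by
  rw [norm_mul]
  calc ‖t‖ * ‖nr a‖ ≤ c * 1 := mul_le_mul ht ha (norm_nonneg _) ((norm_nonneg _).trans ht)
    _ = c := mul_one c

theorem norm_nr_mul₃_le {a b c : D u ϖ} {r : ℝ} (ha : ‖nr a‖ ≤ 1) (hb : ‖nr b‖ ≤ r)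
    (hc : ‖nr c‖ ≤ 1) : ‖nr (a * b * star c)‖ ≤ r := by
  rw [nr_mul, nr_mul, nr_star, mul_comm (nr a)]
  exact norm_mul_nr_le (norm_mul_nr_le hb ha) hc

include h

theorem Lev.val_le {m : ℤ} {x : X u ϖ} (hx : Lev m x) {a b : D u ϖ} (ha : ‖nr a‖ ≤ 1)
    (hb : ‖nr b‖ ≤ 1) : ‖val x a b‖ ≤ (resCard k : ℝ) ^ m :=
  norm_add_le_of_le (norm_add_le_of_le (norm_mul_nr_le hx.1 ha) (norm_mul_nr_le hx.2.1 hb))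
    (h.norm_re_le (norm_nr_mul₃_le ha hx.2.2 hb))

theorem Lev.sesq_le {m : ℤ} {x : X u ϖ} (hx : Lev m x) {a b c d : D u ϖ} (ha : ‖nr a‖ ≤ 1)
    (hb : ‖nr b‖ ≤ 1) (hc : ‖nr c‖ ≤ 1) (hd : ‖nr d‖ ≤ 1) :
    ‖nr (sesq x a b c d)‖ ≤ (resCard k : ℝ) ^ (2 * m + 1) := by
  have hq := h.q_pos
  have hs : ∀ t : k, ‖t‖ ≤ (resCard k : ℝ) ^ m → ∀ a b : D u ϖ, ‖nr a‖ ≤ 1 → ‖nr b‖ ≤ 1 →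
      ‖nr (t • (a * star b))‖ ≤ (resCard k : ℝ) ^ (2 * m + 1) := by
    intro t ht a b ha hb
    rw [nr_smul, nr_mul, nr_star, norm_mul, norm_mul, norm_pow]
    calc ‖t‖ ^ 2 * (‖nr a‖ * ‖nr b‖) ≤ ((resCard k : ℝ) ^ m) ^ 2 * (1 * 1) := by gcongr
      _ = (resCard k : ℝ) ^ (2 * m) := by
        rw [← zpow_natCast, ← zpow_mul]
        norm_num
        rw [mul_comm]
      _ ≤ _ := zpow_le_zpow_right₀ h.one_lt.le (by omega)
  refine h.nr_add_le (h.nr_add_le (h.nr_add_le (hs _ hx.1 _ _ ha hc) (hs _ hx.2.1 _ _ hb hd))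
    (norm_nr_mul₃_le ha hx.2.2 hd)) (norm_nr_mul₃_le hb ?_ hc)
  rw [nr_star]
  exact hx.2.2

theorem BaseData.nr_entry_le (κ : K u ϖ) (i j : Fin 2) : ‖nr ((inclK u ϖ κ).1 i j)‖ ≤ 1 :=
  h.mem_order_iff.mp (κ.1 i j).2

theorem Lev.act_of_integral {m : ℤ} {x : X u ϖ} (hx : Lev m x) (g : G u ϖ)
    (hκ : ∀ i j, ‖nr (g.1 i j)‖ ≤ 1) : Lev m (QHerm.act g x) := by
  refine ⟨?_, ?_, ?_⟩
  · rw [h.ent₁_act]; exact hx.val_le h (hκ _ _) (hκ _ _)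
  · rw [h.ent₂_act]; exact hx.val_le h (hκ _ _) (hκ _ _)
  · rw [h.off_act]; exact hx.sesq_le h (hκ _ _) (hκ _ _) (hκ _ _) (hκ _ _)

theorem Lev.act {m : ℤ} {x : X u ϖ} (hx : Lev m x) (κ : K u ϖ) :
    Lev m (QHerm.act (inclK u ϖ κ) x) :=
  hx.act_of_integral h _ (h.nr_entry_le κ)

theorem lev_act_iff {m : ℤ} {x : X u ϖ} (κ : K u ϖ) : Lev m (act (inclK u ϖ κ) x) ↔ Lev m x := by
  refine ⟨fun hx => ?_, fun hx => hx.act h κ⟩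
  have := hx.act h κ⁻¹
  rwa [act_inclK_inv] at this

theorem Lev.disc_le {m : ℤ} {x : X u ϖ} (hx : Lev m x) :
    ‖disc x‖ ≤ (resCard k : ℝ) ^ (2 * m + 1) := by
  refine norm_sub_le_of_le ?_ hx.2.2
  have hq := h.q_pos
  rw [norm_mul]
  calc ‖ent₁ x‖ * ‖ent₂ x‖ ≤ (resCard k : ℝ) ^ m * (resCard k : ℝ) ^ m :=
        mul_le_mul hx.1 hx.2.1 (norm_nonneg _) (zpow_pos hq _).le
    _ = (resCard k : ℝ) ^ (m + m) := (zpow_add₀ hq.ne' _ _).symm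
    _ ≤ _ := zpow_le_zpow_right₀ h.one_lt.le (by omega)

theorem BaseData.exists_disc (x : X u ϖ) : ∃ e : ℤ, ‖disc x‖ = (resCard k : ℝ) ^ e :=
  h.exists_norm _ (h.disc_ne_zero x)

theorem Lev.exists_le (x : X u ϖ) : ∃ m, Lev m x := by
  have key : ∀ t : k, ∃ m : ℤ, ‖t‖ ≤ (resCard k : ℝ) ^ m := by
    intro t
    rcases eq_or_ne t 0 with rfl | ht
    · exact ⟨0, by simp⟩
    · obtain ⟨m, hm⟩ := h.exists_norm t ht
      exact ⟨m, hm.le⟩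
  obtain ⟨a, ha⟩ := key (ent₁ x)
  obtain ⟨b, hb⟩ := key (ent₂ x)
  obtain ⟨c, hc⟩ := key (nr (off x))
  refine ⟨max a (max b (max c 0)), ha.trans (zpow_le_zpow_right₀ h.one_lt.le (by omega)),
    hb.trans (zpow_le_zpow_right₀ h.one_lt.le (by omega)),
    hc.trans (zpow_le_zpow_right₀ h.one_lt.le (by omega))⟩

/-- The determinant is not zero and is bounded in terms of the level, so the levels of a form are
bounded below. -/
theorem Lev.exists_min (x : X u ϖ) : ∃ m, Lev m x ∧ ¬ Lev (m - 1) x := by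
  obtain ⟨e, he⟩ := h.exists_disc x
  have hbd : ∀ m, Lev m x → e / 2 - 1 ≤ m := by
    intro m hm
    have := hm.disc_le h
    rw [he, zpow_le_zpow_iff_right₀ h.one_lt] at this
    omega
  obtain ⟨m, hm, hmin⟩ := Int.exists_least_of_bdd ⟨_, hbd⟩ (Lev.exists_le h x)
  exact ⟨m, hm, fun hm' => by have := hmin _ hm'; omega⟩

/-- The inverse is the adjugate divided by the determinant, and passing to the adjugate only
exchanges the diagonal entries and changes a sign. -/
theorem lev_inv_iff {m e : ℤ} {x : X u ϖ} (he : ‖disc x‖ = (resCard k : ℝ) ^ e) :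
    Lev m (inv x) ↔ Lev (m + e) x := by
  obtain ⟨h1, h2, h3, -⟩ := h.inv_eq x
  have hq := h.q_pos
  rw [Lev, h1, h2, h3, nr_neg, nr_smul, norm_mul, norm_mul, norm_mul, norm_pow, norm_inv, he,
    inv_mul_le_iff₀ (zpow_pos hq _), inv_mul_le_iff₀ (zpow_pos hq _), inv_pow,
    inv_mul_le_iff₀ (pow_pos (zpow_pos hq _) _), Lev, ← zpow_add₀ hq.ne', ← zpow_natCast,
    ← zpow_mul, ← zpow_add₀ hq.ne']
  have e1 : e + m = m + e := add_comm _ _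
  have e2 : e * ((2 : ℕ) : ℤ) + (2 * m + 1) = 2 * (m + e) + 1 := by push_cast; ring
  rw [e1, e2]
  tauto

theorem lev_inv_act_iff {m : ℤ} {x : X u ϖ} (κ : K u ϖ) :
    Lev m (inv (act (inclK u ϖ κ) x)) ↔ Lev m (inv x) := by
  have key : ∀ (κ : K u ϖ) (x : X u ϖ), Lev m (inv x) → Lev m (inv (act (inclK u ϖ κ) x)) := by
    intro κ x hx
    rw [inv_act, ← map_inv]
    refine hx.act_of_integral h _ fun i j => ?_
    have : (star (inclK u ϖ κ⁻¹)).1 i j = star ((inclK u ϖ κ⁻¹).1 j i) := rfl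
    rw [this, nr_star]
    exact h.nr_entry_le _ _ _
  refine ⟨fun hx => ?_, key κ x⟩
  have := key κ⁻¹ _ hx
  rwa [act_inclK_inv] at this

/-- Multiplicativity of the determinant is not needed: the levels of a form and of its inverse are
both `K`-invariant, and the norm of the determinant is the shift between them. The shift is well
defined because a least level exists. -/
theorem norm_disc_act (κ : K u ϖ) (x : X u ϖ) : ‖disc (act (inclK u ϖ κ) x)‖ = ‖disc x‖ := by
  obtain ⟨e, he⟩ := h.exists_disc x
  obtain ⟨e', he'⟩ := h.exists_disc (act (inclK u ϖ κ) x)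
  obtain ⟨m, hm, hm'⟩ := Lev.exists_min h x
  have key : ∀ j, Lev (j + e') x ↔ Lev (j + e) x := fun j => by
    rw [← lev_act_iff h κ, ← lev_inv_iff h he', lev_inv_act_iff h, lev_inv_iff h he]
  have h1 : e ≤ e' := by
    by_contra hlt
    have := (key (m - e)).mpr (by rwa [sub_add_cancel])
    exact hm' (this.mono h (by omega))
  have h2 : e' ≤ e := by
    by_contra hlt
    have := (key (m - e')).mp (by rwa [sub_add_cancel])
    exact hm' (this.mono h (by omega))
  rw [he, he', le_antisymm h1 h2]

theorem IsType.act {m : ℤ} {n : ℕ} {x : X u ϖ} (hx : IsType m n x) (κ : K u ϖ) :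
    IsType m n (QHerm.act (inclK u ϖ κ) x) := by
  rwa [IsType, lev_act_iff h, lev_act_iff h, norm_disc_act h]

theorem IsType.exists (x : X u ϖ) : ∃ m n, IsType m n x := by
  obtain ⟨m, hm, hm'⟩ := Lev.exists_min h x
  obtain ⟨e, he⟩ := h.exists_disc x
  have hle := hm.disc_le h
  rw [he, zpow_le_zpow_iff_right₀ h.one_lt] at hle
  refine ⟨m, (2 * m + 1 - e).toNat, hm, hm', ?_⟩
  rw [he]
  congr 1
  omega

theorem IsType.unique {m m' : ℤ} {n n' : ℕ} {x : X u ϖ} (hx : IsType m n x)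
    (hx' : IsType m' n' x) : m = m' ∧ n = n' := by
  have key : ∀ {m m' : ℤ} {n n' : ℕ}, IsType m n x → IsType m' n' x → m ≤ m' := by
    intro m m' n n' h1 h2
    by_contra hlt
    exact h1.2.1 (h2.1.mono h (by omega))
  have hm := le_antisymm (key hx hx') (key hx' hx)
  refine ⟨hm, ?_⟩
  have := hx.2.2.symm.trans hx'.2.2
  have := zpow_right_injective₀ h.q_pos h.one_lt.ne' this
  omega

theorem IsType.inv {m : ℤ} {n : ℕ} {x : X u ϖ} (hx : IsType m n x) :
    IsType (n - 1 - m) n (QHerm.inv x) := by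
  refine ⟨?_, ?_, ?_⟩
  · rw [lev_inv_iff h hx.2.2]
    convert hx.1 using 1; ring
  · rw [lev_inv_iff h hx.2.2]
    convert hx.2.1 using 2; ring
  · rw [(h.inv_eq x).2.2.2, norm_inv, hx.2.2, ← zpow_neg]
    congr 1; ring

omit h

theorem val_scale (x y : X u ϖ) (c : k) (h1 : ent₁ y = c * ent₁ x) (h2 : ent₂ y = c * ent₂ x)
    (h3 : off y = c • off x) (a b : D u ϖ) : val y a b = c * val x a b := by
  simp only [val, h1, h2, h3, mul_smul_comm, smul_mul_assoc, QuaternionAlgebra.re_smul, smul_eq_mul]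
  ring

theorem sesq_scale (x y : X u ϖ) (c : k) (h1 : ent₁ y = c * ent₁ x) (h2 : ent₂ y = c * ent₂ x)
    (h3 : off y = c • off x) (a b a' b' : D u ϖ) :
    sesq y a b a' b' = c • sesq x a b a' b' := by
  simp only [sesq, h1, h2, h3, mul_smul_comm, smul_mul_assoc, smul_add, mul_smul,
    QuaternionAlgebra.star_smul]

theorem disc_scale_aux (x : X u ϖ) (c : k) :
    c * ent₁ x * (c * ent₂ x) - nr (c • off x) = c ^ 2 * disc x := by
  rw [nr_smul, disc]; ring

include h

theorem BaseData.exists_scale (x : X u ϖ) {c : k} (hc : c ≠ 0) :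
    ∃ y : X u ϖ, ent₁ y = c * ent₁ x ∧ ent₂ y = c * ent₂ x ∧ off y = c • off x := by
  have : c * ent₁ x * (c * ent₂ x) - nr (c • off x) ≠ 0 := by
    rw [disc_scale_aux]; exact mul_ne_zero (pow_ne_zero 2 hc) (h.disc_ne_zero x)
  exact ⟨mkX _ _ _ this, rfl, rfl, rfl⟩

theorem IsType.scale {m j : ℤ} {n : ℕ} {x y : X u ϖ} (hx : IsType m n x) {c : k}
    (hc : ‖c‖ = (resCard k : ℝ) ^ j) (h1 : ent₁ y = c * ent₁ x) (h2 : ent₂ y = c * ent₂ x)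
    (h3 : off y = c • off x) : IsType (m + j) n y := by
  have hq := h.q_pos
  have key : ∀ m, Lev (m + j) y ↔ Lev m x := by
    intro m
    have e : 2 * (m + j) + 1 = (j + j) + (2 * m + 1) := by ring
    rw [Lev, h1, h2, h3, nr_smul, norm_mul, norm_mul, norm_mul, norm_pow, hc, e, zpow_add₀ hq.ne',
      zpow_add₀ hq.ne' (j + j), zpow_add₀ hq.ne', mul_comm (_ ^ m), ← sq,
      mul_le_mul_iff_right₀ (zpow_pos hq _), mul_le_mul_iff_right₀ (zpow_pos hq _),
      mul_le_mul_iff_right₀ (pow_pos (zpow_pos hq _) _), Lev]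
  refine ⟨(key m).mpr hx.1, ?_, ?_⟩
  · rw [show m + j - 1 = m - 1 + j by ring, key]; exact hx.2.1
  · rw [disc, h1, h2, h3, disc_scale_aux, norm_mul, norm_pow, hc, hx.2.2, sq, ← zpow_add₀ hq.ne',
      ← zpow_add₀ hq.ne']
    congr 1; ring

theorem act_scale {x y : X u ϖ} {c : k} (h1 : ent₁ y = c * ent₁ x) (h2 : ent₂ y = c * ent₂ x)
    (h3 : off y = c • off x) (g : G u ϖ) : ent₁ (act g y) = c * ent₁ (act g x) ∧
      ent₂ (act g y) = c * ent₂ (act g x) ∧ off (act g y) = c • off (act g x) := by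
  rw [h.ent₁_act, h.ent₁_act, h.ent₂_act, h.ent₂_act, h.off_act, h.off_act]
  exact ⟨val_scale x y c h1 h2 h3 _ _, val_scale x y c h1 h2 h3 _ _,
    sesq_scale x y c h1 h2 h3 _ _ _ _⟩

end Orbits

/-! ### Normal forms: the invariants determine the orbit -/

section Transitivity

variable {k : Type*} [NontriviallyNormedField k] [IsUltrametricDist k] {u ϖ : Valued.integer k}

/-- The elements `(1, 0; c, 1)` of `K`. -/
def lowK (c : order u ϖ) : K u ϖ :=
  ⟨!![1, 0; c, 1], !![1, 0; -c, 1], by simp [Matrix.one_fin_two], by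
    simp [Matrix.one_fin_two]⟩

/-- The elements `(1, c; 0, 1)` of `K`. -/
def uppK (c : order u ϖ) : K u ϖ :=
  ⟨!![1, c; 0, 1], !![1, -c; 0, 1], by simp [Matrix.one_fin_two], by
    simp [Matrix.one_fin_two]⟩

/-- The element `(0, 1; 1, 0)` of `K`. -/
def swapK : K u ϖ :=
  ⟨!![0, 1; 1, 0], !![0, 1; 1, 0], by simp [Matrix.one_fin_two], by
    simp [Matrix.one_fin_two]⟩

/-- The diagonal elements of `K`. -/
def diagK (c d : (order u ϖ)ˣ) : K u ϖ :=
  ⟨!![c, 0; 0, d], !![(c⁻¹ : (order u ϖ)ˣ), 0; 0, (d⁻¹ : (order u ϖ)ˣ)], by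
    simp [Matrix.one_fin_two], by
    simp [Matrix.one_fin_two]⟩

/-- Two forms are in the same `K`-orbit. -/
def KEq (x y : X u ϖ) : Prop := ∃ κ : K u ϖ, act (inclK u ϖ κ) x = y

theorem KEq.refl (x : X u ϖ) : KEq x x := ⟨1, by rw [map_one, act_one]⟩

theorem KEq.symm {x y : X u ϖ} : KEq x y → KEq y x := by
  rintro ⟨κ, rfl⟩
  exact ⟨κ⁻¹, act_inclK_inv κ x⟩

theorem KEq.trans {x y z : X u ϖ} : KEq x y → KEq y z → KEq x z := by
  rintro ⟨κ, rfl⟩ ⟨κ', rfl⟩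
  exact ⟨κ' * κ, by rw [map_mul, act_mul]⟩

variable (h : BaseData u ϖ)

include h

theorem IsType.of_kEq {m : ℤ} {n : ℕ} {x y : X u ϖ} (hx : IsType m n x) :
    KEq x y → IsType m n y := by
  rintro ⟨κ, rfl⟩
  exact hx.act h κ

theorem BaseData.exists_unit {c : D u ϖ} (hc : ‖nr c‖ = 1) :
    ∃ c' : (order u ϖ)ˣ, ((c' : order u ϖ) : D u ϖ) = c := by
  have h0 : nr c ≠ 0 := norm_ne_zero_iff.mp (by rw [hc]; exact one_ne_zero)
  refine ⟨⟨⟨c, h.mem_order_iff.mpr hc.le⟩, ⟨invD c, h.mem_order_iff.mpr ?_⟩, ?_, ?_⟩, rfl⟩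
  · rw [nr_invD, norm_inv, hc, inv_one]
  · exact Subtype.ext (mul_invD h0)
  · exact Subtype.ext (invD_mul h0)

theorem BaseData.exists_nr_eq {a : k} (ha : ‖a‖ = 1) : ∃ c : D u ϖ, nr c = a := by
  obtain ⟨r, i, hri⟩ := h.exists_form a ha
  exact ⟨⟨r, i, 0, 0⟩, by simp [nr, hri]⟩

theorem kEq_low (x : X u ϖ) {c : D u ϖ} (hc : ‖nr c‖ ≤ 1) : ∃ y : X u ϖ, KEq x y ∧
    ent₁ y = ent₁ x ∧ ent₂ y = val x c 1 ∧ off y = ent₁ x • star c + off x := by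
  refine ⟨_, ⟨lowK ⟨c, h.mem_order_iff.mpr hc⟩, rfl⟩, ?_, ?_, ?_⟩
  · rw [h.ent₁_act]; simp [inclK_apply, lowK, val]
  · rw [h.ent₂_act]; simp [inclK_apply, lowK]
  · rw [h.off_act]; simp [inclK_apply, lowK, sesq]

theorem kEq_upp (x : X u ϖ) {c : D u ϖ} (hc : ‖nr c‖ ≤ 1) : ∃ y : X u ϖ, KEq x y ∧
    ent₁ y = val x 1 c ∧ ent₂ y = ent₂ x ∧ off y = ent₂ x • c + off x := by
  refine ⟨_, ⟨uppK ⟨c, h.mem_order_iff.mpr hc⟩, rfl⟩, ?_, ?_, ?_⟩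
  · rw [h.ent₁_act]; simp [inclK_apply, uppK]
  · rw [h.ent₂_act]; simp [inclK_apply, uppK, val]
  · rw [h.off_act]; simp [inclK_apply, uppK, sesq]

theorem kEq_swap (x : X u ϖ) : ∃ y : X u ϖ, KEq x y ∧
    ent₁ y = ent₂ x ∧ ent₂ y = ent₁ x ∧ off y = star (off x) := by
  refine ⟨_, ⟨swapK, rfl⟩, ?_, ?_, ?_⟩
  · rw [h.ent₁_act]; simp [inclK_apply, swapK, val]
  · rw [h.ent₂_act]; simp [inclK_apply, swapK, val]
  · rw [h.off_act]; simp [inclK_apply, swapK, sesq]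

theorem kEq_diag (x : X u ϖ) {c d : D u ϖ} (hc : ‖nr c‖ = 1) (hd : ‖nr d‖ = 1) :
    ∃ y : X u ϖ, KEq x y ∧
    ent₁ y = ent₁ x * nr c ∧ ent₂ y = ent₂ x * nr d ∧ off y = c * off x * star d := by
  obtain ⟨c', rfl⟩ := h.exists_unit hc
  obtain ⟨d', rfl⟩ := h.exists_unit hd
  refine ⟨_, ⟨diagK c' d', rfl⟩, ?_, ?_, ?_⟩
  · rw [h.ent₁_act]; simp [inclK_apply, diagK, val]
  · rw [h.ent₂_act]; simp [inclK_apply, diagK, val]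
  · rw [h.off_act]; simp [inclK_apply, diagK, sesq]

/-- Level `0` alone allows the norm `q`; that extreme occurs only for second invariant `0`, since
otherwise the determinant is integral. -/
theorem IsType.norm_nr_off_le {n : ℕ} {x : X u ϖ} (hx : IsType 0 (n + 1) x) :
    ‖nr (off x)‖ ≤ 1 := by
  have : nr (off x) = ent₁ x * ent₂ x - disc x := by rw [disc]; ring
  rw [this]
  have h1 := hx.1.1
  have h2 := hx.1.2.1
  rw [zpow_zero] at h1 h2
  refine norm_sub_le_of_le ?_ ?_
  · rw [norm_mul]; exact mul_le_one₀ h1 (norm_nonneg _) h2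
  · rw [hx.2.2]
    exact zpow_le_one_of_nonpos₀ h.one_lt.le (by push_cast; omega)

theorem BaseData.norm_eq_one {t : k} (h1 : ‖t‖ ≤ 1) (h2 : ¬ ‖t‖ ≤ (resCard k : ℝ) ^ (-1 : ℤ)) :
    ‖t‖ = 1 := by
  refine le_antisymm h1 (not_lt.mp fun hlt => h2 (h.norm_le_zpow_of_lt ?_))
  simpa using hlt

/-- If no diagonal entry is a unit, minimality of the level makes the off-diagonal entry `b` a unit.
The value at the row `(1, b)` is then `2 Nrd(b)` up to smaller terms, a unit because `2` is one. -/
theorem IsType.exists_unit_entry {n : ℕ} {x : X u ϖ} (hx : IsType 0 (n + 1) x) :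
    ∃ y, KEq x y ∧ ‖ent₁ y‖ = 1 := by
  have hb := hx.norm_nr_off_le h
  have h1 := hx.1.1
  have h2 := hx.1.2.1
  rw [zpow_zero] at h1 h2
  by_cases e1 : ‖ent₁ x‖ ≤ (resCard k : ℝ) ^ (-1 : ℤ)
  swap
  · exact ⟨x, KEq.refl x, h.norm_eq_one h1 e1⟩
  by_cases e2 : ‖ent₂ x‖ ≤ (resCard k : ℝ) ^ (-1 : ℤ)
  swap
  · obtain ⟨y, hy, hy1, -, -⟩ := kEq_swap h x
    exact ⟨y, hy, hy1 ▸ h.norm_eq_one h2 e2⟩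
  have e3 : ¬ ‖nr (off x)‖ ≤ (resCard k : ℝ) ^ (-1 : ℤ) := fun e3 => hx.2.1 ⟨e1, e2, by simpa using e3⟩
  have hb1 := h.norm_eq_one hb e3
  obtain ⟨y, hy, hy1, -, -⟩ := kEq_upp h x hb
  refine ⟨y, hy, ?_⟩
  have hq1 : (resCard k : ℝ) ^ (-1 : ℤ) < 1 := by
    rw [zpow_neg_one]; exact inv_lt_one_of_one_lt₀ h.one_lt
  rw [hy1, val, one_mul, mul_star_eq_nr, QuaternionAlgebra.re_coe, nr_one, mul_one, add_comm]
  have h3 : ‖2 * nr (off x)‖ = 1 := by rw [norm_mul, h.norm_two, one_mul, hb1]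
  rw [norm_add_eq_left, h3]
  rw [h3]
  refine norm_add_lt_of_lt (e1.trans_lt hq1) ?_
  rw [norm_mul, hb1, mul_one]
  exact e2.trans_lt hq1

theorem BaseData.prime_ne : (ϖ : k) ≠ 0 :=
  norm_ne_zero_iff.mp (by rw [h.norm_prime]; exact (inv_pos.mpr h.q_pos).ne')

theorem BaseData.norm_prime_zpow (m : ℤ) : ‖(ϖ : k) ^ m‖ = (resCard k : ℝ) ^ (-m) := by
  rw [norm_zpow, h.norm_prime, inv_zpow, zpow_neg]

/-- A unit diagonal entry splits off by completing the square. The two diagonal entries are then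
adjusted by reduced norms of units, which are all the units of `k`. -/
theorem IsType.kEq_diagonal {n : ℕ} {x : X u ϖ} (hx : IsType 0 (n + 1) x) :
    ∃ y, KEq x y ∧ ent₁ y = 1 ∧ ent₂ y = (ϖ : k) ^ (n : ℤ) ∧ off y = 0 := by
  obtain ⟨y, hxy, hy⟩ := hx.exists_unit_entry h
  have hyt := hx.of_kEq h hxy
  have hy0 : ent₁ y ≠ 0 := norm_ne_zero_iff.mp (by rw [hy]; exact one_ne_zero)
  obtain ⟨z, hyz, hz1, -, hz3⟩ := kEq_low h y (c := -((ent₁ y)⁻¹ • star (off y))) (by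
    rw [nr_neg, nr_smul, nr_star, norm_mul, norm_pow, norm_inv, hy]
    simpa using hyt.norm_nr_off_le h)
  have hz3' : off z = 0 := by
    rw [hz3, star_neg, QuaternionAlgebra.star_smul, star_star, smul_neg, smul_smul,
      mul_inv_cancel₀ hy0, one_smul, neg_add_cancel]
  have hzt := hyt.of_kEq h hyz
  have hdz : disc z = ent₁ z * ent₂ z := by rw [disc, hz3', nr_zero, sub_zero]
  have hz2 : ‖ent₂ z‖ = (resCard k : ℝ) ^ (-n : ℤ) := by
    have := hzt.2.2
    rw [hdz, norm_mul, hz1, hy, one_mul] at this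
    rw [this]; congr 1; push_cast; ring
  have hq := h.q_pos
  have hz20 : ent₂ z ≠ 0 := norm_ne_zero_iff.mp (by rw [hz2]; exact (zpow_pos hq _).ne')
  have hc1 : ‖(ent₁ z)⁻¹‖ = 1 := by rw [norm_inv, hz1, hy, inv_one]
  have hd1 : ‖(ent₂ z)⁻¹ * (ϖ : k) ^ (n : ℤ)‖ = 1 := by
    rw [norm_mul, norm_inv, hz2, h.norm_prime_zpow, inv_mul_cancel₀ (zpow_pos hq _).ne']
  obtain ⟨c, hc⟩ := h.exists_nr_eq hc1
  obtain ⟨d, hd⟩ := h.exists_nr_eq hd1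
  obtain ⟨w, hzw, hw1, hw2, hw3⟩ := kEq_diag h z (c := c) (d := d) (by rw [hc, hc1]) (by rw [hd, hd1])
  refine ⟨w, (hxy.trans hyz).trans hzw, ?_, ?_, ?_⟩
  · rw [hw1, hc, mul_inv_cancel₀ (by rwa [hz1])]
  · rw [hw2, hd, mul_inv_cancel_left₀ hz20]
  · rw [hw3, hz3', mul_zero, zero_mul]

omit h

/-- The quaternion `Π⁻¹`. -/
def invPi (u ϖ : Valued.integer k) : D u ϖ := ⟨0, 0, (ϖ : k)⁻¹, 0⟩

include h

theorem nr_invPi : nr (invPi u ϖ) = -(ϖ : k)⁻¹ := by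
  have := h.prime_ne
  simp only [nr, invPi]
  field_simp
  ring

theorem norm_nr_invPi : ‖nr (invPi u ϖ)‖ = (resCard k : ℝ) := by
  rw [nr_invPi h, norm_neg, norm_inv, h.norm_prime, inv_inv]

theorem IsType.norm_nr_off_zero {x : X u ϖ} (hx : IsType 0 0 x) :
    ‖nr (off x)‖ = (resCard k : ℝ) := by
  have hd : ‖disc x‖ = resCard k := by simpa using hx.2.2
  have h1 := hx.1.1
  have h2 := hx.1.2.1
  rw [zpow_zero] at h1 h2
  have h3 : ‖ent₁ x * ent₂ x‖ < ‖disc x‖ := by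
    rw [norm_mul, hd]; exact (mul_le_one₀ h1 (norm_nonneg _) h2).trans_lt h.one_lt
  have h4 : nr (off x) = -(disc x - ent₁ x * ent₂ x) := by rw [disc]; ring
  rw [h4, norm_neg, norm_sub_eq_left h3, hd]

/-- The off-diagonal entry has reduced norm of norm `q`, as `Π⁻¹` does, so their quotient is a unit
by which the first row can be multiplied. -/
theorem IsType.kEq_off_invPi {x : X u ϖ} (hx : IsType 0 0 x) :
    ∃ y c, KEq x y ∧ ent₁ y = ent₁ x * c ∧ ent₂ y = ent₂ x ∧ off y = invPi u ϖ := by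
  have hb := hx.norm_nr_off_zero h
  have hq := h.q_pos
  have hb0 : nr (off x) ≠ 0 := norm_ne_zero_iff.mp (by rw [hb]; exact hq.ne')
  obtain ⟨y, hxy, h1, h2, h3⟩ := kEq_diag h x (c := invPi u ϖ * invD (off x)) (d := 1) (by
    rw [nr_mul, norm_mul, norm_nr_invPi h, nr_invD, norm_inv, hb, mul_inv_cancel₀ hq.ne']) (by simp)
  refine ⟨y, _, hxy, h1, by simpa using h2, ?_⟩
  rw [h3, star_one, mul_one, mul_assoc, invD_mul hb0, mul_one]

theorem IsType.kEq_antidiagonal {x : X u ϖ} (hx : IsType 0 0 x) :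
    ∃ y, KEq x y ∧ ent₁ y = 0 ∧ ent₂ y = 0 ∧ off y = invPi u ϖ := by
  have hϖ := h.prime_ne
  obtain ⟨y, c, hxy, -, -, hy3⟩ := hx.kEq_off_invPi h
  have hyt := hx.of_kEq h hxy
  have hy1 := hyt.1.1
  have hy2 := hyt.1.2.1
  rw [zpow_zero] at hy1 hy2
  have hϖ1 : ‖(ϖ : k)‖ < 1 := by rw [h.norm_prime]; exact inv_lt_one_of_one_lt₀ h.one_lt
  -- The value at the row `(1, t Π)` is `ent₁ y - 2 * t - ϖ * ent₂ y * t ^ 2`. With `s` the root of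
  -- its normalized discriminant, `t = ent₁ y / (1 + s)` is the integral zero, written without the
  -- denominator `ϖ * ent₂ y`.
  obtain ⟨s, hs, hs1⟩ := h.exists_sqrt ((ϖ : k) * (ent₁ y * ent₂ y)) (by
    rw [norm_mul, norm_mul]
    exact (mul_le_of_le_one_right (norm_nonneg _) (mul_le_one₀ hy1 (norm_nonneg _) hy2)).trans_lt hϖ1)
  have hs2 : ‖1 + s‖ = 1 := by
    have : 1 + s = 2 + (s - 1) := by ring
    rw [this, norm_add_eq_left (by rw [h.norm_two]; exact hs1), h.norm_two]
  have hs0 : 1 + s ≠ 0 := norm_ne_zero_iff.mp (by rw [hs2]; exact one_ne_zero)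
  have ht : ‖ent₁ y / (1 + s)‖ ≤ 1 := by rw [norm_div, hs2, div_one]; exact hy1
  have hnr : ∀ t : k, ‖t‖ ≤ 1 → ‖nr (⟨0, 0, t, 0⟩ : D u ϖ)‖ ≤ 1 := by
    intro t ht
    have : nr (⟨0, 0, t, 0⟩ : D u ϖ) = -(ϖ * t ^ 2) := by simp [nr]
    rw [this, norm_neg, norm_mul, norm_pow]
    exact mul_le_one₀ hϖ1.le (by positivity) (pow_le_one₀ (norm_nonneg _) ht)
  obtain ⟨z, hyz, hz1, -, -⟩ := kEq_upp h y (hnr _ ht)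
  have hz1' : ent₁ z = 0 := by
    rw [hz1, val, hy3]
    simp only [nr, invPi, QuaternionAlgebra.re_mul, QuaternionAlgebra.imI_mul,
      QuaternionAlgebra.imJ_mul, QuaternionAlgebra.imK_mul, QuaternionAlgebra.re_star,
      QuaternionAlgebra.imI_star, QuaternionAlgebra.imJ_star, QuaternionAlgebra.imK_star,
      QuaternionAlgebra.re_one, QuaternionAlgebra.imI_one, QuaternionAlgebra.imJ_one,
      QuaternionAlgebra.imK_one]
    field_simp
    have : (1 + s) ^ 2 - ent₂ y * ϖ * ent₁ y - 2 * (1 + s) = 0 := by linear_combination hs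
    linear_combination ent₁ y * this
  have hzt := hyt.of_kEq h hyz
  -- The row operation has changed the off-diagonal entry. Renormalizing it multiplies the first
  -- diagonal entry, which stays `0`.
  obtain ⟨w, d, hzw, hw1, -, hw3⟩ := hzt.kEq_off_invPi h
  rw [hz1', zero_mul] at hw1
  have hwt := hzt.of_kEq h hzw
  have hw2 := hwt.1.2.1
  rw [zpow_zero] at hw2
  -- With `ent₁ w = 0` the value at the row `(r Π, 1)` is `ent₂ w + 2 * r`, which vanishes for `r =
  -- -(ent₂ w / 2)`.
  have hr : ‖-(ent₂ w / 2)‖ ≤ 1 := by rw [norm_neg, norm_div, h.norm_two, div_one]; exact hw2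
  obtain ⟨v, hwv, hv1, hv2, hv3⟩ := kEq_low h w (hnr _ hr)
  refine ⟨v, ((hxy.trans hyz).trans hzw).trans hwv, hv1.trans hw1, ?_, ?_⟩
  · have h2 := h.two_ne
    rw [hv2, val, hw1, hw3]
    simp only [nr, invPi, QuaternionAlgebra.re_mul, QuaternionAlgebra.imI_mul,
      QuaternionAlgebra.imJ_mul, QuaternionAlgebra.imK_mul, QuaternionAlgebra.re_star,
      QuaternionAlgebra.imI_star, QuaternionAlgebra.imJ_star, QuaternionAlgebra.imK_star,
      QuaternionAlgebra.re_one, QuaternionAlgebra.imI_one, QuaternionAlgebra.imJ_one,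
      QuaternionAlgebra.imK_one]
    field_simp
    ring
  · rw [hv3, hw1, hw3, zero_smul, zero_add]

/-- Both forms reach the same normal form, antidiagonal for `n = 0` and diagonal otherwise. -/
theorem IsType.kEq_of_zero {n : ℕ} {x y : X u ϖ} (hx : IsType 0 n x) (hy : IsType 0 n y) :
    KEq x y := by
  cases n with
  | zero =>
    obtain ⟨x', hx', x1, x2, x3⟩ := hx.kEq_antidiagonal h
    obtain ⟨y', hy', y1, y2, y3⟩ := hy.kEq_antidiagonal h
    have : x' = y' := h.ext_form (x1.trans y1.symm) (x2.trans y2.symm) (x3.trans y3.symm)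
    exact hx'.trans (this ▸ hy'.symm)
  | succ n =>
    obtain ⟨x', hx', x1, x2, x3⟩ := hx.kEq_diagonal h
    obtain ⟨y', hy', y1, y2, y3⟩ := hy.kEq_diagonal h
    have : x' = y' := h.ext_form (x1.trans y1.symm) (x2.trans y2.symm) (x3.trans y3.symm)
    exact hx'.trans (this ▸ hy'.symm)

/-- The invariants determine the `K`-orbit. -/
theorem IsType.kEq {m : ℤ} {n : ℕ} {x y : X u ϖ} (hx : IsType m n x) (hy : IsType m n y) :
    KEq x y := by
  have hc : (ϖ : k) ^ m ≠ 0 := zpow_ne_zero _ h.prime_ne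
  have hcn := h.norm_prime_zpow m
  obtain ⟨x', x1, x2, x3⟩ := h.exists_scale x hc
  obtain ⟨y', y1, y2, y3⟩ := h.exists_scale y hc
  have hx' := hx.scale h hcn x1 x2 x3
  have hy' := hy.scale h hcn y1 y2 y3
  rw [add_neg_cancel] at hx' hy'
  obtain ⟨κ, hκ⟩ := hx'.kEq_of_zero h hy'
  obtain ⟨a1, a2, a3⟩ := act_scale h x1 x2 x3 (inclK u ϖ κ)
  rw [hκ] at a1 a2 a3
  refine ⟨κ, h.ext_form (mul_left_cancel₀ hc (a1.symm.trans y1))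
    (mul_left_cancel₀ hc (a2.symm.trans y2)) ?_⟩
  have := a3.symm.trans y3
  exact smul_right_injective _ hc this

theorem IsType.orbitK_eq {m : ℤ} {n : ℕ} {x : X u ϖ} (hx : IsType m n x) :
    orbitK x = {y | IsType m n y} := by
  ext y
  exact ⟨fun ⟨κ, hκ⟩ => hx.of_kEq h ⟨κ, hκ⟩, fun hy => hx.kEq h hy⟩

end Transitivity

/-! ### Equidistribution in a subgroup and averages -/

section Averages

variable {V : Type*} [AddCommGroup V] [MeasurableSpace V] [MeasurableAdd₂ V]

/-- Uniqueness of Haar measure on a measurable subgroup `B`: a finite measure concentrated on `B`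
and invariant under `B` is a multiple of the restriction to `B` of a Haar measure. -/
theorem measure_smul_eq_of_invariant (ρ : Measure V) [SigmaFinite ρ] [ρ.IsAddLeftInvariant]
    (B : AddSubgroup V) (hB : MeasurableSet (B : Set V)) (ν : Measure V) [IsFiniteMeasure ν]
    (hν : ∀ᵐ w ∂ν, w ∈ B) (hinv : ∀ c ∈ B, ν.map (· + c) = ν) :
    ρ B • ν = ν Set.univ • ρ.restrict B := by
  ext A hA
  rw [Measure.smul_apply, Measure.smul_apply, Measure.restrict_apply hA, smul_eq_mul, smul_eq_mul]
  -- By invariance of `ν` the integrand is constant on `B`. Exchanging the integrals, invariance of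
  -- `ρ` makes the inner integral constant as well, and comparing the two results gives
  -- proportionality.
  have h1 : ρ B * ν A = ∫⁻ c in (B : Set V), ν ((· + c) ⁻¹' A) ∂ρ := by
    rw [setLIntegral_congr_fun (g := fun _ => ν A) hB, setLIntegral_const, mul_comm]
    intro c hc
    simp only
    rw [← Measure.map_apply (measurable_add_const c) hA, hinv c hc]
  have h2 : ∀ c, ν ((· + c) ⁻¹' A) = ∫⁻ w, A.indicator 1 (w + c) ∂ν := by
    intro c
    rw [← lintegral_indicator_one (measurable_add_const c hA)]
    rfl
  have h3 : ∀ w ∈ B, ∫⁻ c in (B : Set V), A.indicator (1 : V → ENNReal) (w + c) ∂ρ = ρ (A ∩ B) := by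
    intro w hw
    have : ∀ c, A.indicator (1 : V → ENNReal) (w + c) = ((w + ·) ⁻¹' A).indicator 1 c := fun c => rfl
    simp_rw [this]
    rw [lintegral_indicator_one (measurable_const_add w hA),
      Measure.restrict_apply (measurable_const_add w hA)]
    rw [← measure_preimage_add ρ w (A ∩ B)]
    congr 1
    ext c
    simp [B.add_mem_cancel_left hw]
  rw [h1]
  simp_rw [h2]
  rw [lintegral_lintegral_swap, lintegral_congr_ae (g := fun _ => ρ (A ∩ B)), lintegral_const,
    mul_comm]
  · filter_upwards [hν] with w hw using h3 w hw
  · refine Measurable.aemeasurable ?_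
    exact (measurable_one.indicator hA).comp (measurable_snd.add measurable_fst)

/-- The integral of a function of a variable which is equidistributed in `B`. -/
theorem integral_comp_eq_setAverage {Ω : Type*} [MeasurableSpace Ω] (P : Measure Ω)
    [IsFiniteMeasure P] {φ : Ω → V} (hφ : Measurable φ) (ρ : Measure V) [SigmaFinite ρ]
    [ρ.IsAddLeftInvariant] {B : AddSubgroup V} (hB : MeasurableSet (B : Set V)) (hB0 : ρ B ≠ 0)
    (hB1 : ρ B ≠ ⊤) (hφB : ∀ᵐ ω ∂P, φ ω ∈ B)
    (hinv : ∀ c ∈ B, P.map (fun ω => φ ω + c) = P.map φ) {f : V → ℂ} (hf : Measurable f) :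
    ∫ ω, f (φ ω) ∂P = P.real Set.univ * ⨍ w in (B : Set V), f w ∂ρ := by
  have hν : ρ B • P.map φ = (P.map φ) Set.univ • ρ.restrict B := by
    refine measure_smul_eq_of_invariant ρ B hB _ ?_ ?_
    · exact (ae_map_iff hφ.aemeasurable hB).mpr hφB
    · intro c hc
      rw [Measure.map_map (measurable_add_const c) hφ]
      exact hinv c hc
  have h1 := congrArg (fun m : Measure V => ∫ w, f w ∂m) hν
  rw [integral_smul_measure, integral_smul_measure,
    integral_map hφ.aemeasurable hf.aestronglyMeasurable, Measure.map_apply hφ MeasurableSet.univ,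
    Set.preimage_univ] at h1
  have h0 : (ρ B).toReal ≠ 0 := ENNReal.toReal_ne_zero.mpr ⟨hB0, hB1⟩
  rw [setAverage_eq, Measure.real, Measure.real, ← smul_eq_mul, Complex.coe_smul, smul_comm, ← h1,
    smul_smul, inv_mul_cancel₀ h0, one_smul]

/-- Averages over subgroups are compatible with homomorphisms. -/
theorem setAverage_comp_hom {W : Type*} [AddCommGroup W] [MeasurableSpace W] [MeasurableAdd₂ W]
    (μ : Measure W) [μ.IsAddLeftInvariant] {A : AddSubgroup W} (hA : MeasurableSet (A : Set W))
    (hA0 : μ A ≠ 0) (hA1 : μ A ≠ ⊤) (ρ : Measure V) [SigmaFinite ρ]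
    [ρ.IsAddLeftInvariant] {B : AddSubgroup V} (hB : MeasurableSet (B : Set V)) (hB0 : ρ B ≠ 0)
    (hB1 : ρ B ≠ ⊤) {φ : W → V} (hφ : Measurable φ) (hadd : ∀ a b, φ (a + b) = φ a + φ b)
    (hmap : ∀ a ∈ A, φ a ∈ B) (hsurj : ∀ b ∈ B, ∃ a ∈ A, φ a = b) {f : V → ℂ} (hf : Measurable f) :
    ⨍ w in (A : Set W), f (φ w) ∂μ = ⨍ w in (B : Set V), f w ∂ρ := by
  have : IsFiniteMeasure (μ.restrict A) := ⟨by
    rw [Measure.restrict_apply_univ]; exact hA1.lt_top⟩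
  rw [setAverage_eq, integral_comp_eq_setAverage (μ.restrict A) hφ ρ hB hB0 hB1
    ((ae_restrict_iff' hA).mpr (Filter.Eventually.of_forall hmap)) ?_ hf,
    measureReal_restrict_apply_univ, ← Complex.coe_smul, smul_eq_mul, ← mul_assoc,
    ← Complex.ofReal_mul, Measure.real, inv_mul_cancel₀ (ENNReal.toReal_ne_zero.mpr ⟨hA0, hA1⟩),
    Complex.ofReal_one, one_mul]
  intro c hc
  obtain ⟨a, ha, rfl⟩ := hsurj c hc
  have hm : (μ.restrict A).map (a + ·) = μ.restrict A := by
    ext s hs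
    rw [Measure.map_apply (measurable_const_add a) hs, Measure.restrict_apply
      (measurable_const_add a hs), Measure.restrict_apply hs, ← measure_preimage_add μ a (s ∩ A)]
    congr 1
    ext c
    simp [A.add_mem_cancel_left ha]
  conv_rhs => rw [← hm]
  rw [Measure.map_map hφ (measurable_const_add a)]
  congr 1
  funext x
  simp [hadd, add_comm]

theorem setAverage_const_mul {W : Type*} [MeasurableSpace W] (μ : Measure W) (A : Set W)
    (c : ℂ) (f : W → ℂ) : ⨍ w in A, c * f w ∂μ = c * ⨍ w in A, f w ∂μ := by
  rw [setAverage_eq, setAverage_eq, integral_const_mul, mul_smul_comm]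

theorem setAverage_congr_fun {W : Type*} [MeasurableSpace W] {μ : Measure W} {A : Set W}
    (hA : MeasurableSet A) {f g : W → ℂ} (hfg : ∀ w ∈ A, f w = g w) :
    ⨍ w in A, f w ∂μ = ⨍ w in A, g w ∂μ := by
  rw [setAverage_eq, setAverage_eq, setIntegral_congr_fun hA hfg]

theorem setAverage_of_eq {W : Type*} [MeasurableSpace W] {μ : Measure W} {A : Set W}
    (hA : MeasurableSet A) (hA0 : μ A ≠ 0) (hA1 : μ A ≠ ⊤) {f : W → ℂ} {c : ℂ}
    (hf : ∀ w ∈ A, f w = c) : ⨍ w in A, f w ∂μ = c := by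
  rw [setAverage_congr_fun hA hf, setAverage_const hA0 hA1]

/-- Splitting an average along a subset. -/
theorem setAverage_diff_add {W : Type*} [MeasurableSpace W] {μ : Measure W} {A B : Set W}
    (hA1 : μ A ≠ ⊤) (hB : MeasurableSet B) (hBA : B ⊆ A) (hB0 : μ B ≠ 0) {f : W → ℂ}
    (hf : IntegrableOn f A μ) {c : ℂ} (hA : MeasurableSet A) (hc : ∀ w ∈ A \ B, f w = c) :
    ⨍ w in A, f w ∂μ = (1 - μ.real B / μ.real A : ℝ) * c +
      (μ.real B / μ.real A : ℝ) * ⨍ w in B, f w ∂μ := by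
  have hB1 : μ B ≠ ⊤ := measure_ne_top_of_subset hBA hA1
  have hA0 : μ A ≠ 0 := fun h0 => hB0 (measure_mono_null hBA h0)
  have hAr : (μ.real A : ℂ) ≠ 0 := by
    exact_mod_cast ENNReal.toReal_ne_zero.mpr ⟨hA0, hA1⟩
  have hBr : (μ.real B : ℂ) ≠ 0 := by
    exact_mod_cast ENNReal.toReal_ne_zero.mpr ⟨hB0, hB1⟩
  have h1 := setIntegral_sdiff hB hf hBA
  rw [setIntegral_congr_fun (hA.diff hB) hc, setIntegral_const, measureReal_sdiff hBA hB hA1] at h1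
  rw [setAverage_eq, setAverage_eq, ← sub_add_cancel (∫ x in A, f x ∂μ) (∫ x in B, f x ∂μ), ← h1]
  simp only [Complex.real_smul]
  push_cast
  field_simp

end Averages

/-! ### Haar measures of the ideals of `k` and of `D` -/

section Balls

variable {k : Type*} [NontriviallyNormedField k] [IsUltrametricDist k] {u ϖ : Valued.integer k}

/-- The fractional ideal of elements of norm at most `q ^ m`. -/
def ballk (k : Type*) [NontriviallyNormedField k] [IsUltrametricDist k] (m : ℤ) : AddSubgroup k where
  carrier := {t | ‖t‖ ≤ (resCard k : ℝ) ^ m}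
  zero_mem' := by simp only [Set.mem_ofPred_eq, norm_zero]; positivity
  add_mem' := norm_add_le_of_le
  neg_mem' := by intro t ht; simpa using ht

theorem mem_ballk {m : ℤ} {t : k} : t ∈ ballk k m ↔ ‖t‖ ≤ (resCard k : ℝ) ^ m := Iff.rfl

theorem ballk_mono (h : BaseData u ϖ) {m m' : ℤ} (hm : m ≤ m') {t : k} (ht : t ∈ ballk k m) :
    t ∈ ballk k m' :=
  (mem_ballk.mp ht).trans (zpow_le_zpow_right₀ h.one_lt.le hm)

/-- The ideal of quaternions whose reduced norm has norm at most `q ^ m`. -/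
def ballD (h : BaseData u ϖ) (m : ℤ) : AddSubgroup (D u ϖ) where
  carrier := {a | ‖nr a‖ ≤ (resCard k : ℝ) ^ m}
  zero_mem' := by simp only [Set.mem_ofPred_eq, nr_zero, norm_zero]; positivity
  add_mem' := h.nr_add_le
  neg_mem' := by intro t ht; simpa using ht

theorem mem_ballD {h : BaseData u ϖ} {m : ℤ} {a : D u ϖ} :
    a ∈ ballD h m ↔ ‖nr a‖ ≤ (resCard k : ℝ) ^ m := Iff.rfl

/-- The coordinates on `D`, as a homeomorphism. -/
def homeoD (u ϖ : Valued.integer k) : D u ϖ ≃ₜ (Fin 4 → k) where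
  toEquiv := QuaternionAlgebra.equivTuple (u : k) 0 (ϖ : k)
  continuous_toFun := continuous_equivTuple
  continuous_invFun := by
    refine continuous_toD ?_ ?_ ?_ ?_
    · exact continuous_apply 0
    · exact continuous_apply 1
    · exact continuous_apply 2
    · exact continuous_apply 3

instance (u ϖ : Valued.integer k) : MeasurableSpace (D u ϖ) := borel _

instance (u ϖ : Valued.integer k) : BorelSpace (D u ϖ) := ⟨rfl⟩

theorem continuous_nr : Continuous (nr : D u ϖ → k) := by
  have h1 := continuous_re (u := u) (ϖ := ϖ)
  have h2 := continuous_imI (u := u) (ϖ := ϖ)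
  have h3 := continuous_imJ (u := u) (ϖ := ϖ)
  have h4 := continuous_imK (u := u) (ϖ := ϖ)
  unfold nr
  fun_prop

instance : ContinuousStar (D u ϖ) where
  continuous_star := by
    have h1 := continuous_re (u := u) (ϖ := ϖ)
    have h2 := continuous_imI (u := u) (ϖ := ϖ)
    have h3 := continuous_imJ (u := u) (ϖ := ϖ)
    have h4 := continuous_imK (u := u) (ϖ := ϖ)
    apply continuous_toD <;> simp only [QuaternionAlgebra.re_star, QuaternionAlgebra.imI_star,
      QuaternionAlgebra.imJ_star, QuaternionAlgebra.imK_star] <;> fun_prop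

instance : ContinuousSMul k (D u ϖ) where
  continuous_smul := by
    have h1 := continuous_re (u := u) (ϖ := ϖ)
    have h2 := continuous_imI (u := u) (ϖ := ϖ)
    have h3 := continuous_imJ (u := u) (ϖ := ϖ)
    have h4 := continuous_imK (u := u) (ϖ := ϖ)
    apply continuous_toD <;> simp only [QuaternionAlgebra.re_smul, QuaternionAlgebra.imI_smul,
      QuaternionAlgebra.imJ_smul, QuaternionAlgebra.imK_smul] <;> fun_prop

theorem ballD_mono (h : BaseData u ϖ) {m m' : ℤ} (hm : m ≤ m') {t : D u ϖ} (ht : t ∈ ballD h m) :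
    t ∈ ballD h m' :=
  (mem_ballD.mp ht).trans (zpow_le_zpow_right₀ h.one_lt.le hm)

theorem isClosed_ballk (m : ℤ) : IsClosed (ballk k m : Set k) :=
  isClosed_le continuous_norm continuous_const

theorem isClosed_ballD (h : BaseData u ϖ) (m : ℤ) : IsClosed (ballD h m : Set (D u ϖ)) :=
  isClosed_le continuous_nr.norm continuous_const

variable [ProperSpace k] [MeasurableSpace k] [BorelSpace k]

omit [ProperSpace k] in
theorem measurableSet_ballk (m : ℤ) : MeasurableSet (ballk k m : Set k) :=
  (isClosed_ballk m).measurableSet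

omit [ProperSpace k] [MeasurableSpace k] [BorelSpace k] in
theorem measurableSet_ballD (h : BaseData u ϖ) (m : ℤ) :
    MeasurableSet (ballD h m : Set (D u ϖ)) :=
  (isClosed_ballD h m).measurableSet

/-- The Haar measure on `k`. -/
abbrev mu (k : Type*) [NontriviallyNormedField k] [ProperSpace k] [MeasurableSpace k]
    [BorelSpace k] : Measure k := Measure.addHaar

theorem mu_ballk_ne_top (m : ℤ) : mu k (ballk k m) ≠ ⊤ := by
  have : (ballk k m : Set k) = Metric.closedBall 0 ((resCard k : ℝ) ^ m) := by
    ext t; simp [mem_ballk]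
  rw [this]
  exact (isCompact_closedBall _ _).measure_ne_top

theorem mu_ballk_ne_zero (h : BaseData u ϖ) (m : ℤ) : mu k (ballk k m) ≠ 0 := by
  have : (ballk k m : Set k) = Metric.closedBall 0 ((resCard k : ℝ) ^ m) := by
    ext t; simp [mem_ballk]
  rw [this]
  exact (Metric.measure_closedBall_pos _ _ (zpow_pos h.q_pos _)).ne'

/-- The maximal ideal is the kernel of reduction, a subgroup of index `q`, so the ring of integers
is a union of `q` of its translates. -/
theorem mu_ballk_zero (h : BaseData u ϖ) :
    mu k (ballk k 0) = (resCard k : ENNReal) * mu k (ballk k (-1)) := by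
  set O := Valued.integer k
  set R : O →+ IsLocalRing.ResidueField O := (IsLocalRing.residue O).toAddMonoidHom with hR
  have hO : MeasurableSet (O : Set k) := by
    convert measurableSet_ballk (k := k) 0 using 1
    ext t
    simp [O, Valued.integer.mem_iff, mem_ballk]
  have hemb : MeasurableEmbedding (O.subtype : O → k) := MeasurableEmbedding.subtype_coe hO
  have hker : (R.ker : Set O) = (O.subtype) ⁻¹' (ballk k (-1) : Set k) := by
    ext a
    have hle := Valued.integer.norm_le_one a
    change IsLocalRing.residue O a = 0 ↔ ‖(a : k)‖ ≤ _
    rw [residue_eq_zero_iff]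
    constructor
    · intro ha; exact h.norm_le_zpow_of_lt (by simpa using ha)
    · intro ha
      refine ha.trans_lt ?_
      rw [zpow_neg_one]; exact inv_lt_one_of_one_lt₀ h.one_lt
  have hmk : MeasurableSet (R.ker : Set O) := by
    rw [hker]; exact hemb.measurable (measurableSet_ballk _)
  have hindex : R.ker.index = resCard k := by
    rw [AddSubgroup.index_ker, AddMonoidHom.range_eq_top.mpr IsLocalRing.residue_surjective,
      resCard, AddSubgroup.card_top]
  have hfin : R.ker.FiniteIndex := ⟨by
    rw [hindex]
    have := h.q_pos
    exact_mod_cast this.ne'⟩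
  have hinv : ((mu k).comap O.subtype.toAddMonoidHom).IsAddLeftInvariant :=
    Measure.IsAddLeftInvariant.comap (mu k) (f := O.subtype.toAddMonoidHom) hemb
  have := AddSubgroup.index_mul_measure R.ker hmk ((mu k).comap O.subtype.toAddMonoidHom)
  rw [hindex] at this
  have e1 : ((mu k).comap O.subtype.toAddMonoidHom) R.ker = mu k (ballk k (-1)) := by
    have : ((mu k).comap O.subtype.toAddMonoidHom) R.ker = mu k (O.subtype '' R.ker) :=
      hemb.comap_apply _ _
    rw [this, hker]
    congr 1
    refine Set.image_preimage_eq_of_subset ?_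
    intro t ht
    refine ⟨⟨t, ?_⟩, rfl⟩
    refine Valued.integer.mem_iff.mpr (le_trans ht ?_)
    exact zpow_le_one_of_nonpos₀ h.one_lt.le (by norm_num)
  have e2 : ((mu k).comap O.subtype.toAddMonoidHom) Set.univ = mu k (ballk k 0) := by
    have : ((mu k).comap O.subtype.toAddMonoidHom) Set.univ = mu k (O.subtype '' Set.univ) :=
      hemb.comap_apply _ _
    rw [this]
    congr 1
    ext t
    simp [O, Valued.integer.mem_iff, mem_ballk]
  rw [e1, e2] at this
  exact this.symm

/-- Multiplication by `ϖ ^ (-m)` carries the measure on the ring of integers to an invariant measure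
on the ball of radius `q ^ m`. Uniqueness makes this a multiple of Haar measure, and the ball of
radius `q ^ (m - 1)` is the image of the maximal ideal. -/
theorem mu_ballk_mul (h : BaseData u ϖ) (m : ℤ) :
    mu k (ballk k m) * mu k (ballk k (-1)) = mu k (ballk k 0) * mu k (ballk k (m - 1)) := by
  set c : k := (ϖ : k) ^ (-m)
  have hc : ‖c‖ = (resCard k : ℝ) ^ m := by rw [h.norm_prime_zpow, neg_neg]
  have hc0 : c ≠ 0 := zpow_ne_zero _ h.prime_ne
  have hq := h.q_pos
  have hmem : ∀ (t : k) (j : ℤ), c * t ∈ ballk k (m + j) ↔ t ∈ ballk k j := by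
    intro t j
    rw [mem_ballk, mem_ballk, norm_mul, hc, zpow_add₀ hq.ne', mul_le_mul_iff_right₀ (zpow_pos hq _)]
  have hmeas : Measurable fun t : k => c * t := measurable_const_mul c
  have hfin : IsFiniteMeasure ((mu k).restrict (ballk k 0)) := ⟨by
    rw [Measure.restrict_apply_univ]; exact (mu_ballk_ne_top 0).lt_top⟩
  have key := measure_smul_eq_of_invariant (mu k) (ballk k m) (measurableSet_ballk m)
    (((mu k).restrict (ballk k 0)).map fun t => c * t) ?_ ?_
  · have := congrArg (fun M : Measure k => M (ballk k (m - 1))) key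
    simp only [Measure.smul_apply, smul_eq_mul] at this
    rw [Measure.map_apply hmeas (measurableSet_ballk _), Measure.map_apply hmeas MeasurableSet.univ,
      Set.preimage_univ, Measure.restrict_apply_univ,
      Measure.restrict_apply (hmeas (measurableSet_ballk _)),
      Measure.restrict_apply (measurableSet_ballk _)] at this
    convert this using 3
    · ext t
      have h1 := hmem t (-1)
      simp only [SetLike.mem_coe, Set.mem_inter_iff, Set.mem_preimage]
      rw [sub_eq_add_neg, h1]
      exact ⟨fun ht => ⟨ht, ballk_mono h (by norm_num) ht⟩, fun ht => ht.1⟩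
    · ext t
      simp only [SetLike.mem_coe, Set.mem_inter_iff]
      exact ⟨fun ht => ⟨ht, ballk_mono h (by omega) ht⟩, fun ht => ht.1⟩
  · refine (ae_map_iff hmeas.aemeasurable (measurableSet_ballk m)).mpr
      ((ae_restrict_iff' (measurableSet_ballk 0)).mpr (Filter.Eventually.of_forall fun t ht => ?_))
    have := (hmem t 0).mpr ht
    rwa [add_zero] at this
  · intro a ha
    rw [Measure.map_map (measurable_add_const a) hmeas]
    have hb : c⁻¹ * a ∈ ballk k 0 := by
      rw [← hmem, mul_inv_cancel_left₀ hc0, add_zero]; exact ha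
    have hm : ((mu k).restrict (ballk k 0)).map (c⁻¹ * a + ·) = (mu k).restrict (ballk k 0) := by
      ext s hs
      rw [Measure.map_apply (measurable_const_add _) hs, Measure.restrict_apply
        (measurable_const_add _ hs), Measure.restrict_apply hs,
        ← measure_preimage_add (mu k) (c⁻¹ * a) (s ∩ _)]
      congr 1
      ext t
      simp [(ballk k 0).add_mem_cancel_left hb]
    conv_rhs => rw [← hm]
    rw [Measure.map_map hmeas (measurable_const_add _)]
    congr 1
    funext t
    simp only [Function.comp, mul_add, mul_inv_cancel_left₀ hc0]
    ring

/-- The volume of the ring of integers of `k`. -/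
def volO (k : Type*) [NontriviallyNormedField k] [IsUltrametricDist k] [ProperSpace k]
    [MeasurableSpace k] [BorelSpace k] : ℝ := (mu k).real (ballk k 0)

theorem volO_pos (h : BaseData u ϖ) : 0 < volO k :=
  ENNReal.toReal_pos (mu_ballk_ne_zero h 0) (mu_ballk_ne_top 0)

theorem mu_real_ballk (h : BaseData u ϖ) (m : ℤ) :
    (mu k).real (ballk k m) = (resCard k : ℝ) ^ m * volO k := by
  have hq := h.q_pos
  have hv := volO_pos h
  have hstep : ∀ m : ℤ, (mu k).real (ballk k m) = resCard k * (mu k).real (ballk k (m - 1)) := by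
    intro m
    have h1 := congrArg ENNReal.toReal (mu_ballk_mul h m)
    have h2 := congrArg ENNReal.toReal (mu_ballk_zero h)
    rw [ENNReal.toReal_mul, ENNReal.toReal_mul] at h1
    rw [ENNReal.toReal_mul, ENNReal.toReal_natCast] at h2
    have h3 : (mu k (ballk k (-1))).toReal ≠ 0 :=
      (ENNReal.toReal_pos (mu_ballk_ne_zero h _) (mu_ballk_ne_top _)).ne'
    simp only [Measure.real]
    rw [h2] at h1
    refine mul_right_cancel₀ h3 (h1.trans ?_)
    ring
  induction m using Int.induction_on with
  | zero => simp [volO]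
  | succ i ih =>
    rw [hstep, add_sub_cancel_right, ih, zpow_add_one₀ hq.ne']; ring
  | pred i ih =>
    have := hstep (-(i : ℤ))
    rw [ih] at this
    refine mul_left_cancel₀ hq.ne' (this.symm.trans ?_)
    rw [zpow_sub_one₀ hq.ne']
    field_simp

theorem mu_ballk (h : BaseData u ϖ) (m : ℤ) :
    mu k (ballk k m) = ENNReal.ofReal ((resCard k : ℝ) ^ m * volO k) := by
  rw [← mu_real_ballk h, Measure.real, ENNReal.ofReal_toReal (mu_ballk_ne_top m)]

/-- The Haar measure on `D`. -/
def muD (u ϖ : Valued.integer k) : Measure (D u ϖ) :=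
  (Measure.pi fun _ : Fin 4 => mu k).map (homeoD u ϖ).symm

omit [ProperSpace k] [MeasurableSpace k] [BorelSpace k] in
instance [SecondCountableTopology k] : SecondCountableTopology (D u ϖ) :=
  (homeoD u ϖ).secondCountableTopology

instance : SigmaFinite (muD u ϖ) :=
  (homeoD u ϖ).symm.toMeasurableEquiv.sigmaFinite_map

instance : (muD u ϖ).IsAddLeftInvariant :=
  isAddLeftInvariant_map
    (QuaternionAlgebra.addEquivTuple (u : k) 0 (ϖ : k)).symm.toAddHom
    (homeoD u ϖ).symm.continuous.measurable
    (homeoD u ϖ).symm.surjective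

theorem muD_apply_homeo (s : Set (Fin 4 → k)) :
    muD u ϖ (homeoD u ϖ ⁻¹' s) = (Measure.pi fun _ : Fin 4 => mu k) s := by
  rw [muD]
  have := (homeoD u ϖ).symm.toMeasurableEquiv.map_apply (μ := Measure.pi fun _ : Fin 4 => mu k)
    (homeoD u ϖ ⁻¹' s)
  refine this.trans ?_
  congr 1
  ext t
  simp

/-- The set of quaternions with prescribed bounds of coordinates. -/
theorem muD_box (a b : ℤ) : muD u ϖ {w | w.re ∈ ballk k a ∧ w.imI ∈ ballk k a ∧
    w.imJ ∈ ballk k b ∧ w.imK ∈ ballk k b} = mu k (ballk k a) ^ 2 * mu k (ballk k b) ^ 2 := by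
  have : {w : D u ϖ | w.re ∈ ballk k a ∧ w.imI ∈ ballk k a ∧
    w.imJ ∈ ballk k b ∧ w.imK ∈ ballk k b} = homeoD u ϖ ⁻¹' (Set.univ.pi
      ![(ballk k a : Set k), ballk k a, ballk k b, ballk k b]) := by
    ext w
    simp only [Set.mem_preimage, Set.mem_univ_pi, Fin.forall_fin_succ]
    simp [homeoD, QuaternionAlgebra.equivTuple_apply]
  rw [this, muD_apply_homeo, Measure.pi_pi]
  simp [Fin.prod_univ_succ]
  ring

/-- The ideal is a box whose shape depends on the parity of `m`; in both cases the four exponents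
add up to `2 * m`. -/
theorem muD_ballD (h : BaseData u ϖ) (m : ℤ) :
    muD u ϖ (ballD h m) = ENNReal.ofReal ((resCard k : ℝ) ^ (2 * m) * volO k ^ 4) := by
  have hq := h.q_pos
  have hv := (volO_pos h).le
  obtain ⟨j, rfl | rfl⟩ := Int.even_or_odd' m
  · have : (ballD h (2 * j) : Set (D u ϖ)) = {w | w.re ∈ ballk k j ∧ w.imI ∈ ballk k j ∧
        w.imJ ∈ ballk k j ∧ w.imK ∈ ballk k j} := by
      ext w; exact h.nr_le_even
    rw [this, muD_box, mu_ballk h, ← ENNReal.ofReal_pow (by positivity),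
      ← ENNReal.ofReal_mul (by positivity)]
    congr 1
    rw [show 2 * (2 * j) = j + j + (j + j) by ring, zpow_add₀ hq.ne', zpow_add₀ hq.ne']
    ring
  · have : (ballD h (2 * j + 1) : Set (D u ϖ)) = {w | w.re ∈ ballk k j ∧ w.imI ∈ ballk k j ∧
        w.imJ ∈ ballk k (j + 1) ∧ w.imK ∈ ballk k (j + 1)} := by
      ext w; exact h.nr_le_odd
    rw [this, muD_box, mu_ballk h, mu_ballk h, ← ENNReal.ofReal_pow (by positivity),
      ← ENNReal.ofReal_pow (by positivity), ← ENNReal.ofReal_mul (by positivity)]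
    congr 1
    have e : 2 * (2 * j + 1) = j + j + ((j + 1) + (j + 1)) := by ring
    rw [e, zpow_add₀ hq.ne' (j + j), zpow_add₀ hq.ne' j j, zpow_add₀ hq.ne' (j + 1) (j + 1)]
    ring

theorem muD_real_ballD (h : BaseData u ϖ) (m : ℤ) :
    (muD u ϖ).real (ballD h m) = (resCard k : ℝ) ^ (2 * m) * volO k ^ 4 := by
  have hq := h.q_pos
  have hv := (volO_pos h).le
  rw [Measure.real, muD_ballD, ENNReal.toReal_ofReal (by positivity)]

theorem muD_ballD_ne_zero (h : BaseData u ϖ) (m : ℤ) : muD u ϖ (ballD h m) ≠ 0 := by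
  have hq := h.q_pos
  have hv := volO_pos h
  rw [muD_ballD]
  exact (ENNReal.ofReal_pos.mpr (by positivity)).ne'

theorem muD_ballD_ne_top (h : BaseData u ϖ) (m : ℤ) : muD u ϖ (ballD h m) ≠ ⊤ := by
  rw [muD_ballD]
  exact ENNReal.ofReal_ne_top

end Balls

/-! ### The first row of a random element of `K` -/

section HaarK

variable {k : Type*} [NontriviallyNormedField k] [IsUltrametricDist k] {u ϖ : Valued.integer k}

/-- Consequently the norm of a value does not change when the row is divided by a unit of the
maximal order, so a unit entry of the row may be taken to be `1`. -/
theorem val_mul_left (x : X u ϖ) (c a b : D u ϖ) : val x (c * a) (c * b) = nr c * val x a b := by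
  have h1 : c * a * off x * star (c * b) = c * (a * off x * star b) * star c := by
    simp only [star_mul, mul_assoc]
  have h2 : ∀ y : D u ϖ, (c * y * star c).re = nr c * y.re := by
    intro y
    simp only [nr, QuaternionAlgebra.re_mul, QuaternionAlgebra.imI_mul,
      QuaternionAlgebra.imJ_mul, QuaternionAlgebra.imK_mul, QuaternionAlgebra.re_star,
      QuaternionAlgebra.imI_star, QuaternionAlgebra.imJ_star, QuaternionAlgebra.imK_star]
    ring
  rw [val, val, nr_mul, nr_mul, h1, h2]
  ring

/-- The first entry of the first row. -/
def row₁ (κ : K u ϖ) : D u ϖ := κ.1 0 0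

/-- The second entry of the first row. -/
def row₂ (κ : K u ϖ) : D u ϖ := κ.1 0 1

theorem row₁_mul_lowK (κ : K u ϖ) (c : order u ϖ) :
    row₁ (κ * lowK c) = row₁ κ + row₂ κ * c := by
  simp [row₁, row₂, lowK, Matrix.mul_apply, Fin.sum_univ_two]

theorem row₂_mul_lowK (κ : K u ϖ) (c : order u ϖ) : row₂ (κ * lowK c) = row₂ κ := by
  simp [row₂, lowK, Matrix.mul_apply, Fin.sum_univ_two]

theorem row₁_mul_swapK (κ : K u ϖ) : row₁ (κ * swapK) = row₂ κ := by
  simp [row₁, row₂, swapK, Matrix.mul_apply, Fin.sum_univ_two]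

theorem row₂_mul_swapK (κ : K u ϖ) : row₂ (κ * swapK) = row₁ κ := by
  simp [row₁, row₂, swapK, Matrix.mul_apply, Fin.sum_univ_two]

theorem continuous_row₁ : Continuous (row₁ : K u ϖ → D u ϖ) :=
  continuous_subtype_val.comp (Units.continuous_val.matrix_elem 0 0)

theorem continuous_row₂ : Continuous (row₂ : K u ϖ → D u ϖ) :=
  continuous_subtype_val.comp (Units.continuous_val.matrix_elem 0 1)

theorem BaseData.nr_row₁_le (h : BaseData u ϖ) (κ : K u ϖ) : ‖nr (row₁ κ)‖ ≤ 1 :=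
  h.nr_entry_le κ 0 0

theorem BaseData.nr_row₂_le (h : BaseData u ϖ) (κ : K u ϖ) : ‖nr (row₂ κ)‖ ≤ 1 :=
  h.nr_entry_le κ 0 1

/-- Rows of `K` are primitive. -/
theorem BaseData.row_primitive (h : BaseData u ϖ) (κ : K u ϖ) (h2 : ‖nr (row₂ κ)‖ < 1) :
    ‖nr (row₁ κ)‖ = 1 := by
  refine le_antisymm (h.nr_row₁_le κ) (not_lt.mp fun h1 => ?_)
  have e : row₁ κ * (κ⁻¹.1 0 0 : order u ϖ) + row₂ κ * (κ⁻¹.1 1 0 : order u ϖ) = 1 := by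
    have : (κ.1 * κ⁻¹.1) 0 0 = (1 : order u ϖ) := by rw [κ.mul_inv]; simp
    rw [Matrix.mul_apply, Fin.sum_univ_two] at this
    exact congrArg Subtype.val this
  have hlt : ∀ a b : D u ϖ, ‖nr a‖ < 1 → ‖nr b‖ ≤ 1 → ‖nr (a * b)‖ < 1 := by
    intro a b ha hb
    rw [nr_mul, norm_mul]
    exact (mul_le_of_le_one_right (norm_nonneg _) hb).trans_lt ha
  have := h.nr_add_lt (hlt _ _ h1 (h.nr_entry_le κ⁻¹ 0 0)) (hlt _ _ h2 (h.nr_entry_le κ⁻¹ 1 0))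
  simp only [inclK_apply] at this
  rw [e, nr_one, norm_one] at this
  exact lt_irrefl _ this

variable [ProperSpace k]

instance : (haarK u ϖ).IsHaarMeasure := by unfold haarK; infer_instance

instance : IsProbabilityMeasure (haarK u ϖ) :=
  ⟨Measure.haarMeasure_self (K₀ := (⊤ : PositiveCompacts (K u ϖ)))⟩

/-- A right translate of Haar measure is again left invariant, hence a multiple of it, and on a
compact group the total mass forces the factor to be `1`. -/
instance : (haarK u ϖ).IsMulRightInvariant where
  map_mul_right_eq_self g := by
    have hm : Measurable fun κ : K u ϖ => κ * g := (continuous_mul_const g).measurable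
    have h1 := Measure.isMulInvariant_eq_smul_of_compactSpace
      ((haarK u ϖ).map (· * g)) (haarK u ϖ)
    have h2 := congrArg (fun M : Measure (K u ϖ) => M Set.univ) h1
    simp only [Measure.smul_apply] at h2
    rw [Measure.map_apply hm MeasurableSet.univ, Set.preimage_univ, measure_univ] at h2
    rw [h1]
    have : ((((haarK u ϖ).map (· * g)).haarScalarFactor (haarK u ϖ) : NNReal) : ENNReal) = 1 := by
      simpa [ENNReal.smul_def] using h2.symm
    rw [ENNReal.coe_eq_one.mp this, one_smul]

variable [MeasurableSpace k] [BorelSpace k]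

omit [ProperSpace k] in
theorem measurable_invD [SecondCountableTopology k] : Measurable (invD : D u ϖ → D u ϖ) :=
  (continuous_nr.measurable.inv).smul continuous_star.measurable

/-- Right multiplication by `(1, 0; c, 1)` preserves Haar measure and the second entry `b` of the
row, and translates `b⁻¹ a` by `c`. The law of `b⁻¹ a` is thus invariant under the maximal order and
must be uniform. -/
theorem integral_row₂ (h : BaseData u ϖ) {f : D u ϖ → ℂ} (hf : Measurable f) :
    ∫ κ in {κ | ‖nr (row₂ κ)‖ = 1}, f (invD (row₂ κ) * row₁ κ) ∂(haarK u ϖ) =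
      (haarK u ϖ).real {κ | ‖nr (row₂ κ)‖ = 1} * ⨍ w in (ballD h 0 : Set (D u ϖ)), f w ∂(muD u ϖ) := by
  set E : Set (K u ϖ) := {κ | ‖nr (row₂ κ)‖ = 1} with hEdef
  have hE : MeasurableSet E :=
    (isClosed_eq (continuous_nr.comp continuous_row₂).norm continuous_const).measurableSet
  have hφ : Measurable fun κ : K u ϖ => invD (row₂ κ) * row₁ κ :=
    (measurable_invD.comp continuous_row₂.measurable).mul continuous_row₁.measurable
  rw [integral_comp_eq_setAverage ((haarK u ϖ).restrict E) hφ (muD u ϖ) (measurableSet_ballD h 0)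
    (muD_ballD_ne_zero h 0) (muD_ballD_ne_top h 0) ?_ ?_ hf, measureReal_restrict_apply_univ]
  · refine (ae_restrict_iff' hE).mpr (Filter.Eventually.of_forall fun κ hκ => ?_)
    rw [mem_ballD, zpow_zero, nr_mul, nr_invD, norm_mul, norm_inv, hκ, inv_one, one_mul]
    exact h.nr_row₁_le κ
  · intro c hc
    set c' : order u ϖ := ⟨c, h.mem_order_iff.mpr (by simpa using mem_ballD.mp hc)⟩ with hc'
    have hR : Measurable fun κ : K u ϖ => κ * lowK c' := (continuous_mul_const _).measurable
    have hP : ((haarK u ϖ).restrict E).map (· * lowK c') = (haarK u ϖ).restrict E := by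
      have hpre : (· * lowK c') ⁻¹' E = E := by
        ext κ; simp only [hEdef, Set.mem_preimage, Set.mem_ofPred_eq, row₂_mul_lowK]
      have := Measure.restrict_map (μ := haarK u ϖ) hR hE
      rw [hpre, map_mul_right_eq_self] at this
      exact this.symm
    conv_rhs => rw [← hP]
    rw [Measure.map_map hφ hR]
    refine Measure.map_congr ((ae_restrict_iff' hE).mpr (Filter.Eventually.of_forall fun κ hκ => ?_))
    have h0 : nr (row₂ κ) ≠ 0 := norm_ne_zero_iff.mp (by rw [hκ]; exact one_ne_zero)
    simp only [Function.comp, row₂_mul_lowK, row₁_mul_lowK, mul_add]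
    rw [← mul_assoc (invD _) (row₂ κ), invD_mul h0, one_mul]

theorem integral_row₁ (h : BaseData u ϖ) {f : D u ϖ → ℂ} (hf : Measurable f) :
    ∫ κ in {κ | ‖nr (row₁ κ)‖ = 1}, f (invD (row₁ κ) * row₂ κ) ∂(haarK u ϖ) =
      (haarK u ϖ).real {κ | ‖nr (row₂ κ)‖ = 1} * ⨍ w in (ballD h 0 : Set (D u ϖ)), f w ∂(muD u ϖ) := by
  rw [← integral_row₂ h hf, ← integral_indicator, ← integral_indicator,
    ← integral_mul_right_eq_self _ (swapK (u := u) (ϖ := ϖ))]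
  · refine integral_congr_ae (Filter.Eventually.of_forall fun κ => ?_)
    simp only [Set.indicator_apply, Set.mem_ofPred_eq, row₁_mul_swapK, row₂_mul_swapK]
  · exact (isClosed_eq (continuous_nr.comp continuous_row₂).norm continuous_const).measurableSet
  · exact (isClosed_eq (continuous_nr.comp continuous_row₁).norm continuous_const).measurableSet

theorem setAverage_indicator_ballD (h : BaseData u ϖ) (f : D u ϖ → ℂ) :
    ⨍ w in (ballD h 0 : Set (D u ϖ)), (ballD h (-1) : Set (D u ϖ)).indicator f w ∂(muD u ϖ) =
      ((resCard k : ℂ)⁻¹ ^ 2) * ⨍ w in (ballD h (-1) : Set (D u ϖ)), f w ∂(muD u ϖ) := by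
  have hq := h.q_pos
  have hv := volO_pos h
  have hsub : (ballD h (-1) : Set (D u ϖ)) ⊆ ballD h 0 := fun w hw => ballD_mono h (by norm_num) hw
  rw [setAverage_eq, setAverage_eq, setIntegral_indicator (measurableSet_ballD h _),
    Set.inter_eq_right.mpr hsub, muD_real_ballD, muD_real_ballD]
  simp only [Complex.real_smul]
  have hqc : (resCard k : ℂ) ≠ 0 := by exact_mod_cast hq.ne'
  have hvc : (volO k : ℂ) ≠ 0 := by exact_mod_cast hv.ne'
  push_cast
  simp only [zpow_neg, zpow_ofNat]
  field_simp

/-- Rows are primitive, so the complement is the locus where the first entry is a unit and the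
quotient lies in the maximal ideal. The factor `q⁻²` is the relative measure of that ideal in the
order. -/
theorem integral_row₂_compl (h : BaseData u ϖ) {f : D u ϖ → ℂ} (hf : Measurable f) :
    ∫ κ in {κ | ‖nr (row₂ κ)‖ = 1}ᶜ, f (invD (row₁ κ) * row₂ κ) ∂(haarK u ϖ) =
      (haarK u ϖ).real {κ | ‖nr (row₂ κ)‖ = 1} * ((resCard k : ℂ)⁻¹ ^ 2 *
        ⨍ w in (ballD h (-1) : Set (D u ϖ)), f w ∂(muD u ϖ)) := by
  rw [← setAverage_indicator_ballD, ← integral_row₁ h (hf.indicator (measurableSet_ballD h _)),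
    ← integral_indicator, ← integral_indicator]
  · refine integral_congr_ae (Filter.Eventually.of_forall fun κ => ?_)
    have hmem : invD (row₁ κ) * row₂ κ ∈ (ballD h (-1) : Set (D u ϖ)) ↔
        ‖nr (row₁ κ)‖⁻¹ * ‖nr (row₂ κ)‖ ≤ (resCard k : ℝ)⁻¹ := by
      rw [SetLike.mem_coe, mem_ballD, nr_mul, nr_invD, norm_mul, norm_inv, zpow_neg_one]
    simp only [Set.indicator_apply (s := {κ | ‖nr (row₂ κ)‖ = 1}ᶜ),
      Set.indicator_apply (s := {κ | ‖nr (row₁ κ)‖ = 1}), Set.mem_ofPred_eq, Set.mem_compl_iff]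
    by_cases h2 : ‖nr (row₂ κ)‖ = 1
    · rw [if_neg (not_not.mpr h2)]
      split_ifs with h1
      · rw [Set.indicator_of_notMem]
        rw [hmem, h1, h2, inv_one, one_mul, not_le]
        exact inv_lt_one_of_one_lt₀ h.one_lt
      · rfl
    · have h1 := h.row_primitive κ (lt_of_le_of_ne (h.nr_row₂_le κ) h2)
      rw [if_pos h2, if_pos h1, Set.indicator_of_mem]
      rw [hmem, h1, inv_one, one_mul, ← zpow_neg_one]
      refine h.norm_le_zpow_of_lt ?_
      rw [neg_add_cancel, zpow_zero]
      exact lt_of_le_of_ne (h.nr_row₂_le κ) h2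
  · exact (isClosed_eq (continuous_nr.comp continuous_row₁).norm continuous_const).measurableSet
  · exact (isClosed_eq (continuous_nr.comp continuous_row₂).norm
      continuous_const).measurableSet.compl

/-- For the constant function `1` the previous formula says that the complementary probability is
`q⁻²` times the probability itself. -/
theorem haarK_row₂ (h : BaseData u ϖ) :
    ((haarK u ϖ).real {κ | ‖nr (row₂ κ)‖ = 1} : ℂ) * (1 + (resCard k : ℂ)⁻¹ ^ 2) = 1 := by
  set E : Set (K u ϖ) := {κ | ‖nr (row₂ κ)‖ = 1} with hEdef
  have hE : MeasurableSet E :=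
    (isClosed_eq (continuous_nr.comp continuous_row₂).norm continuous_const).measurableSet
  have h1 := integral_row₂_compl h (f := fun _ => 1) measurable_const
  rw [setAverage_const (muD_ballD_ne_zero h _) (muD_ballD_ne_top h _), setIntegral_const,
    ← hEdef, probReal_compl_eq_one_sub hE] at h1
  simp only [Complex.real_smul] at h1
  push_cast at h1
  linear_combination -h1

/-- The integral over `K` in terms of averages over the maximal order and its maximal ideal. -/
theorem integral_val (h : BaseData u ϖ) (x : X u ϖ) {g : k → ℂ} (hg : Measurable g)
    (hgn : ∀ c t : k, ‖c‖ = 1 → g (c * t) = g t)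
    (hint : Integrable (fun κ => g (val x (row₁ κ) (row₂ κ))) (haarK u ϖ)) :
    (1 + (resCard k : ℂ)⁻¹ ^ 2) * ∫ κ, g (val x (row₁ κ) (row₂ κ)) ∂(haarK u ϖ) =
      ⨍ w in (ballD h 0 : Set (D u ϖ)), g (val x w 1) ∂(muD u ϖ) +
      (resCard k : ℂ)⁻¹ ^ 2 * ⨍ w in (ballD h (-1) : Set (D u ϖ)), g (val x 1 w) ∂(muD u ϖ) := by
  set E : Set (K u ϖ) := {κ | ‖nr (row₂ κ)‖ = 1} with hEdef
  have hE : MeasurableSet E :=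
    (isClosed_eq (continuous_nr.comp continuous_row₂).norm continuous_const).measurableSet
  have hval : ∀ b : D u ϖ, (Measurable fun w => g (val x w b)) ∧ Measurable fun w => g (val x b w) := by
    intro b
    have h1 := continuous_nr (u := u) (ϖ := ϖ)
    have h2 := continuous_re (u := u) (ϖ := ϖ)
    constructor
    · refine hg.comp (Continuous.measurable ?_)
      unfold val
      exact ((continuous_const.mul h1).add continuous_const).add
        (continuous_const.mul (h2.comp ((continuous_id.mul continuous_const).mul continuous_const)))
    · refine hg.comp (Continuous.measurable ?_)
      unfold val
      exact (continuous_const.add (continuous_const.mul h1)).add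
        (continuous_const.mul (h2.comp (continuous_const.mul continuous_star)))
  have e1 : ∫ κ in E, g (val x (row₁ κ) (row₂ κ)) ∂(haarK u ϖ) =
      (haarK u ϖ).real E * ⨍ w in (ballD h 0 : Set (D u ϖ)), g (val x w 1) ∂(muD u ϖ) := by
    rw [← integral_row₂ h (hval 1).1]
    refine setIntegral_congr_fun hE fun κ hκ => ?_
    have h0 : nr (row₂ κ) ≠ 0 := norm_ne_zero_iff.mp (by rw [hκ]; exact one_ne_zero)
    rw [← hgn (nr (row₂ κ)) (val x (invD (row₂ κ) * row₁ κ) 1) hκ, ← val_mul_left, ← mul_assoc,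
      mul_invD h0, one_mul, mul_one]
  have e2 : ∫ κ in Eᶜ, g (val x (row₁ κ) (row₂ κ)) ∂(haarK u ϖ) =
      (haarK u ϖ).real E * ((resCard k : ℂ)⁻¹ ^ 2 *
        ⨍ w in (ballD h (-1) : Set (D u ϖ)), g (val x 1 w) ∂(muD u ϖ)) := by
    rw [← integral_row₂_compl h (hval 1).2]
    refine setIntegral_congr_fun hE.compl fun κ hκ => ?_
    have h1 := h.row_primitive κ (lt_of_le_of_ne (h.nr_row₂_le κ) hκ)
    have h0 : nr (row₁ κ) ≠ 0 := norm_ne_zero_iff.mp (by rw [h1]; exact one_ne_zero)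
    rw [← hgn (nr (row₁ κ)) (val x 1 (invD (row₁ κ) * row₂ κ)) h1, ← val_mul_left, ← mul_assoc,
      mul_invD h0, one_mul, mul_one]
  rw [← integral_add_compl hE hint, e1, e2]
  have hH := haarK_row₂ h
  rw [← hEdef] at hH
  linear_combination (⨍ w in (ballD h 0 : Set (D u ϖ)), g (val x w 1) ∂(muD u ϖ) +
    (resCard k : ℂ)⁻¹ ^ 2 * ⨍ w in (ballD h (-1) : Set (D u ϖ)), g (val x 1 w) ∂(muD u ϖ)) * hH

end HaarK

/-! ### Averages of quasi-characters over linear images of ideals -/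

section Average

variable {k : Type*} [NontriviallyNormedField k] [IsUltrametricDist k] {u ϖ : Valued.integer k}

/-- Functions on `k` behaving like `t ↦ |t|ˢ` with `S = q⁻ˢ`. -/
structure QuasiChar [MeasurableSpace k] (ϖ : Valued.integer k) (g : k → ℂ) (S : ℂ) : Prop where
  meas : Measurable g
  one : ∀ t, ‖t‖ = 1 → g t = 1
  unit_mul : ∀ c t, ‖c‖ = 1 → g (c * t) = g t
  prime_mul : ∀ t, g (ϖ * t) = S * g t
  bdd : ∀ t, ‖t‖ ≤ 1 → ‖g t‖ ≤ 1

variable [ProperSpace k]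

/-- The average over `K` of a function of the upper left entry. -/
def avgK (g : k → ℂ) (x : X u ϖ) : ℂ := ∫ κ, g (ent₁ (act (inclK u ϖ κ) x)) ∂(haarK u ϖ)

/-- Right invariance of Haar measure makes the average a function of the orbit, so any convenient
representative may be used. -/
theorem avgK_act (g : k → ℂ) (x : X u ϖ) (κ : K u ϖ) :
    avgK g (act (inclK u ϖ κ) x) = avgK g x := by
  have := integral_mul_right_eq_self (μ := haarK u ϖ)
    (fun κ' => g (ent₁ (act (inclK u ϖ κ') x))) κ
  simp only [map_mul, act_mul] at this
  exact this

theorem avgK_eq_of_isType (h : BaseData u ϖ) (g : k → ℂ) {m : ℤ} {n : ℕ} {x y : X u ϖ}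
    (hx : IsType m n x) (hy : IsType m n y) : avgK g x = avgK g y := by
  obtain ⟨κ, rfl⟩ := hx.kEq h hy
  exact (avgK_act g x κ).symm

variable [MeasurableSpace k] [BorelSpace k] {g : k → ℂ} {S : ℂ}

omit [ProperSpace k] [BorelSpace k] in
theorem QuasiChar.prime_zpow_mul (hg : QuasiChar ϖ g S) (h : BaseData u ϖ) (hS : S ≠ 0) (j : ℤ)
    (t : k) : g ((ϖ : k) ^ j * t) = S ^ j * g t := by
  have hϖ := h.prime_ne
  induction j using Int.induction_on with
  | zero => simp
  | succ i ih =>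
    rw [zpow_add_one₀ hϖ, zpow_add_one₀ hS, mul_comm _ (ϖ : k), mul_assoc, hg.prime_mul, ih]
    ring
  | pred i ih =>
    refine mul_left_cancel₀ hS ?_
    rw [← hg.prime_mul, ← mul_assoc, ← zpow_one_add₀ hϖ, ← mul_assoc, ← zpow_one_add₀ hS,
      add_sub_cancel, ih]

omit [BorelSpace k] in
theorem QuasiChar.avgK_scale (hg : QuasiChar ϖ g S) (h : BaseData u ϖ) (hS : S ≠ 0) {m : ℤ} {n : ℕ}
    {x x₀ : X u ϖ} (hx : IsType m n x) (hx₀ : IsType 0 n x₀) :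
    avgK g x = S ^ (-m) * avgK g x₀ := by
  obtain ⟨y, h1, h2, h3⟩ := h.exists_scale x₀ (zpow_ne_zero (-m) h.prime_ne)
  have hy := hx₀.scale h (h.norm_prime_zpow (-m)) h1 h2 h3
  rw [neg_neg, zero_add] at hy
  rw [avgK_eq_of_isType h g hx hy, avgK, avgK, ← integral_const_mul]
  refine integral_congr_ae (Filter.Eventually.of_forall fun κ => ?_)
  simp only
  rw [(act_scale h h1 h2 h3 _).1, hg.prime_zpow_mul h hS]

omit [ProperSpace k] [MeasurableSpace k] [BorelSpace k] in
theorem continuous_act_ent₁ (h : BaseData u ϖ) (x : X u ϖ) :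
    Continuous fun κ : K u ϖ => ent₁ (act (inclK u ϖ κ) x) := by
  simp only [h.ent₁_act]
  change Continuous fun κ => val x (row₁ κ) (row₂ κ)
  have h1 := continuous_nr (u := u) (ϖ := ϖ)
  have h2 := continuous_re (u := u) (ϖ := ϖ)
  have h3 := continuous_row₁ (u := u) (ϖ := ϖ)
  have h4 := continuous_row₂ (u := u) (ϖ := ϖ)
  unfold val
  exact ((continuous_const.mul (h1.comp h3)).add (continuous_const.mul (h1.comp h4))).add
    (continuous_const.mul (h2.comp ((h3.mul continuous_const).mul h4.star)))

theorem QuasiChar.avgK_eq (hg : QuasiChar ϖ g S) (h : BaseData u ϖ) {x : X u ϖ} (hx : Lev 0 x) :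
    (1 + (resCard k : ℂ)⁻¹ ^ 2) * avgK g x =
      ⨍ w in (ballD h 0 : Set (D u ϖ)), g (val x w 1) ∂(muD u ϖ) +
      (resCard k : ℂ)⁻¹ ^ 2 * ⨍ w in (ballD h (-1) : Set (D u ϖ)), g (val x 1 w) ∂(muD u ϖ) := by
  rw [← integral_val h x hg.meas (fun c t => hg.unit_mul c t)]
  · simp only [avgK, h.ent₁_act]; rfl
  · have : (fun κ : K u ϖ => g (val x (row₁ κ) (row₂ κ))) =
        fun κ => g (ent₁ (act (inclK u ϖ κ) x)) := by
      funext κ; rw [h.ent₁_act]; rfl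
    rw [this]
    refine Integrable.of_bound (C := 1)
      (hg.meas.comp (continuous_act_ent₁ h x).measurable).aestronglyMeasurable ?_
    refine Filter.Eventually.of_forall fun κ => hg.bdd _ ?_
    simpa using (hx.act h κ).1

theorem QuasiChar.setAverage_ballk (hg : QuasiChar ϖ g S) (h : BaseData u ϖ) :
    ⨍ t in (ballk k (-1) : Set k), g t ∂(mu k) = S * ⨍ t in (ballk k 0 : Set k), g t ∂(mu k) := by
  have hϖ := h.prime_ne
  have hq := h.q_pos
  rw [← setAverage_const_mul, ← setAverage_comp_hom (mu k) (measurableSet_ballk 0)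
    (mu_ballk_ne_zero h 0) (mu_ballk_ne_top 0) (mu k) (measurableSet_ballk (-1))
    (mu_ballk_ne_zero h _) (mu_ballk_ne_top _) (φ := fun t => (ϖ : k) * t)
    (measurable_const_mul _) (fun a b => mul_add _ a b) ?_ ?_ hg.meas]
  · simp only [hg.prime_mul]
  · intro t ht
    rw [mem_ballk, norm_mul, h.norm_prime, zpow_neg_one]
    exact mul_le_of_le_one_right (inv_pos.mpr hq).le (by simpa using mem_ballk.mp ht)
  · intro t ht
    refine ⟨(ϖ : k)⁻¹ * t, ?_, by field_simp⟩
    rw [mem_ballk, norm_mul, norm_inv, h.norm_prime, inv_inv, zpow_zero]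
    have := mem_ballk.mp ht
    rw [zpow_neg_one] at this
    calc _ ≤ (resCard k : ℝ) * (resCard k : ℝ)⁻¹ := by gcongr
      _ = 1 := mul_inv_cancel₀ hq.ne'

/-- The ring of integers is split into the units, where `g` is `1`, and the maximal ideal, where the
average is `S` times the original one. -/
theorem QuasiChar.average_eq (hg : QuasiChar ϖ g S) (h : BaseData u ϖ) :
    (1 - S * (resCard k : ℂ)⁻¹) * ⨍ t in (ballk k 0 : Set k), g t ∂(mu k) =
      1 - (resCard k : ℂ)⁻¹ := by
  have hq := h.q_pos
  have hv := volO_pos h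
  have hint : IntegrableOn g (ballk k 0 : Set k) (mu k) := by
    refine Measure.integrableOn_of_bounded (M := 1) (mu_ballk_ne_top 0) hg.meas.aestronglyMeasurable ?_
    refine (ae_restrict_iff' (measurableSet_ballk 0)).mpr (Filter.Eventually.of_forall fun t ht => ?_)
    exact hg.bdd t (by simpa using mem_ballk.mp ht)
  have h1 := setAverage_diff_add (mu_ballk_ne_top 0) (measurableSet_ballk (-1))
    (fun t ht => ballk_mono h (by norm_num) ht) (mu_ballk_ne_zero h (-1)) hint (c := 1)
    (measurableSet_ballk 0) (fun t ht => hg.one t (h.norm_eq_one (by simpa using mem_ballk.mp ht.1)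
      ht.2))
  have e : (mu k).real (ballk k (-1)) / (mu k).real (ballk k 0) = (resCard k : ℝ)⁻¹ := by
    rw [mu_real_ballk h, mu_real_ballk h, zpow_neg_one, zpow_zero]
    field_simp
  rw [e, hg.setAverage_ballk h] at h1
  push_cast at h1
  linear_combination h1

/-- An additive surjection from an ideal of `D` onto an ideal of `k`. -/
theorem setAverage_linear (h : BaseData u ϖ) (hg : Measurable g) {m j : ℤ} {φ : D u ϖ → k}
    (hφ : Continuous φ) (hadd : ∀ a b, φ (a + b) = φ a + φ b)
    (hmap : ∀ a, ‖nr a‖ ≤ (resCard k : ℝ) ^ m → ‖φ a‖ ≤ (resCard k : ℝ) ^ j)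
    (hsurj : ∀ b, ‖b‖ ≤ (resCard k : ℝ) ^ j → ∃ a, ‖nr a‖ ≤ (resCard k : ℝ) ^ m ∧ φ a = b) :
    ⨍ w in (ballD h m : Set (D u ϖ)), g (φ w) ∂(muD u ϖ) =
      ⨍ t in (ballk k j : Set k), g t ∂(mu k) :=
  setAverage_comp_hom (muD u ϖ) (measurableSet_ballD h m) (muD_ballD_ne_zero h m)
    (muD_ballD_ne_top h m) (mu k) (measurableSet_ballk j) (mu_ballk_ne_zero h j)
    (mu_ballk_ne_top j) hφ.measurable hadd hmap hsurj hg

omit [ProperSpace k] [MeasurableSpace k] [BorelSpace k] in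
theorem BaseData.norm_two_mul (h : BaseData u ϖ) (t : k) : ‖2 * t‖ = ‖t‖ := by
  rw [norm_mul, h.norm_two, one_mul]

theorem QuasiChar.average_trace (hg : QuasiChar ϖ g S) (h : BaseData u ϖ) :
    ⨍ w in (ballD h 0 : Set (D u ϖ)), g (2 * w.re) ∂(muD u ϖ) =
      ⨍ t in (ballk k 0 : Set k), g t ∂(mu k) := by
  refine setAverage_linear h hg.meas (φ := fun w : D u ϖ => 2 * w.re)
    (continuous_const.mul continuous_re)
    (fun a b => by rw [QuaternionAlgebra.re_add, mul_add]) (fun a ha => ?_) (fun b hb => ?_)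
  · rw [h.norm_two_mul]; exact (h.nr_le_even (m := 0).mp ha).1
  · have := h.two_ne
    refine ⟨⟨b / 2, 0, 0, 0⟩, h.nr_le_even (m := 0).mpr ?_, by field_simp⟩
    simp [norm_div, h.norm_two]
    simpa using hb

theorem QuasiChar.average_trace_prime (hg : QuasiChar ϖ g S) (h : BaseData u ϖ) :
    ⨍ w in (ballD h (-1) : Set (D u ϖ)), g (2 * w.re) ∂(muD u ϖ) =
      ⨍ t in (ballk k (-1) : Set k), g t ∂(mu k) := by
  have hq := h.q_pos
  refine setAverage_linear h hg.meas (φ := fun w : D u ϖ => 2 * w.re)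
    (continuous_const.mul continuous_re)
    (fun a b => by rw [QuaternionAlgebra.re_add, mul_add]) (fun a ha => ?_) (fun b hb => ?_)
  · rw [h.norm_two_mul]; exact (h.nr_le_odd (m := -1).mp ha).1
  · have := h.two_ne
    refine ⟨⟨b / 2, 0, 0, 0⟩, h.nr_le_odd (m := -1).mpr ?_, by field_simp⟩
    simp [norm_div, h.norm_two, hq.le]
    simpa using hb

theorem QuasiChar.average_invPi (hg : QuasiChar ϖ g S) (h : BaseData u ϖ) :
    ⨍ w in (ballD h 0 : Set (D u ϖ)), g (2 * (w * invPi u ϖ).re) ∂(muD u ϖ) =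
      ⨍ t in (ballk k 0 : Set k), g t ∂(mu k) := by
  have hϖ := h.prime_ne
  have e : ∀ w : D u ϖ, (w * invPi u ϖ).re = w.imJ := by
    intro w
    simp [invPi, QuaternionAlgebra.re_mul]
    field_simp
  simp only [e]
  refine setAverage_linear h hg.meas (φ := fun w : D u ϖ => 2 * w.imJ)
    (continuous_const.mul continuous_imJ)
    (fun a b => by rw [QuaternionAlgebra.imJ_add, mul_add]) (fun a ha => ?_) (fun b hb => ?_)
  · rw [h.norm_two_mul]; exact (h.nr_le_even (m := 0).mp ha).2.2.1
  · have := h.two_ne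
    refine ⟨⟨0, 0, b / 2, 0⟩, h.nr_le_even (m := 0).mpr ?_, by field_simp⟩
    simp [norm_div, h.norm_two]
    simpa using hb

/-- Multiplication by `Π⁻¹` takes the maximal ideal back to the order, whose trace is all of the
ring of integers. No factor `S` appears here, in contrast to `QuasiChar.average_trace_prime`. -/
theorem QuasiChar.average_invPi_prime (hg : QuasiChar ϖ g S) (h : BaseData u ϖ) :
    ⨍ w in (ballD h (-1) : Set (D u ϖ)), g (2 * (invPi u ϖ * star w).re) ∂(muD u ϖ) =
      ⨍ t in (ballk k 0 : Set k), g t ∂(mu k) := by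
  have hϖ := h.prime_ne
  have hq := h.q_pos
  have e : ∀ w : D u ϖ, (invPi u ϖ * star w).re = -w.imJ := by
    intro w
    simp [invPi, QuaternionAlgebra.re_mul]
    field_simp
  simp only [e]
  refine setAverage_linear h hg.meas (φ := fun w : D u ϖ => 2 * -w.imJ)
    (continuous_const.mul continuous_imJ.neg)
    (fun a b => by rw [QuaternionAlgebra.imJ_add]; ring) (fun a ha => ?_) (fun b hb => ?_)
  · rw [h.norm_two_mul, norm_neg]; exact (h.nr_le_odd (m := -1).mp ha).2.2.1
  · have := h.two_ne
    refine ⟨⟨0, 0, -(b / 2), 0⟩, h.nr_le_odd (m := -1).mpr ?_, by field_simp⟩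
    simp [norm_div, h.norm_two, hq.le]
    simpa using hb

/-- The uniformizer `Π` of `D`. -/
def Pi (u ϖ : Valued.integer k) : D u ϖ := ⟨0, 0, 1, 0⟩

omit [ProperSpace k] [MeasurableSpace k] [BorelSpace k]

theorem nr_Pi : nr (Pi u ϖ) = -(ϖ : k) := by simp [nr, Pi]

theorem norm_nr_Pi_pow (h : BaseData u ϖ) (l : ℕ) :
    ‖nr (Pi u ϖ ^ l)‖ = (resCard k : ℝ) ^ (-(l : ℤ)) := by
  induction l with
  | zero => simp
  | succ l ih =>
    rw [pow_succ, nr_mul, norm_mul, ih, nr_Pi, norm_neg, h.norm_prime, ← zpow_neg_one,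
      ← zpow_add₀ h.q_pos.ne']
    congr 1; push_cast; ring

theorem Pi_mul_star_Pi : Pi u ϖ * star (Pi u ϖ) = QuaternionAlgebra.coe (-(ϖ : k)) := by
  rw [mul_star_eq_nr, nr_Pi]

variable [ProperSpace k] [MeasurableSpace k] [BorelSpace k]

theorem average_mul_Pi (h : BaseData u ϖ) {f : D u ϖ → ℂ} (hf : Measurable f) :
    ⨍ w in (ballD h (-1) : Set (D u ϖ)), f w ∂(muD u ϖ) =
      ⨍ w in (ballD h 0 : Set (D u ϖ)), f (w * Pi u ϖ) ∂(muD u ϖ) := by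
  have hq := h.q_pos
  have h0 : nr (Pi u ϖ) ≠ 0 := by rw [nr_Pi]; exact neg_ne_zero.mpr h.prime_ne
  refine (setAverage_comp_hom (muD u ϖ) (measurableSet_ballD h 0) (muD_ballD_ne_zero h 0)
    (muD_ballD_ne_top h 0) (muD u ϖ) (measurableSet_ballD h _) (muD_ballD_ne_zero h _)
    (muD_ballD_ne_top h _) (φ := fun w => w * Pi u ϖ) (continuous_mul_const _).measurable
    (fun a b => add_mul a b _) (fun a ha => ?_) (fun b hb => ?_) hf).symm
  · rw [mem_ballD, nr_mul, nr_Pi, norm_mul, norm_neg, h.norm_prime, zpow_neg_one]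
    exact mul_le_of_le_one_left (inv_pos.mpr hq).le (by simpa using mem_ballD.mp ha)
  · refine ⟨b * invD (Pi u ϖ), ?_, by rw [mul_assoc, invD_mul h0, mul_one]⟩
    rw [mem_ballD, nr_mul, nr_invD, nr_Pi, norm_mul, norm_inv, norm_neg, h.norm_prime, inv_inv,
      zpow_zero]
    have := mem_ballD.mp hb
    rw [zpow_neg_one] at this
    calc _ ≤ (resCard k : ℝ)⁻¹ * (resCard k : ℝ) := by gcongr
      _ = 1 := inv_mul_cancel₀ hq.ne'

end Average

/-! ### Recursion for the averages and the polynomials `P_n` -/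

section Recursion

variable {k : Type*} [NontriviallyNormedField k] [IsUltrametricDist k] {u ϖ : Valued.integer k}

theorem BaseData.isType_antidiag (h : BaseData u ϖ) {x : X u ϖ} (h1 : ent₁ x = 0) (h2 : ent₂ x = 0)
    (h3 : off x = 1) : IsType 0 1 x := by
  have h' := h.one_lt
  have hq := h.q_pos
  refine ⟨⟨by simp [h1], by simp [h2], by simp [h3, h'.le]⟩, fun hl => ?_, by simp [disc, h1, h3]⟩
  have := hl.2.2
  rw [h3, nr_one, norm_one] at this
  norm_num at this
  exact absurd this (not_le.mpr (inv_lt_one_of_one_lt₀ h'))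

theorem BaseData.isType_of_ent₁ (h : BaseData u ϖ) {x : X u ϖ} (h1 : ent₁ x = 1) (h2 : ent₂ x = 0)
    (h3 : off x = 1) : IsType 0 1 x := by
  have h' := h.one_lt
  refine ⟨⟨by simp [h1], by simp [h2], by simp [h3, h'.le]⟩, fun hl => ?_, by simp [disc, h2, h3]⟩
  have := hl.1
  rw [h1, norm_one] at this
  norm_num at this
  exact absurd this (not_le.mpr (inv_lt_one_of_one_lt₀ h'))

theorem BaseData.isType_of_ent₂ (h : BaseData u ϖ) {x : X u ϖ} {l : ℕ} (h1 : ent₁ x = 0)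
    (h2 : ent₂ x = 1) (h3 : off x = Pi u ϖ ^ l) : IsType 0 (l + 1) x := by
  have h' := h.one_lt
  refine ⟨⟨by simp [h1], by simp [h2], ?_⟩, fun hl => ?_, ?_⟩
  · rw [h3, norm_nr_Pi_pow h]
    exact zpow_le_zpow_right₀ h'.le (by omega)
  · have := hl.2.1
    rw [h2, norm_one] at this
    norm_num at this
    exact absurd this (not_le.mpr (inv_lt_one_of_one_lt₀ h'))
  · rw [disc, h1, zero_mul, zero_sub, norm_neg, h3, norm_nr_Pi_pow h]
    congr 1; push_cast; ring

theorem BaseData.isType_invPi (h : BaseData u ϖ) {x : X u ϖ} (h1 : ent₁ x = 0) (h2 : ent₂ x = 0)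
    (h3 : off x = invPi u ϖ) : IsType 0 0 x := by
  have h' := h.one_lt
  refine ⟨⟨by simp [h1], by simp [h2], by rw [h3, norm_nr_invPi h]; simp⟩, fun hl => ?_, ?_⟩
  · have := hl.2.2
    rw [h3, norm_nr_invPi h] at this
    norm_num at this
    exact absurd this (not_le.mpr ((inv_lt_one_of_one_lt₀ h').trans h'))
  · rw [disc, h1, zero_mul, zero_sub, norm_neg, h3, norm_nr_invPi h]
    simp

theorem BaseData.norm_re_lt (h : BaseData u ϖ) {a : D u ϖ}
    (ha : ‖nr a‖ ≤ (resCard k : ℝ) ^ (-1 : ℤ)) : ‖2 * a.re‖ < 1 := by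
  rw [h.norm_two_mul]
  refine ((h.nr_le_odd (m := -1)).mp ha).1.trans_lt ?_
  rw [zpow_neg_one]
  exact inv_lt_one_of_one_lt₀ h.one_lt

variable [ProperSpace k] [MeasurableSpace k] [BorelSpace k] {g : k → ℂ} {S : ℂ}

/-- The average of `g` over `t = N(w) + Tr(Π ^ l w*)`, `w` in the maximal order. -/
def traceAvg (h : BaseData u ϖ) (g : k → ℂ) (l : ℕ) : ℂ :=
  ⨍ w in (ballD h 0 : Set (D u ϖ)), g (nr w + 2 * (Pi u ϖ ^ l * star w).re) ∂(muD u ϖ)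

omit [ProperSpace k] [MeasurableSpace k] [BorelSpace k] in
theorem continuous_traceForm (c : D u ϖ) :
    Continuous fun w : D u ϖ => nr w + 2 * (c * star w).re :=
  (continuous_nr (u := u) (ϖ := ϖ)).add (continuous_const.mul
    ((continuous_re (u := u) (ϖ := ϖ)).comp (continuous_const.mul continuous_star)))

/-- The substitution `w = w' Π` multiplies both `N(w)` and `Tr(Π ^ (l + 1) w*)` by `-ϖ` and lowers
the power of `Π` by one. -/
theorem QuasiChar.average_traceForm_prime (hg : QuasiChar ϖ g S) (h : BaseData u ϖ) (l : ℕ) :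
    ⨍ w in (ballD h (-1) : Set (D u ϖ)), g (nr w + 2 * (Pi u ϖ ^ (l + 1) * star w).re) ∂(muD u ϖ) =
      S * traceAvg h g l := by
  have hf : Measurable fun w : D u ϖ => g (nr w + 2 * (Pi u ϖ ^ (l + 1) * star w).re) :=
    hg.meas.comp (continuous_traceForm _).measurable
  rw [average_mul_Pi h hf, traceAvg, ← setAverage_const_mul]
  refine setAverage_congr_fun (measurableSet_ballD h 0) fun w _ => ?_
  -- The sign in `Nrd(Π) = -ϖ` is absorbed by invariance under units.
  rw [← hg.prime_mul, ← hg.unit_mul (-1) (ϖ * _) (by simp), nr_mul, nr_Pi]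
  congr 1
  rw [star_mul, pow_succ, mul_assoc, ← mul_assoc (Pi u ϖ), Pi_mul_star_Pi,
    QuaternionAlgebra.coe_mul_eq_smul, mul_smul_comm, QuaternionAlgebra.re_smul, smul_eq_mul]
  ring

/-- For a positive power of `Π` the trace term is not a unit, so for a unit `w` the norm dominates
and `g` takes the value `1`. On the maximal ideal the substitution above applies. -/
theorem QuasiChar.traceAvg_succ (hg : QuasiChar ϖ g S) (h : BaseData u ϖ) (l : ℕ) :
    traceAvg h g (l + 1) = (1 - (resCard k : ℂ)⁻¹ ^ 2) +
      (resCard k : ℂ)⁻¹ ^ 2 * (S * traceAvg h g l) := by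
  have hq := h.q_pos
  have hv := volO_pos h
  have hqc : (resCard k : ℂ) ≠ 0 := by exact_mod_cast hq.ne'
  have htr : ∀ w : D u ϖ, ‖nr w‖ ≤ 1 → ‖2 * (Pi u ϖ ^ (l + 1) * star w).re‖ < 1 := by
    intro w hw
    refine h.norm_re_lt ?_
    rw [nr_mul, nr_star, norm_mul, norm_nr_Pi_pow h]
    refine (mul_le_of_le_one_right (zpow_pos hq _).le hw).trans ?_
    exact zpow_le_zpow_right₀ h.one_lt.le (by push_cast; omega)
  have hint : IntegrableOn (fun w : D u ϖ => g (nr w + 2 * (Pi u ϖ ^ (l + 1) * star w).re))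
      (ballD h 0 : Set (D u ϖ)) (muD u ϖ) := by
    refine Measure.integrableOn_of_bounded (M := 1) (muD_ballD_ne_top h 0)
      (hg.meas.comp (continuous_traceForm _).measurable).aestronglyMeasurable ?_
    refine (ae_restrict_iff' (measurableSet_ballD h 0)).mpr
      (Filter.Eventually.of_forall fun w hw => ?_)
    have hw' : ‖nr w‖ ≤ 1 := by simpa using mem_ballD.mp hw
    exact hg.bdd _ (norm_add_le_of_le hw' (htr w hw').le)
  have h1 := setAverage_diff_add (muD_ballD_ne_top h 0) (measurableSet_ballD h (-1))
    (fun t ht => ballD_mono h (by norm_num) ht) (muD_ballD_ne_zero h (-1)) hint (c := 1)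
    (measurableSet_ballD h 0) (fun w hw => by
      have hw1 : ‖nr w‖ ≤ 1 := by simpa using mem_ballD.mp hw.1
      have hw2 : ‖nr w‖ = 1 := h.norm_eq_one hw1 hw.2
      refine hg.one _ ?_
      rw [norm_add_eq_left, hw2]
      rw [hw2]
      exact htr w hw1)
  rw [hg.average_traceForm_prime h l] at h1
  rw [traceAvg, h1, muD_real_ballD, muD_real_ballD]
  have hvc : (volO k : ℂ) ≠ 0 := by exact_mod_cast hv.ne'
  push_cast
  simp only [zpow_neg, zpow_ofNat]
  field_simp

theorem one_add_inv_sq_ne_zero (N : ℕ) : 1 + (N : ℂ)⁻¹ ^ 2 ≠ 0 := by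
  have : ((1 + (N : ℝ)⁻¹ ^ 2 : ℝ) : ℂ) ≠ 0 := Complex.ofReal_ne_zero.mpr (by positivity)
  push_cast at this
  exact this

theorem QuasiChar.avgK_zero (hg : QuasiChar ϖ g S) (h : BaseData u ϖ) {x : X u ϖ}
    (hx : IsType 0 0 x) : avgK g x = ⨍ t in (ballk k 0 : Set k), g t ∂(mu k) := by
  have hq := h.q_pos
  obtain ⟨y, hxy, y1, y2, y3⟩ := hx.kEq_antidiagonal h
  have hy := h.isType_invPi y1 y2 y3
  have h1 := hg.avgK_eq h hy.1
  have e1 : ∀ w, val y w 1 = 2 * (w * invPi u ϖ).re := by intro w; simp [val, y1, y2, y3]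
  have e2 : ∀ w, val y 1 w = 2 * (invPi u ϖ * star w).re := by intro w; simp [val, y1, y2, y3]
  simp only [e1, e2] at h1
  rw [hg.average_invPi h, hg.average_invPi_prime h, ← avgK_eq_of_isType h g hx hy] at h1
  have := one_add_inv_sq_ne_zero (resCard k)
  refine mul_left_cancel₀ this (h1.trans ?_)
  ring

/-- The hyperbolic representative is used, whose values on the normalized rows are plain traces. -/
theorem QuasiChar.avgK_one (hg : QuasiChar ϖ g S) (h : BaseData u ϖ) {x : X u ϖ}
    (hx : IsType 0 1 x) : (1 + (resCard k : ℂ)⁻¹ ^ 2) * avgK g x =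
      (1 + (resCard k : ℂ)⁻¹ ^ 2 * S) * ⨍ t in (ballk k 0 : Set k), g t ∂(mu k) := by
  set y : X u ϖ := mkX 0 0 1 (by simp)
  have hy : IsType 0 1 y := h.isType_antidiag rfl rfl rfl
  have e1 : ∀ w, val y w 1 = 2 * w.re := by intro w; simp [val, y]
  have e2 : ∀ w, val y 1 w = 2 * w.re := by intro w; simp [val, y]
  have h1 := hg.avgK_eq h hy.1
  simp only [e1, e2] at h1
  rw [hg.average_trace h, hg.average_trace_prime h, hg.setAverage_ballk h,
    ← avgK_eq_of_isType h g hx hy] at h1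
  rw [h1]; ring

/-- A second representative of the same orbit, with first diagonal entry `1`. Comparison with
`QuasiChar.avgK_one` evaluates `traceAvg` at `0`, where the norm and the trace compete and a direct
computation is awkward. -/
theorem QuasiChar.avgK_one_eq_traceAvg (hg : QuasiChar ϖ g S) (h : BaseData u ϖ) {x : X u ϖ}
    (hx : IsType 0 1 x) : (1 + (resCard k : ℂ)⁻¹ ^ 2) * avgK g x =
      traceAvg h g 0 + (resCard k : ℂ)⁻¹ ^ 2 := by
  set y : X u ϖ := mkX 1 0 1 (by simp)
  have hy : IsType 0 1 y := h.isType_of_ent₁ rfl rfl rfl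
  have e1 : ∀ w, val y w 1 = nr w + 2 * (Pi u ϖ ^ 0 * star w).re := by intro w; simp [val, y]
  have e2 : ∀ w, val y 1 w = 1 + 2 * w.re := by intro w; simp [val, y]
  have h1 := hg.avgK_eq h hy.1
  simp only [e1, e2] at h1
  rw [← avgK_eq_of_isType h g hx hy, ← traceAvg] at h1
  rw [h1, setAverage_of_eq (measurableSet_ballD h _) (muD_ballD_ne_zero h _)
    (muD_ballD_ne_top h _) (c := 1), mul_one]
  intro w hw
  refine hg.one _ ?_
  rw [norm_add_eq_left, norm_one]
  rw [norm_one]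
  exact h.norm_re_lt (mem_ballD.mp hw)

/-- The representative with diagonal `(0, 1)` and off-diagonal entry `Π ^ (l + 1)` takes unit values
at all rows `(w, 1)`, so only the maximal ideal contributes something nontrivial. -/
theorem QuasiChar.avgK_succ_succ (hg : QuasiChar ϖ g S) (h : BaseData u ϖ) {x : X u ϖ} {l : ℕ}
    (hx : IsType 0 (l + 2) x) : (1 + (resCard k : ℂ)⁻¹ ^ 2) * avgK g x =
      1 + (resCard k : ℂ)⁻¹ ^ 2 * (S * traceAvg h g l) := by
  have hd : (0 : k) * 1 - nr (Pi u ϖ ^ (l + 1)) ≠ 0 := by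
    rw [zero_mul, zero_sub, neg_ne_zero, ← norm_ne_zero_iff, norm_nr_Pi_pow h]
    exact (zpow_pos h.q_pos _).ne'
  set y : X u ϖ := mkX 0 1 (Pi u ϖ ^ (l + 1)) hd
  have hy : IsType 0 (l + 2) y := h.isType_of_ent₂ rfl rfl rfl
  have e1 : ∀ w, val y w 1 = 1 + 2 * (w * Pi u ϖ ^ (l + 1)).re := by intro w; simp [val, y]
  have e2 : ∀ w, val y 1 w = nr w + 2 * (Pi u ϖ ^ (l + 1) * star w).re := by
    intro w; simp [val, y]
  have h1 := hg.avgK_eq h hy.1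
  simp only [e1, e2] at h1
  rw [← avgK_eq_of_isType h g hx hy, hg.average_traceForm_prime h l] at h1
  rw [h1, setAverage_of_eq (measurableSet_ballD h _) (muD_ballD_ne_zero h _)
    (muD_ballD_ne_top h _) (c := 1)]
  intro w hw
  refine hg.one _ ?_
  rw [norm_add_eq_left, norm_one]
  rw [norm_one]
  refine h.norm_re_lt ?_
  rw [nr_mul, norm_mul, norm_nr_Pi_pow h]
  refine (mul_le_of_le_one_left (zpow_pos h.q_pos _).le (by simpa using mem_ballD.mp hw)).trans ?_
  exact zpow_le_zpow_right₀ h.one_lt.le (by push_cast; omega)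

/-- The symmetric polynomials whose values are the normalized spherical functions. -/
def sphPoly (q : ℂ) : ℕ → ℂ → ℂ → ℂ
  | 0, _, _ => (1 - q⁻¹) * (1 + q⁻¹ ^ 2)
  | 1, a, b => (1 - q⁻¹) * (a + b)
  | 2, a, b => a ^ 2 + b ^ 2 + (1 - q - q⁻¹ - q⁻¹ ^ 2) * (a * b)
  | n + 3, a, b => (a + b) * sphPoly q (n + 2) a b - a * b * sphPoly q (n + 1) a b

/-- This inhomogeneous first-order recursion is the one produced by the averages; the defining
three-term recursion has the advantage of being visibly symmetric in `a` and `b`. -/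
theorem sphPoly_succ {q : ℂ} (hq : q ≠ 0) (n : ℕ) (a b : ℂ) : sphPoly q (n + 2) a b =
    b ^ n * (b - q * a) * (b - q⁻¹ ^ 2 * a) + a * sphPoly q (n + 1) a b := by
  induction n with
  | zero => simp only [sphPoly]; field_simp; ring
  | succ n ih =>
    rw [sphPoly, ih]
    ring

theorem QuasiChar.avgK_eq_sphPoly (hg : QuasiChar ϖ g S) (h : BaseData u ϖ) {x : X u ϖ} {n : ℕ}
    (hx : IsType 0 n x) {a b : ℂ} (hS : b * S = (resCard k : ℂ) ^ 2 * a) :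
    b ^ n * ((1 - S * (resCard k : ℂ)⁻¹) * (1 + (resCard k : ℂ)⁻¹ ^ 2) * avgK g x) =
      sphPoly (resCard k) n a b := by
  have hq := h.q_pos
  have hqc : (resCard k : ℂ) ≠ 0 := by exact_mod_cast hq.ne'
  have hS' : a = (resCard k : ℂ)⁻¹ ^ 2 * (b * S) := by rw [hS]; field_simp
  have hL := hg.average_eq h
  obtain _ | n := n
  · rw [hg.avgK_zero h hx, sphPoly]
    linear_combination (1 + (resCard k : ℂ)⁻¹ ^ 2) * hL
  -- `W` is `1 + q⁻²` times the average over `K` at type `(0, n + 1)`. The recursion for `traceAvg`,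
  -- shifted by `q⁻²`, becomes that of `sphPoly_succ`.
  · have key : ∀ n, ∃ W, traceAvg h g n = W - (resCard k : ℂ)⁻¹ ^ 2 ∧
        b ^ (n + 1) * ((1 - S * (resCard k : ℂ)⁻¹) * W) = sphPoly (resCard k) (n + 1) a b := by
      intro n
      induction n with
      | zero =>
        have hy := h.isType_antidiag (x := mkX 0 0 1 (by simp)) rfl rfl rfl
        refine ⟨_, eq_sub_of_add_eq (hg.avgK_one_eq_traceAvg h hy).symm, ?_⟩
        rw [hg.avgK_one h hy, sphPoly, hS']
        linear_combination b * (1 + (resCard k : ℂ)⁻¹ ^ 2 * S) * hL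
      | succ n ih =>
        obtain ⟨W, hW1, hW2⟩ := ih
        refine ⟨1 + (resCard k : ℂ)⁻¹ ^ 2 * S * (W - (resCard k : ℂ)⁻¹ ^ 2), ?_, ?_⟩
        · rw [hg.traceAvg_succ h, hW1]; ring
        · rw [sphPoly_succ hqc, ← hW2, hS']
          field_simp
          ring
    obtain _ | n := n
    · rw [mul_assoc, hg.avgK_one h hx, sphPoly, hS']
      linear_combination b * (1 + (resCard k : ℂ)⁻¹ ^ 2 * S) * hL
    · obtain ⟨W, hW1, hW2⟩ := key n
      rw [mul_assoc, hg.avgK_succ_succ h hx, hW1, sphPoly_succ hqc, ← hW2, hS']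
      field_simp
      ring

end Recursion

/-! ### Symmetric Laurent polynomials and the identity theorem -/

section SymLaurent

variable {q : ℝ}

theorem cpow_ne_zero (hq : 0 < q) (s : ℂ) : (q : ℂ) ^ s ≠ 0 := by
  rw [Ne, Complex.cpow_eq_zero_iff]
  exact fun h => hq.ne' (by exact_mod_cast h.1)

theorem zpow_cpow (hq : 0 < q) (e : ℤ) (w : ℂ) : ((q ^ e : ℝ) : ℂ) ^ w = ((q : ℂ) ^ w) ^ e := by
  have h1 : ((q ^ e : ℝ) : ℂ) ≠ 0 := by exact_mod_cast (zpow_pos hq e).ne'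
  rw [Complex.cpow_def_of_ne_zero h1, Complex.cpow_def_of_ne_zero (by exact_mod_cast hq.ne'),
    ← Complex.ofReal_log (zpow_pos hq e).le, ← Complex.ofReal_log hq.le, Real.log_zpow,
    ← Complex.exp_int_mul]
  congr 1
  push_cast
  ring

/-- The monomial `q ^ (m₁ z₁ + m₂ z₂)`. -/
def monom (q : ℝ) (m : ℤ × ℤ) (z : Fin 2 → ℂ) : ℂ :=
  (q : ℂ) ^ ((m.1 : ℂ) * z 0 + (m.2 : ℂ) * z 1)

/-- Laurent polynomials in `q ^ z₁`, `q ^ z₂`. -/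
def laurent (q : ℝ) : Submodule ℂ ((Fin 2 → ℂ) → ℂ) := Submodule.span ℂ (Set.range (monom q))

theorem monom_eq (hq : 0 < q) (m : ℤ × ℤ) (z : Fin 2 → ℂ) :
    monom q m z = ((q : ℂ) ^ z 0) ^ m.1 * ((q : ℂ) ^ z 1) ^ m.2 := by
  have hqc : (q : ℂ) ≠ 0 := by exact_mod_cast hq.ne'
  rw [monom, Complex.cpow_add _ _ hqc, Complex.cpow_int_mul, Complex.cpow_int_mul]

theorem monom_mul (hq : 0 < q) (m m' : ℤ × ℤ) : monom q m * monom q m' = monom q (m + m') := by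
  funext z
  have h0 := cpow_ne_zero hq (z 0)
  have h1 := cpow_ne_zero hq (z 1)
  rw [Pi.mul_apply, monom_eq hq, monom_eq hq, monom_eq hq, Prod.fst_add, Prod.snd_add,
    zpow_add₀ h0, zpow_add₀ h1]
  ring

theorem monom_mul_mem (hq : 0 < q) (m : ℤ × ℤ) {f : (Fin 2 → ℂ) → ℂ} (hf : f ∈ laurent q) :
    monom q m * f ∈ laurent q := by
  induction hf using Submodule.span_induction with
  | mem f hf =>
    obtain ⟨m', rfl⟩ := hf
    rw [monom_mul hq]
    exact Submodule.subset_span ⟨_, rfl⟩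
  | zero => rw [mul_zero]; exact zero_mem _
  | add f g _ _ hf hg => rw [mul_add]; exact add_mem hf hg
  | smul c f _ hf => rw [mul_smul_comm]; exact Submodule.smul_mem _ c hf

/-- Monomials whose exponents are allowed to vary need not be shown independent: the given
coefficients are averaged with their transpose, which represents the same function. -/
theorem mem_symLaurent_of_laurent {f : (Fin 2 → ℂ) → ℂ} (hf : f ∈ laurent q)
    (hsymm : ∀ a b, f ![a, b] = f ![b, a]) : f ∈ symLaurent q := by
  rw [laurent, Finsupp.mem_span_range_iff_exists_finsupp] at hf
  obtain ⟨c, hc⟩ := hf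
  have hval : ∀ (c : (ℤ × ℤ) →₀ ℂ) z, (Finsupp.linearCombination ℂ (monom q) c) z =
      c.sum fun m a => a * (q : ℂ) ^ ((m.1 : ℂ) * z 0 + (m.2 : ℂ) * z 1) := by
    intro c z
    rw [Finsupp.linearCombination_apply, Finsupp.sum, Finset.sum_apply]
    rfl
  have hz : ∀ z : Fin 2 → ℂ, z = ![z 0, z 1] := by
    intro z; funext i; fin_cases i <;> rfl
  have hswap : Finsupp.linearCombination ℂ (monom q) (c.mapDomain Prod.swap) = f := by
    rw [Finsupp.linearCombination_mapDomain]
    funext z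
    have e : f z = f ![z 1, z 0] := by rw [← hsymm, ← hz]
    rw [e, ← hc, Finsupp.linearCombination_apply, Finsupp.sum, Finsupp.sum, Finset.sum_apply,
      Finset.sum_apply]
    refine Finset.sum_congr rfl fun m _ => ?_
    simp [monom, add_comm]
  refine ⟨(1 / 2 : ℂ) • (c + c.mapDomain Prod.swap), ?_, ?_⟩
  · intro m n
    have h1 := Finsupp.mapDomain_apply Prod.swap_injective c (m, n)
    have h2 := Finsupp.mapDomain_apply Prod.swap_injective c (n, m)
    rw [Prod.swap_prod_mk] at h1 h2
    rw [Finsupp.smul_apply, Finsupp.smul_apply, Finsupp.add_apply, Finsupp.add_apply, h1, h2,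
      add_comm]
  · intro z
    rw [← hval, map_smul, map_add, hswap, Finsupp.linearCombination_apply, hc, Pi.smul_apply,
      Pi.add_apply, smul_eq_mul]
    ring

theorem symLaurent_analytic (hq : 0 < q) {f : (Fin 2 → ℂ) → ℂ} (hf : f ∈ symLaurent q) (a : ℂ) :
    Differentiable ℂ fun b => f ![a, b] := by
  obtain ⟨c, -, hc⟩ := hf
  have hqc : (q : ℂ) ≠ 0 := by exact_mod_cast hq.ne'
  simp only [hc, Finsupp.sum]
  refine Differentiable.fun_sum fun m _ => ?_
  refine Differentiable.const_mul ?_ _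
  refine Differentiable.const_cpow ?_ (Or.inl hqc)
  simp only [Matrix.cons_val_zero, Matrix.cons_val_one]
  fun_prop

/-- For fixed `z₁` both functions are entire in `z₂` and agree on the half plane `Re z₂ > Re z₁ +
2`, so they agree everywhere. -/
theorem symLaurent_ext (hq : 0 < q) {f g : (Fin 2 → ℂ) → ℂ} (hf : f ∈ symLaurent q)
    (hg : g ∈ symLaurent q) (hfg : ∀ z, 0 ≤ (sOfZ z 0).re → f z = g z) : f = g := by
  funext z
  have hz : z = ![z 0, z 1] := by funext i; fin_cases i <;> rfl
  have hfa := (symLaurent_analytic hq hf (z 0))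
  have hga := (symLaurent_analytic hq hg (z 0))
  have hev : (fun b => f ![z 0, b]) =ᶠ[nhds (z 0 + 3)] fun b => g ![z 0, b] := by
    have ho : IsOpen {b : ℂ | (z 0 + 2).re < b.re} := isOpen_lt continuous_const Complex.continuous_re
    filter_upwards [ho.mem_nhds (by norm_num : (z 0 + 2).re < (z 0 + 3).re)] with b hb
    refine hfg _ ?_
    simp only [sOfZ, Matrix.cons_val_zero, Matrix.cons_val_one, Complex.sub_re, Complex.add_re,
      Complex.neg_re] at hb ⊢
    linarith
  have := (Complex.analyticOnNhd_univ_iff_differentiable.mpr hfa).eq_of_eventuallyEq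
    (Complex.analyticOnNhd_univ_iff_differentiable.mpr hga) hev
  rw [hz]
  exact congrFun this (z 1)

theorem sphPoly_comm (q : ℂ) (n : ℕ) (a b : ℂ) : sphPoly q n a b = sphPoly q n b a := by
  induction n using Nat.strong_induction_on with
  | _ n ih =>
    match n with
    | 0 => rfl
    | 1 => simp only [sphPoly]; ring
    | 2 => simp only [sphPoly]; ring
    | n + 3 => rw [sphPoly, sphPoly, ih (n + 2) (by omega), ih (n + 1) (by omega)]; ring

theorem sphPoly_mem_laurent (hq : 0 < q) (n : ℕ) :
    (fun z : Fin 2 → ℂ => sphPoly q n ((q : ℂ) ^ z 0) ((q : ℂ) ^ z 1)) ∈ laurent q := by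
  have hm : ∀ m, monom q m ∈ laurent q := fun m => Submodule.subset_span ⟨m, rfl⟩
  induction n using Nat.strong_induction_on with
  | _ n ih =>
    match n with
    | 0 =>
      convert Submodule.smul_mem _ ((1 - (q : ℂ)⁻¹) * (1 + (q : ℂ)⁻¹ ^ 2)) (hm (0, 0)) using 1
      funext z
      simp [sphPoly, monom_eq hq]
    | 1 =>
      convert Submodule.smul_mem _ (1 - (q : ℂ)⁻¹) (add_mem (hm (1, 0)) (hm (0, 1))) using 1
      funext z
      simp [sphPoly, monom_eq hq]
    | 2 =>
      convert add_mem (add_mem (hm (2, 0)) (hm (0, 2)))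
        (Submodule.smul_mem _ (1 - (q : ℂ) - (q : ℂ)⁻¹ - (q : ℂ)⁻¹ ^ 2) (hm (1, 1))) using 1
      funext z
      simp [sphPoly, monom_eq hq]
    | n + 3 =>
      convert sub_mem (add_mem (monom_mul_mem hq (1, 0) (ih (n + 2) (by omega)))
        (monom_mul_mem hq (0, 1) (ih (n + 2) (by omega))))
        (monom_mul_mem hq (1, 1) (ih (n + 1) (by omega))) using 1
      funext z
      simp [sphPoly, monom_eq hq]
      ring

/-- The normalized spherical functions at forms of type `(m, n)`. -/
def sphFun (q : ℝ) (m : ℤ) (n : ℕ) (z : Fin 2 → ℂ) : ℂ :=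
  (q : ℂ) ^ (1 - n : ℤ) / (1 + (q : ℂ)⁻¹ ^ 2) * (((q : ℂ) ^ z 0 * (q : ℂ) ^ z 1) ^ (-m) *
    sphPoly q n ((q : ℂ) ^ z 0) ((q : ℂ) ^ z 1))

theorem sphFun_mem_symLaurent (hq : 0 < q) (m : ℤ) (n : ℕ) : sphFun q m n ∈ symLaurent q := by
  refine mem_symLaurent_of_laurent ?_ ?_
  · convert Submodule.smul_mem _ ((q : ℂ) ^ (1 - n : ℤ) / (1 + (q : ℂ)⁻¹ ^ 2))
      (monom_mul_mem hq (-m, -m) (sphPoly_mem_laurent hq n)) using 1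
    funext z
    simp only [sphFun, Pi.smul_apply, Pi.mul_apply, monom_eq hq, mul_zpow, smul_eq_mul]
  · intro a b
    simp only [sphFun, Matrix.cons_val_zero, Matrix.cons_val_one]
    rw [sphPoly_comm, mul_comm ((q : ℂ) ^ a)]

end SymLaurent

/-! ### The normalized spherical functions -/

section Omega

variable {k : Type*} [NontriviallyNormedField k] [IsUltrametricDist k] {u ϖ : Valued.integer k}

open Classical in
/-- The function `t ↦ |t|ˢ`, extended by `0`. -/
def normPow (s : ℂ) (t : k) : ℂ := if t = 0 then 0 else (‖t‖ : ℂ) ^ s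

theorem absPow_eq (h : BaseData u ϖ) (s : Fin 2 → ℂ) (x : X u ϖ) :
    absPow s x = (‖disc x‖ : ℂ) ^ s 1 * normPow (s 0) (ent₁ x) := by
  have h0 : ‖disc x‖ ≠ 0 := norm_ne_zero_iff.mpr (h.disc_ne_zero x)
  rw [absPow, normPow]
  by_cases h1 : ent₁ x = 0
  · rw [if_pos h1, mul_zero, if_neg]
    exact fun hall => hall 0 (by rw [h.absd_zero, h1, norm_zero])
  · rw [if_neg h1, if_pos, Fin.prod_univ_two, h.absd_zero, h.absd_one, mul_comm]
    refine Fin.forall_fin_two.mpr ⟨?_, ?_⟩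
    · rw [h.absd_zero]; exact norm_ne_zero_iff.mpr h1
    · rw [h.absd_one]; exact h0

/-- The condition on the real part serves only the bound on the unit ball, which guarantees
integrability. -/
theorem quasiChar_normPow [MeasurableSpace k] [BorelSpace k] (h : BaseData u ϖ) {s : ℂ}
    (hs : 0 ≤ s.re) :
    QuasiChar ϖ (normPow s : k → ℂ) ((resCard k : ℂ) ^ (-s)) where
  meas := by
    refine Measurable.ite (measurableSet_eq (a := (0 : k))) measurable_const ?_
    exact (Complex.measurable_ofReal.comp measurable_norm).pow_const s
  one t ht := by
    have : t ≠ 0 := norm_ne_zero_iff.mp (by rw [ht]; exact one_ne_zero)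
    simp [normPow, this, ht]
  unit_mul c t hc := by
    have : c ≠ 0 := norm_ne_zero_iff.mp (by rw [hc]; exact one_ne_zero)
    by_cases ht : t = 0
    · rw [ht, mul_zero]
    · rw [normPow, normPow, if_neg (mul_ne_zero this ht), if_neg ht, norm_mul, hc, one_mul]
  prime_mul t := by
    have hϖ := h.prime_ne
    by_cases ht : t = 0
    · simp [normPow, ht]
    · rw [normPow, normPow, if_neg (mul_ne_zero hϖ ht), if_neg ht, norm_mul, h.norm_prime,
        Complex.ofReal_mul, Complex.mul_cpow_ofReal_nonneg (inv_pos.mpr h.q_pos).le (norm_nonneg _),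
        Complex.ofReal_inv, Complex.ofReal_natCast, Complex.inv_cpow, Complex.cpow_neg]
      rw [Complex.natCast_arg]
      exact Real.pi_pos.ne
  bdd t ht := by
    by_cases h0 : t = 0
    · simp [normPow, h0]
    · rw [normPow, if_neg h0, Complex.norm_cpow_eq_rpow_re_of_pos (norm_pos_iff.mpr h0)]
      exact Real.rpow_le_one (norm_nonneg _) ht hs

variable [ProperSpace k]

theorem omega_eq (h : BaseData u ϖ) (x : X u ϖ) (s : Fin 2 → ℂ) :
    omega x s = (‖disc x‖ : ℂ) ^ s 1 * avgK (normPow (s 0)) x := by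
  rw [omega, avgK, ← integral_const_mul]
  refine integral_congr_ae (Filter.Eventually.of_forall fun κ => ?_)
  simp only [absPow_eq h, norm_disc_act h]

variable [MeasurableSpace k] [BorelSpace k]

/-- With `A = q ^ z₁` and `B = q ^ z₂` one has `S = q² A / B`, so the factor `1 - S q⁻¹` that clears
the denominator of the average is exactly `Gfac` divided by `B`. The change of variables from `s` to
`z` thus turns the average into `sphPoly` at `(A, B)`. -/
theorem Gfac_mul_omega (h : BaseData u ϖ) {x : X u ϖ} {m : ℤ} {n : ℕ} (hx : IsType m n x)
    {z : Fin 2 → ℂ} (hz : 0 ≤ (sOfZ z 0).re) :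
    Gfac (resCard k) z * omega x (sOfZ z) = sphFun (resCard k) m n z := by
  have hq := h.q_pos
  have hqc : (resCard k : ℂ) ≠ 0 := by exact_mod_cast hq.ne'
  have hqn : ((resCard k : ℝ) : ℂ) = (resCard k : ℂ) := Complex.ofReal_natCast _
  have hA : (resCard k : ℂ) ^ z 0 ≠ 0 := by rw [← hqn]; exact cpow_ne_zero hq _
  have hB : (resCard k : ℂ) ^ z 1 ≠ 0 := by rw [← hqn]; exact cpow_ne_zero hq _
  have hg := quasiChar_normPow h hz
  obtain ⟨y, h1, h2, h3⟩ := h.exists_scale x (zpow_ne_zero m h.prime_ne)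
  have hy := hx.scale h (h.norm_prime_zpow m) h1 h2 h3
  rw [add_neg_cancel] at hy
  have hS : (resCard k : ℂ) ^ (-sOfZ z 0) =
      (resCard k : ℂ) ^ 2 * (resCard k : ℂ) ^ z 0 / (resCard k : ℂ) ^ z 1 := by
    rw [show -sOfZ z 0 = ((2 : ℕ) : ℂ) + z 0 - z 1 by simp [sOfZ]; ring, Complex.cpow_sub _ _ hqc,
      Complex.cpow_add _ _ hqc, Complex.cpow_natCast]
  have hD : (‖disc x‖ : ℂ) ^ sOfZ z 1 =
      ((resCard k : ℂ) / (resCard k : ℂ) ^ z 1) ^ (2 * m + 1 - n) := by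
    rw [hx.2.2, zpow_cpow hq, hqn]
    congr 1
    rw [show sOfZ z 1 = 1 - z 1 by simp [sOfZ]; ring, Complex.cpow_sub _ _ hqc, Complex.cpow_one]
  have hS0 : (resCard k : ℂ) ^ (-sOfZ z 0) ≠ 0 := by rw [← hqn]; exact cpow_ne_zero hq _
  have hkey := hg.avgK_eq_sphPoly h hy (a := (resCard k : ℂ) ^ z 0) (b := (resCard k : ℂ) ^ z 1) (by
    rw [hS]; field_simp)
  rw [omega_eq h, hg.avgK_scale h hS0 hx hy, hD, sphFun, hqn, ← hkey, hS, Gfac, hqn,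
    Complex.cpow_add _ _ hqc, Complex.cpow_one]
  set A := (resCard k : ℂ) ^ z 0
  set B := (resCard k : ℂ) ^ z 1
  set Q := (resCard k : ℂ)
  have hne : Q ^ 2 + 1 ≠ 0 := by
    have := one_add_inv_sq_ne_zero (resCard k)
    rw [show Q ^ 2 + 1 = Q ^ 2 * (1 + Q⁻¹ ^ 2) by field_simp]
    exact mul_ne_zero (pow_ne_zero 2 hqc) this
  have e1 : (Q / B) ^ (2 * m + 1 - n) = Q ^ (1 - n : ℤ) * B ^ n / B * ((Q / B) ^ 2) ^ m := by
    rw [show 2 * m + 1 - n = 2 * m + (1 - n : ℤ) by ring, zpow_add₀ (div_ne_zero hqc hB), zpow_mul,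
      div_zpow _ _ (1 - n : ℤ), zpow_sub₀ hB, zpow_one, zpow_natCast]
    norm_cast
    field_simp
  have e2 : (Q ^ 2 * A / B) ^ (-m) * ((Q / B) ^ 2) ^ m = (A * B) ^ (-m) := by
    rw [zpow_neg, ← inv_zpow, ← mul_zpow, zpow_neg, ← inv_zpow]
    congr 1
    field_simp
  rw [e1, ← e2]
  change _ = Q ^ (1 - n : ℤ) / (1 + Q⁻¹ ^ 2) * _
  field_simp

theorem isNormalizedSpherical_sphFun (h : BaseData u ϖ) {x : X u ϖ} {m : ℤ} {n : ℕ}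
    (hx : IsType m n x) : IsNormalizedSpherical x (sphFun (resCard k) m n) :=
  ⟨sphFun_mem_symLaurent h.q_pos m n, fun _ hz => (Gfac_mul_omega h hx hz).symm⟩

omit [MeasurableSpace k] [BorelSpace k] in
theorem IsNormalizedSpherical.unique (h : BaseData u ϖ) {x : X u ϖ} {f g : (Fin 2 → ℂ) → ℂ}
    (hf : IsNormalizedSpherical x f) (hg : IsNormalizedSpherical x g) : f = g :=
  symLaurent_ext h.q_pos hf.1 hg.1 fun z hz => (hf.2 z hz).trans (hg.2 z hz).symm

theorem Psi_eq (h : BaseData u ϖ) {x : X u ϖ} {m : ℤ} {n : ℕ}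
    (hx : IsType m n x) : Psi x = sphFun (resCard k) m n := by
  have hex : ∃ f, IsNormalizedSpherical x f := ⟨_, isNormalizedSpherical_sphFun h hx⟩
  rw [Psi, dif_pos hex]
  exact hex.choose_spec.unique h (isNormalizedSpherical_sphFun h hx)

end Omega

/-! ### Measures of the level sets of the invariants -/

section ProductMeasure

theorem prod_eq_mul_of_fibers {α β : Type*} [MeasurableSpace α] [MeasurableSpace β]
    (μ : Measure α) (ν : Measure β) [SFinite ν] {R : Set α} (hR : MeasurableSet R)
    {s : Set (α × β)} (hs : MeasurableSet s) {c : ENNReal}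
    (h1 : ∀ a ∈ R, ν (Prod.mk a ⁻¹' s) = c) (h2 : ∀ p ∈ s, p.1 ∈ R) :
    (μ.prod ν) s = μ R * c := by
  rw [Measure.prod_apply hs, mul_comm, ← lintegral_indicator_const hR c]
  refine lintegral_congr fun a => ?_
  by_cases ha : a ∈ R
  · rw [Set.indicator_of_mem ha, h1 a ha]
  · rw [Set.indicator_of_notMem ha]
    convert measure_empty (μ := ν)
    exact Set.eq_empty_of_forall_notMem fun b hb => ha (h2 _ hb)

theorem prod_eq_mul_of_fibers_symm {α β : Type*} [MeasurableSpace α] [MeasurableSpace β]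
    (μ : Measure α) (ν : Measure β) [SFinite μ] [SFinite ν] {R : Set β} (hR : MeasurableSet R)
    {s : Set (α × β)} (hs : MeasurableSet s) {c : ENNReal}
    (h1 : ∀ b ∈ R, μ ((fun a => (a, b)) ⁻¹' s) = c) (h2 : ∀ p ∈ s, p.2 ∈ R) :
    (μ.prod ν) s = ν R * c := by
  rw [Measure.prod_apply_symm hs, mul_comm, ← lintegral_indicator_const hR c]
  refine lintegral_congr fun a => ?_
  by_cases ha : a ∈ R
  · rw [Set.indicator_of_mem ha, h1 a ha]
  · rw [Set.indicator_of_notMem ha]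
    convert measure_empty (μ := μ)
    exact Set.eq_empty_of_forall_notMem fun b hb => ha (h2 _ hb)

variable {k : Type*} [NontriviallyNormedField k] [IsUltrametricDist k] {u ϖ : Valued.integer k}
  [ProperSpace k] [MeasurableSpace k] [BorelSpace k]

omit [ProperSpace k] in
theorem sphere_measure (h : BaseData u ϖ) {β : Type*} [MeasurableSpace β] (P : Measure β)
    {N : β → k} (hN : Measurable N) {c d : ℤ → ℝ}
    (hc : ∀ e, c e - c (e - 1) = d e) (hc0 : ∀ e, 0 ≤ c e)
    (hP : ∀ e : ℤ, P {b | ‖N b‖ ≤ (resCard k : ℝ) ^ e} = ENNReal.ofReal (c e)) (e : ℤ) :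
    P {b | ‖N b‖ = (resCard k : ℝ) ^ e} = ENNReal.ofReal (d e) := by
  have hset : {b | ‖N b‖ = (resCard k : ℝ) ^ e} =
      {b | ‖N b‖ ≤ (resCard k : ℝ) ^ e} \ {b | ‖N b‖ ≤ (resCard k : ℝ) ^ (e - 1)} := by
    ext b
    simp only [Set.mem_ofPred_eq, Set.mem_sdiff]
    constructor
    · intro hb
      refine ⟨hb.le, ?_⟩
      rw [hb, not_le]
      exact zpow_lt_zpow_right₀ h.one_lt (by omega)
    · rintro ⟨h1, h2⟩
      refine le_antisymm h1 (not_lt.mp fun hlt => h2 (h.norm_le_zpow_of_lt ?_))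
      rwa [sub_add_cancel]
  have hm : MeasurableSet {b | ‖N b‖ ≤ (resCard k : ℝ) ^ (e - 1)} :=
    measurableSet_le hN.norm measurable_const
  rw [hset, measure_sdiff _ hm.nullMeasurableSet (by rw [hP]; exact ENNReal.ofReal_ne_top), hP, hP,
    ← ENNReal.ofReal_sub _ (hc0 _), hc]
  intro b hb
  exact (Set.mem_ofPred_eq ▸ hb : _ ≤ _).trans (zpow_le_zpow_right₀ h.one_lt.le (by omega))

theorem mu_sphere (h : BaseData u ϖ) (e : ℤ) : mu k {t | ‖t‖ = (resCard k : ℝ) ^ e} =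
    ENNReal.ofReal ((1 - (resCard k : ℝ)⁻¹) * (resCard k : ℝ) ^ e * volO k) := by
  have hq := h.q_pos
  have hv := (volO_pos h).le
  refine sphere_measure h (mu k) measurable_id (c := fun e => (resCard k : ℝ) ^ e * volO k)
    (d := fun e => (1 - (resCard k : ℝ)⁻¹) * (resCard k : ℝ) ^ e * volO k)
    (fun e => ?_) (fun e => by positivity) (fun e => mu_ballk h e) e
  rw [zpow_sub_one₀ hq.ne']
  ring

theorem mu_sphere_affine (h : BaseData u ϖ) {a : k} {m : ℤ} (ha : ‖a‖ = (resCard k : ℝ) ^ m)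
    (t : k) (e : ℤ) : mu k {c | ‖a * c - t‖ = (resCard k : ℝ) ^ e} =
      ENNReal.ofReal ((1 - (resCard k : ℝ)⁻¹) * (resCard k : ℝ) ^ (e - m) * volO k) := by
  have hq := h.q_pos
  have h0 : a ≠ 0 := norm_ne_zero_iff.mp (by rw [ha]; exact (zpow_pos hq _).ne')
  rw [← mu_sphere h, ← measure_preimage_add (mu k) (a⁻¹ * t)]
  congr 1
  ext c
  have e1 : a * (a⁻¹ * t + c) - t = a * c := by field_simp; ring
  simp only [Set.mem_ofPred_eq, Set.mem_preimage]
  rw [e1, norm_mul, ha, zpow_sub₀ hq.ne', eq_div_iff (zpow_pos hq m).ne', mul_comm]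

variable {β : Type*} [MeasurableSpace β] (P : Measure β) [SFinite P] {N : β → k}

omit [ProperSpace k] in
theorem measurableSet_pivot [SecondCountableTopology k] {f : k × k × β → k} (hf : Measurable f)
    (hN : Measurable N) (m j e : ℤ) : MeasurableSet {p : k × k × β |
      ‖f p‖ = (resCard k : ℝ) ^ m ∧ ‖N p.2.2‖ ≤ (resCard k : ℝ) ^ j ∧
      ‖p.1 * p.2.1 - N p.2.2‖ = (resCard k : ℝ) ^ e} := by
  have h1 : Measurable fun p : k × k × β => ‖f p‖ := hf.norm
  have h2 : Measurable fun p : k × k × β => ‖N p.2.2‖ := by fun_prop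
  have h3 : Measurable fun p : k × k × β => ‖p.1 * p.2.1 - N p.2.2‖ := by fun_prop
  exact (measurableSet_eq_fun h1 measurable_const).inter
    ((measurableSet_le h2 measurable_const).inter (measurableSet_eq_fun h3 measurable_const))

/-- Once the pivot `p.1` and the last coordinate are fixed, the determinant is affine in `p.2.1`
with slope of norm `q ^ m`. The measure of its sphere does not depend on the fixed data, and Fubini
gives a product. -/
theorem prod_pivot_left (h : BaseData u ϖ) (hN : Measurable N) (m j e : ℤ) :
    ((mu k).prod ((mu k).prod P)) {p | ‖p.1‖ = (resCard k : ℝ) ^ m ∧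
      ‖N p.2.2‖ ≤ (resCard k : ℝ) ^ j ∧ ‖p.1 * p.2.1 - N p.2.2‖ = (resCard k : ℝ) ^ e} =
    mu k {t | ‖t‖ = (resCard k : ℝ) ^ m} * (P {b | ‖N b‖ ≤ (resCard k : ℝ) ^ j} *
      ENNReal.ofReal ((1 - (resCard k : ℝ)⁻¹) * (resCard k : ℝ) ^ (e - m) * volO k)) := by
  have hb : MeasurableSet {b | ‖N b‖ ≤ (resCard k : ℝ) ^ j} :=
    measurableSet_le hN.norm measurable_const
  have hm : MeasurableSet {p : k × k × β | ‖p.1‖ = (resCard k : ℝ) ^ m ∧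
      ‖N p.2.2‖ ≤ (resCard k : ℝ) ^ j ∧ ‖p.1 * p.2.1 - N p.2.2‖ = (resCard k : ℝ) ^ e} :=
    measurableSet_pivot measurable_fst hN m j e
  refine prod_eq_mul_of_fibers _ _ (measurableSet_eq_fun (by fun_prop) (by fun_prop)) hm
    (fun a ha => ?_) (fun p hp => hp.1)
  refine prod_eq_mul_of_fibers_symm _ _ hb (measurable_prodMk_left hm) (fun b hb => ?_)
    (fun p hp => hp.2.1)
  rw [← mu_sphere_affine h ha (N b) e]
  congr 1
  ext c
  exact ⟨fun hc => hc.2.2, fun hc => ⟨ha, hb, hc⟩⟩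

theorem prod_pivot_right (h : BaseData u ϖ) (hN : Measurable N) (m j e : ℤ) :
    ((mu k).prod ((mu k).prod P)) {p | ‖p.2.1‖ = (resCard k : ℝ) ^ m ∧
      ‖N p.2.2‖ ≤ (resCard k : ℝ) ^ j ∧ ‖p.1 * p.2.1 - N p.2.2‖ = (resCard k : ℝ) ^ e} =
    mu k {t | ‖t‖ = (resCard k : ℝ) ^ m} * P {b | ‖N b‖ ≤ (resCard k : ℝ) ^ j} *
      ENNReal.ofReal ((1 - (resCard k : ℝ)⁻¹) * (resCard k : ℝ) ^ (e - m) * volO k) := by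
  have hb : MeasurableSet {b | ‖N b‖ ≤ (resCard k : ℝ) ^ j} :=
    measurableSet_le hN.norm measurable_const
  have hs : MeasurableSet {t : k | ‖t‖ = (resCard k : ℝ) ^ m} :=
    measurableSet_eq_fun (by fun_prop) (by fun_prop)
  have hm : MeasurableSet {p : k × k × β | ‖p.2.1‖ = (resCard k : ℝ) ^ m ∧
      ‖N p.2.2‖ ≤ (resCard k : ℝ) ^ j ∧ ‖p.1 * p.2.1 - N p.2.2‖ = (resCard k : ℝ) ^ e} :=
    measurableSet_pivot (measurable_fst.comp measurable_snd) hN m j e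
  rw [← Measure.prod_prod]
  refine prod_eq_mul_of_fibers_symm _ _ (hs.prod hb) hm (fun c hc => ?_)
    (fun p hp => ⟨hp.1, hp.2.1⟩)
  rw [← mu_sphere_affine h hc.1 (N c.2) e]
  congr 1
  ext a
  refine ⟨fun ha => ?_, fun ha => ⟨hc.1, hc.2, ?_⟩⟩
  · rw [Set.mem_ofPred_eq, mul_comm]; exact ha.2.2
  · rw [Set.mem_ofPred_eq, mul_comm] at ha; exact ha

/-- The level sets of the invariants of forms, in coordinates. -/
def levelSet (N : β → k) (m : ℤ) (n : ℕ) : Set (k × k × β) :=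
  {p | (‖p.1‖ ≤ (resCard k : ℝ) ^ m ∧ ‖p.2.1‖ ≤ (resCard k : ℝ) ^ m ∧
    ‖N p.2.2‖ ≤ (resCard k : ℝ) ^ (2 * m + 1)) ∧
    ¬ (‖p.1‖ ≤ (resCard k : ℝ) ^ (m - 1) ∧ ‖p.2.1‖ ≤ (resCard k : ℝ) ^ (m - 1) ∧
    ‖N p.2.2‖ ≤ (resCard k : ℝ) ^ (2 * (m - 1) + 1)) ∧
    ‖p.1 * p.2.1 - N p.2.2‖ = (resCard k : ℝ) ^ (2 * m + 1 - n)}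

omit [ProperSpace k] [MeasurableSpace k] [BorelSpace k] in
theorem BaseData.norm_eq_zpow (h : BaseData u ϖ) {t : k} {m : ℤ} (h1 : ‖t‖ ≤ (resCard k : ℝ) ^ m)
    (h2 : ¬ ‖t‖ ≤ (resCard k : ℝ) ^ (m - 1)) : ‖t‖ = (resCard k : ℝ) ^ m := by
  refine le_antisymm h1 (not_lt.mp fun hlt => h2 (h.norm_le_zpow_of_lt ?_))
  rwa [sub_add_cancel]

omit [ProperSpace k] [MeasurableSpace k] [BorelSpace k] [MeasurableSpace β] in
theorem norm_mul_le_zpow (h : BaseData u ϖ) {s t : k} {m j : ℤ} (h1 : ‖s‖ ≤ (resCard k : ℝ) ^ m)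
    (h2 : ‖t‖ ≤ (resCard k : ℝ) ^ j) : ‖s * t‖ ≤ (resCard k : ℝ) ^ (m + j) := by
  rw [norm_mul, zpow_add₀ h.q_pos.ne']
  exact mul_le_mul h1 h2 (norm_nonneg _) (zpow_pos h.q_pos _).le

omit [ProperSpace k] [MeasurableSpace k] [BorelSpace k] [MeasurableSpace β] in
theorem norm_le_of_mul_le (h : BaseData u ϖ) {s t : k} {m j : ℤ} (h1 : ‖s‖ = (resCard k : ℝ) ^ m)
    (h2 : ‖s * t‖ ≤ (resCard k : ℝ) ^ (m + j)) : ‖t‖ ≤ (resCard k : ℝ) ^ j := by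
  rw [norm_mul, zpow_add₀ h.q_pos.ne', h1] at h2
  exact le_of_mul_le_mul_left h2 (zpow_pos h.q_pos _)

-- The required norm `q ^ (2 * m + 1)` of the determinant exceeds that of the product of the
-- diagonal entries, so it comes entirely from the off-diagonal term.
omit [ProperSpace k] [MeasurableSpace k] [BorelSpace k] [MeasurableSpace β] in
theorem levelSet_zero (h : BaseData u ϖ) (m : ℤ) : levelSet N m 0 =
    {t : k | ‖t‖ ≤ (resCard k : ℝ) ^ m} ×ˢ {t : k | ‖t‖ ≤ (resCard k : ℝ) ^ m} ×ˢ
      {b | ‖N b‖ = (resCard k : ℝ) ^ (2 * m + 1)} := by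
  have hmono : ∀ {a b : ℤ}, a < b → (resCard k : ℝ) ^ a < (resCard k : ℝ) ^ b :=
    fun hab => zpow_lt_zpow_right₀ h.one_lt hab
  ext ⟨a, c, b⟩
  simp only [levelSet, Set.mem_ofPred_eq, Set.mem_prod, Nat.cast_zero, sub_zero]
  constructor
  · rintro ⟨⟨h1, h2, h3⟩, -, h5⟩
    refine ⟨h1, h2, ?_⟩
    have h6 := norm_mul_le_zpow h h1 h2
    have e : N b = -(a * c - N b) + a * c := by ring
    rw [e, norm_add_eq_left, norm_neg, h5]
    rw [norm_neg, h5]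
    exact h6.trans_lt (hmono (by omega))
  · rintro ⟨h1, h2, h3⟩
    refine ⟨⟨h1, h2, h3.le⟩, fun h4 => ?_, ?_⟩
    · rw [h3] at h4
      exact absurd h4.2.2 (not_le.mpr (hmono (by omega)))
    · have h6 := norm_mul_le_zpow h h1 h2
      have e : a * c - N b = -N b + a * c := by ring
      rw [e, norm_add_eq_left, norm_neg, h3]
      rw [norm_neg, h3]
      exact h6.trans_lt (hmono (by omega))

-- The pieces are distinguished by whether the first diagonal entry has the maximal norm. If not,
-- the off-diagonal term alone carries the determinant.
omit [ProperSpace k] [MeasurableSpace k] [BorelSpace k] [MeasurableSpace β] in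
theorem levelSet_one (h : BaseData u ϖ) (m : ℤ) : levelSet N m 1 =
    {p | ‖p.1‖ = (resCard k : ℝ) ^ m ∧ ‖N p.2.2‖ ≤ (resCard k : ℝ) ^ (2 * m) ∧
      ‖p.1 * p.2.1 - N p.2.2‖ = (resCard k : ℝ) ^ (2 * m)} ∪
    {t : k | ‖t‖ ≤ (resCard k : ℝ) ^ (m - 1)} ×ˢ {t : k | ‖t‖ ≤ (resCard k : ℝ) ^ m} ×ˢ
      {b | ‖N b‖ = (resCard k : ℝ) ^ (2 * m)} := by
  have hmono : ∀ {a b : ℤ}, a < b → (resCard k : ℝ) ^ a < (resCard k : ℝ) ^ b :=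
    fun hab => zpow_lt_zpow_right₀ h.one_lt hab
  ext ⟨a, c, b⟩
  simp only [levelSet, Set.mem_ofPred_eq, Set.mem_prod, Set.mem_union, Nat.cast_one,
    add_sub_cancel_right]
  constructor
  · rintro ⟨⟨h1, h2, h3⟩, -, h5⟩
    by_cases ha : ‖a‖ ≤ (resCard k : ℝ) ^ (m - 1)
    · right
      refine ⟨ha, h2, ?_⟩
      have h6 := norm_mul_le_zpow h ha h2
      have e : N b = -(a * c - N b) + a * c := by ring
      rw [e, norm_add_eq_left, norm_neg, h5]
      rw [norm_neg, h5]
      exact h6.trans_lt (hmono (by omega))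
    · left
      refine ⟨h.norm_eq_zpow h1 ha, ?_, h5⟩
      have h6 := norm_mul_le_zpow h h1 h2
      have e : N b = a * c - (a * c - N b) := by ring
      rw [e]
      exact norm_sub_le_of_le (by rwa [two_mul]) h5.le
  · rintro (⟨h1, h2, h3⟩ | ⟨h1, h2, h3⟩)
    · refine ⟨⟨h1.le, ?_, h2.trans (hmono (by omega)).le⟩, fun h4 => ?_, h3⟩
      · refine norm_le_of_mul_le h h1 (j := m) ?_
        have e : a * c = (a * c - N b) + N b := by ring
        rw [e, ← two_mul]
        exact norm_add_le_of_le h3.le h2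
      · rw [h1] at h4
        exact absurd h4.1 (not_le.mpr (hmono (by omega)))
    · refine ⟨⟨h1.trans (hmono (by omega)).le, h2, h3.le.trans (hmono (by omega)).le⟩,
        fun h4 => ?_, ?_⟩
      · rw [h3] at h4
        exact absurd h4.2.2 (not_le.mpr (hmono (by omega)))
      · have h6 := norm_mul_le_zpow h h1 h2
        have e : a * c - N b = -N b + a * c := by ring
        rw [e, norm_add_eq_left, norm_neg, h3]
        rw [norm_neg, h3]
        exact h6.trans_lt (hmono (by omega))

-- The determinant is now too small for the off-diagonal term to attain the level alone, so one
-- diagonal entry is a pivot. The stricter bound on the off-diagonal term in the second piece makes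
-- the pieces disjoint: with both diagonal entries maximal that term would have norm `q ^ (2 * m)`.
omit [ProperSpace k] [MeasurableSpace k] [BorelSpace k] [MeasurableSpace β] in
theorem levelSet_succ_succ (h : BaseData u ϖ) (m : ℤ) (n : ℕ) : levelSet N m (n + 2) =
    {p | ‖p.1‖ = (resCard k : ℝ) ^ m ∧ ‖N p.2.2‖ ≤ (resCard k : ℝ) ^ (2 * m) ∧
      ‖p.1 * p.2.1 - N p.2.2‖ = (resCard k : ℝ) ^ (2 * m - 1 - n)} ∪
    {p | ‖p.2.1‖ = (resCard k : ℝ) ^ m ∧ ‖N p.2.2‖ ≤ (resCard k : ℝ) ^ (2 * m - 1) ∧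
      ‖p.1 * p.2.1 - N p.2.2‖ = (resCard k : ℝ) ^ (2 * m - 1 - n)} := by
  have hmono : ∀ {a b : ℤ}, a < b → (resCard k : ℝ) ^ a < (resCard k : ℝ) ^ b :=
    fun hab => zpow_lt_zpow_right₀ h.one_lt hab
  have hmono' : ∀ {a b : ℤ}, a ≤ b → (resCard k : ℝ) ^ a ≤ (resCard k : ℝ) ^ b :=
    fun hab => zpow_le_zpow_right₀ h.one_lt.le hab
  ext ⟨a, c, b⟩
  have e0 : (2 * m + 1 - ((n + 2 : ℕ) : ℤ)) = 2 * m - 1 - n := by push_cast; ring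
  have e1 : 2 * (m - 1) + 1 = 2 * m - 1 := by ring
  simp only [levelSet, Set.mem_ofPred_eq, Set.mem_union, e0, e1]
  constructor
  · rintro ⟨⟨h1, h2, h3⟩, h4, h5⟩
    have e : N b = a * c - (a * c - N b) := by ring
    by_cases ha : ‖a‖ ≤ (resCard k : ℝ) ^ (m - 1)
    · right
      have h6 := norm_mul_le_zpow h ha h2
      have h7 : ‖N b‖ ≤ (resCard k : ℝ) ^ (2 * m - 1) := by
        rw [e]
        exact norm_sub_le_of_le (h6.trans (hmono' (by omega))) (h5.le.trans (hmono' (by omega)))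
      exact ⟨h.norm_eq_zpow h2 fun hc => h4 ⟨ha, hc, h7⟩, h7, h5⟩
    · left
      refine ⟨h.norm_eq_zpow h1 ha, ?_, h5⟩
      have h6 := norm_mul_le_zpow h h1 h2
      rw [e]
      exact norm_sub_le_of_le (by rwa [two_mul]) (h5.le.trans (hmono' (by omega)))
  · have e : a * c = (a * c - N b) + N b := by ring
    rintro (⟨h1, h2, h3⟩ | ⟨h1, h2, h3⟩)
    · refine ⟨⟨h1.le, ?_, h2.trans (hmono (by omega)).le⟩, fun h4 => ?_, h3⟩
      · refine norm_le_of_mul_le h h1 (j := m) ?_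
        rw [e, ← two_mul]
        exact norm_add_le_of_le (h3.le.trans (hmono' (by omega))) h2
      · rw [h1] at h4
        exact absurd h4.1 (not_le.mpr (hmono (by omega)))
    · refine ⟨⟨?_, h1.le, h2.trans (hmono (by omega)).le⟩, fun h4 => ?_, h3⟩
      · refine norm_le_of_mul_le h h1 (j := m) ?_
        rw [mul_comm, e, ← two_mul]
        exact norm_add_le_of_le (h3.le.trans (hmono' (by omega))) (h2.trans (hmono' (by omega)))
      · rw [h1] at h4
        exact absurd h4.2.1 (not_le.mpr (hmono (by omega)))

/-- The volumes of the level sets, up to normalization. -/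
def volC (q : ℝ) : ℕ → ℝ
  | 0 => q⁻¹ * (1 - q⁻¹ ^ 2)
  | 1 => (1 - q⁻¹) * (1 + q⁻¹ ^ 2)
  | n + 2 => (1 - q⁻¹) ^ 2 * (1 + q⁻¹ ^ 2) * q ^ (2 * (n + 1))

/-- The power of `q` is split off as the cube of the norm of the determinant, which the density of
the invariant measure will cancel. -/
theorem measure_levelSet (h : BaseData u ϖ) (hN : Measurable N) {w : ℝ} (hw : 0 ≤ w)
    (hP : ∀ e : ℤ, P {b | ‖N b‖ ≤ (resCard k : ℝ) ^ e} =
      ENNReal.ofReal ((resCard k : ℝ) ^ (2 * e) * w)) (m : ℤ) (n : ℕ) :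
    ((mu k).prod ((mu k).prod P)) (levelSet N m n) =
      ENNReal.ofReal ((resCard k : ℝ) ^ (3 * (2 * m + 1 - n)) * volC (resCard k) n *
        (volO k ^ 2 * w)) := by
  have hq := h.q_pos
  have hv := (volO_pos h).le
  have hq1 : (0 : ℝ) ≤ 1 - (resCard k : ℝ)⁻¹ := sub_nonneg.mpr (inv_le_one_of_one_le₀ h.one_lt.le)
  have hq2 : (0 : ℝ) ≤ 1 - (resCard k : ℝ)⁻¹ ^ 2 :=
    sub_nonneg.mpr (pow_le_one₀ (inv_pos.mpr hq).le (inv_le_one_of_one_le₀ h.one_lt.le))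
  have hball : ∀ e : ℤ, mu k {t | ‖t‖ ≤ (resCard k : ℝ) ^ e} =
    ENNReal.ofReal ((resCard k : ℝ) ^ e * volO k) := fun e => mu_ballk h e
  have hsph : ∀ e : ℤ, P {b | ‖N b‖ = (resCard k : ℝ) ^ e} =
      ENNReal.ofReal ((1 - (resCard k : ℝ)⁻¹ ^ 2) * (resCard k : ℝ) ^ (2 * e) * w) := by
    refine sphere_measure h P hN (d := fun e => _) (fun e => ?_)
      (fun e => by positivity) hP
    rw [mul_sub, zpow_sub₀ hq.ne' (2 * e), mul_one, zpow_ofNat]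
    field_simp
  have hm : ∀ e : ℤ, MeasurableSet {b | ‖N b‖ = (resCard k : ℝ) ^ e} := fun e =>
    measurableSet_eq_fun (by fun_prop) (by fun_prop)
  have hmk : ∀ e : ℤ, MeasurableSet {t : k | ‖t‖ ≤ (resCard k : ℝ) ^ e} := fun e =>
    measurableSet_le (by fun_prop) (by fun_prop)
  obtain _ | _ | n := n
  · rw [levelSet_zero h, Measure.prod_prod, Measure.prod_prod, hball, hsph,
      ← ENNReal.ofReal_mul (by positivity), ← ENNReal.ofReal_mul (by positivity), volC]
    congr 1
    rw [show 2 * (2 * m + 1) = m + m + (m + m) + 2 by ring,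
      show 3 * (2 * m + 1 - ((0 : ℕ) : ℤ)) = m + m + (m + m) + (m + m) + 3 by push_cast; ring]
    simp only [zpow_add₀ hq.ne', zpow_ofNat]
    field_simp
  · rw [zero_add, levelSet_one h, measure_union, prod_pivot_left P h hN, mu_sphere h, hP,
      Measure.prod_prod, Measure.prod_prod, hball, hball, hsph,
      ← ENNReal.ofReal_mul (by positivity), ← ENNReal.ofReal_mul (by positivity),
      ← ENNReal.ofReal_mul (by positivity), ← ENNReal.ofReal_mul (by positivity),
      ← ENNReal.ofReal_add (by positivity) (by positivity), volC]
    · congr 1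
      rw [show 2 * (2 * m) = m + m + (m + m) by ring, show 2 * m - m = m by ring,
        show 3 * (2 * m + 1 - ((1 : ℕ) : ℤ)) = m + m + (m + m) + (m + m) by push_cast; ring]
      simp only [zpow_add₀ hq.ne', zpow_sub_one₀ hq.ne']
      field_simp
      ring
    · rw [Set.disjoint_left]
      rintro p ⟨h1, -⟩ ⟨h2, -⟩
      rw [Set.mem_ofPred_eq, h1] at h2
      exact absurd h2 (not_le.mpr (zpow_lt_zpow_right₀ h.one_lt (by omega)))
    · exact (hmk _).prod ((hmk _).prod (hm _))
  · rw [levelSet_succ_succ h, measure_union, prod_pivot_left P h hN, prod_pivot_right P h hN,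
      mu_sphere h, hP, hP,
      ← ENNReal.ofReal_mul (by positivity), ← ENNReal.ofReal_mul (by positivity),
      ← ENNReal.ofReal_mul (by positivity), ← ENNReal.ofReal_mul (by positivity),
      ← ENNReal.ofReal_add (by positivity) (by positivity), volC]
    · congr 1
      rw [show 2 * (2 * m) = m + m + (m + m) by ring, show 2 * m - 1 - n - m = m - 1 - n by ring,
        show 2 * (2 * m - 1) = m + m + (m + m) - 2 by ring,
        show 3 * (2 * m + 1 - ((n + 1 + 1 : ℕ) : ℤ)) =
          m + m + (m + m) + (m + m) - 3 - (n + n + n) by push_cast; ring]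
      simp only [zpow_add₀ hq.ne', zpow_sub₀ hq.ne', zpow_ofNat, zpow_natCast]
      field_simp
      ring
    · rw [Set.disjoint_left]
      rintro p ⟨h1, -⟩ ⟨h2, h3, h4⟩
      have h5 : ‖p.1 * p.2.1‖ ≤ (resCard k : ℝ) ^ (2 * m - 1) := by
        have e : p.1 * p.2.1 = (p.1 * p.2.1 - N p.2.2) + N p.2.2 := by ring
        rw [e]
        exact norm_add_le_of_le (h4.le.trans (zpow_le_zpow_right₀ h.one_lt.le (by omega))) h3
      rw [norm_mul, h1, h2, ← zpow_add₀ hq.ne'] at h5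
      exact absurd h5 (not_le.mpr (zpow_lt_zpow_right₀ h.one_lt (by omega)))
    · exact measurableSet_pivot (measurable_fst.comp measurable_snd) hN _ _ _

end ProductMeasure

/-! ### Volumes of the orbits -/

section Volume

variable {k : Type*} [NontriviallyNormedField k] [IsUltrametricDist k] {u ϖ : Valued.integer k}

/-- The reduced norm in terms of the coordinates of `D`. -/
def nrCoord (u ϖ : Valued.integer k) (t : Fin 4 → k) : k := nr ((homeoD u ϖ).symm t)

theorem continuous_nrCoord : Continuous (nrCoord u ϖ) :=
  continuous_nr.comp (homeoD u ϖ).symm.continuous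

theorem coord_apply (x : X u ϖ) : coord x = (ent₁ x, ent₂ x, homeoD u ϖ (off x)) := rfl

theorem continuous_coord : Continuous (coord : X u ϖ → _) := by
  have h : ∀ i j, Continuous fun x : X u ϖ => x.1.1 i j := fun i j =>
    (Units.continuous_val.comp continuous_subtype_val).matrix_elem i j
  exact (continuous_re.comp (h 0 0)).prodMk ((continuous_re.comp (h 1 1)).prodMk
    (continuous_equivTuple.comp (h 0 1)))

theorem continuous_disc : Continuous (disc : X u ϖ → k) := by
  have h : Continuous fun x : X u ϖ =>
      (coord x).1 * (coord x).2.1 - nrCoord u ϖ (coord x).2.2 :=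
    ((continuous_fst.comp continuous_coord).mul ((continuous_fst.comp continuous_snd).comp
      continuous_coord)).sub (continuous_nrCoord.comp ((continuous_snd.comp continuous_snd).comp
      continuous_coord))
  convert h using 2 with x
  rw [disc, coord_apply, nrCoord, Homeomorph.symm_apply_apply]

/-- The coordinates of nondegenerate forms. -/
def coordSet (u ϖ : Valued.integer k) : Set (k × k × (Fin 4 → k)) :=
  {p | p.1 * p.2.1 - nrCoord u ϖ p.2.2 ≠ 0}

theorem continuous_mkX {α : Type*} [TopologicalSpace α] {a c : α → k} {b : α → D u ϖ}
    (ha : Continuous a) (hc : Continuous c) (hb : Continuous b)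
    (hd : ∀ p, a p * c p - nr (b p) ≠ 0) : Continuous fun p => mkX (a p) (c p) (b p) (hd p) := by
  have hcoe : Continuous fun t : k => (QuaternionAlgebra.coe t : D u ϖ) := by
    refine continuous_toD ?_ ?_ ?_ ?_
    · exact continuous_id
    · exact continuous_const
    · exact continuous_const
    · exact continuous_const
  have hmat : ∀ {a c : α → k} {b : α → D u ϖ}, Continuous a → Continuous c → Continuous b →
      Continuous fun p => formMat (a p) (c p) (b p) := by
    intro a c b ha hc hb
    refine continuous_matrix fun i j => ?_
    fin_cases i <;> fin_cases j
    · exact hcoe.comp ha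
    · exact hb
    · exact hb.star
    · exact hcoe.comp hc
  refine Continuous.subtype_mk ?_ _
  refine Units.continuous_iff.mpr ⟨hmat ha hc hb, ?_⟩
  have hdc : Continuous fun p => (a p * c p - nr (b p))⁻¹ :=
    ((ha.mul hc).sub (continuous_nr.comp hb)).inv₀ hd
  exact hdc.smul (hmat hc ha hb.neg)

theorem coord_mem (h : BaseData u ϖ) (x : X u ϖ) : coord x ∈ coordSet u ϖ := by
  have := h.disc_ne_zero x
  rw [coordSet, Set.mem_ofPred_eq, coord_apply, nrCoord, Homeomorph.symm_apply_apply]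
  exact this

/-- The coordinates as a homeomorphism. -/
def homeoX (h : BaseData u ϖ) : X u ϖ ≃ₜ coordSet u ϖ where
  toFun x := ⟨coord x, coord_mem h x⟩
  invFun p := mkX p.1.1 p.1.2.1 ((homeoD u ϖ).symm p.1.2.2) p.2
  left_inv x := h.ext_form rfl rfl ((homeoD u ϖ).symm_apply_apply (off x))
  right_inv _ := Subtype.ext (Prod.ext rfl (Prod.ext rfl ((homeoD u ϖ).apply_symm_apply _)))
  continuous_toFun := continuous_coord.subtype_mk _
  continuous_invFun :=
    continuous_mkX (continuous_fst.comp continuous_subtype_val)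
      ((continuous_fst.comp continuous_snd).comp continuous_subtype_val)
      ((homeoD u ϖ).symm.continuous.comp
        ((continuous_snd.comp continuous_snd).comp continuous_subtype_val)) _

theorem isOpenEmbedding_coord (h : BaseData u ϖ) :
    Topology.IsOpenEmbedding (coord : X u ϖ → _) := by
  have ho : IsOpen (coordSet u ϖ) := by
    refine isOpen_ne_fun ?_ continuous_const
    exact (continuous_fst.mul (continuous_fst.comp continuous_snd)).sub
      (continuous_nrCoord.comp (continuous_snd.comp continuous_snd))
  exact ho.isOpenEmbedding_subtypeVal.comp (homeoX h).isOpenEmbedding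

theorem coord_image_isType (h : BaseData u ϖ) (m : ℤ) (n : ℕ) :
    coord '' {x : X u ϖ | IsType m n x} = levelSet (nrCoord u ϖ) m n := by
  have key : ∀ x : X u ϖ, coord x ∈ levelSet (nrCoord u ϖ) m n ↔ IsType m n x := by
    intro x
    simp only [levelSet, Set.mem_ofPred_eq, coord_apply, nrCoord, Homeomorph.symm_apply_apply]
    rfl
  ext p
  constructor
  · rintro ⟨x, hx, rfl⟩
    exact (key x).mpr hx
  · intro hp
    have hd : p ∈ coordSet u ϖ := by
      have h1 := hp.2.2
      rw [coordSet, Set.mem_ofPred_eq, ← norm_ne_zero_iff, h1]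
      exact (zpow_pos h.q_pos _).ne'
    have he : coord ((homeoX h).symm ⟨p, hd⟩) = p :=
      congrArg Subtype.val ((homeoX h).apply_symm_apply ⟨p, hd⟩)
    refine ⟨_, ?_, he⟩
    rw [Set.mem_ofPred_eq, ← key, he]
    exact hp

variable [ProperSpace k] [MeasurableSpace k] [BorelSpace k]

omit [ProperSpace k] [MeasurableSpace k] [BorelSpace k] in
theorem isClopen_isType (h : BaseData u ϖ) (m : ℤ) (n : ℕ) : IsClopen {x : X u ϖ | IsType m n x} := by
  have hq := h.q_pos
  have hval : ∀ {f : X u ϖ → k} (hf : Continuous f) (j : ℤ),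
      IsClopen {x | ‖f x‖ ≤ (resCard k : ℝ) ^ j} := by
    intro f hf j
    refine ⟨isClosed_le hf.norm continuous_const, ?_⟩
    have : {x | ‖f x‖ ≤ (resCard k : ℝ) ^ j} = {x | ‖f x‖ < (resCard k : ℝ) ^ (j + 1)} := by
      ext x
      exact ⟨fun hx => lt_of_le_of_lt hx (zpow_lt_zpow_right₀ h.one_lt (by omega)),
        fun hx => h.norm_le_zpow_of_lt hx⟩
    rw [this]
    exact isOpen_lt hf.norm continuous_const
  have h1 : Continuous (ent₁ : X u ϖ → k) := continuous_fst.comp continuous_coord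
  have h2 : Continuous (ent₂ : X u ϖ → k) := (continuous_fst.comp continuous_snd).comp continuous_coord
  have h3 : Continuous fun x : X u ϖ => nr (off x) := by
    refine continuous_nr.comp ?_
    exact (Units.continuous_val.comp continuous_subtype_val).matrix_elem 0 1
  have hlev : ∀ m : ℤ, IsClopen {x : X u ϖ | Lev m x} := fun m =>
    (hval h1 m).inter ((hval h2 m).inter (hval h3 _))
  have hd : IsClopen {x : X u ϖ | ‖disc x‖ = (resCard k : ℝ) ^ (2 * m + 1 - n)} := by
    have : {x : X u ϖ | ‖disc x‖ = (resCard k : ℝ) ^ (2 * m + 1 - n)} =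
        {x | ‖disc x‖ ≤ (resCard k : ℝ) ^ (2 * m + 1 - n)} \
          {x | ‖disc x‖ ≤ (resCard k : ℝ) ^ (2 * m + 1 - n - 1)} := by
      ext x
      refine ⟨fun hx => ⟨le_of_eq hx, ?_⟩, fun hx => h.norm_eq_zpow hx.1 hx.2⟩
      rw [Set.mem_ofPred_eq] at hx ⊢
      rw [hx, not_le]
      exact zpow_lt_zpow_right₀ h.one_lt (by omega)
    rw [this]
    exact (hval continuous_disc _).diff (hval continuous_disc _)
  exact (hlev m).inter ((hlev (m - 1)).compl.inter hd)

/-- The reduced norm is the square of the determinant, so the density is the constant `‖disc x‖ ^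
(-3)` on an orbit and removes the dependence on `m`. -/
theorem measX₀_isType (h : BaseData u ϖ) (m : ℤ) (n : ℕ) :
    measX₀ u ϖ {x | IsType m n x} = ENNReal.ofReal (volC (resCard k) n * volO k ^ 6) := by
  have hq := h.q_pos
  have hv := volO_pos h
  have hms : MeasurableSet {x : X u ϖ | IsType m n x} := (isClopen_isType h m n).isClosed.measurableSet
  rw [measX₀, withDensity_apply _ hms, setLIntegral_congr_fun (g := fun _ =>
    ENNReal.ofReal ((resCard k : ℝ) ^ (-(3 * (2 * m + 1 - n)) : ℤ))) hms, setLIntegral_const,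
    (isOpenEmbedding_coord h).measurableEmbedding.comap_apply, coord_image_isType h,
    measure_levelSet _ h continuous_nrCoord.measurable (w := volO k ^ 4) (by positivity),
    ← ENNReal.ofReal_mul (by positivity)]
  · congr 1
    have := (zpow_pos hq (3 * (2 * m + 1 - n))).ne'
    rw [zpow_neg]
    field_simp
  · intro e
    rw [← muD_ballD h, ← muD_apply_homeo (u := u) (ϖ := ϖ)]
    congr 1
  · intro x hx
    simp only
    rw [h.nrd_eq, norm_pow, hx.2.2, ← Real.rpow_natCast, ← Real.rpow_mul (zpow_pos hq _).le,
      ← Real.rpow_intCast, ← Real.rpow_mul hq.le, ← Real.rpow_intCast]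
    congr 2
    push_cast
    ring

omit [ProperSpace k] [MeasurableSpace k] [BorelSpace k] in
theorem volC_pos (h : BaseData u ϖ) (n : ℕ) : 0 < volC (resCard k) n := by
  have hq := h.q_pos
  have hq1 : (0 : ℝ) < 1 - (resCard k : ℝ)⁻¹ := sub_pos.mpr (inv_lt_one_of_one_lt₀ h.one_lt)
  have hq2 : (0 : ℝ) < 1 - (resCard k : ℝ)⁻¹ ^ 2 :=
    sub_pos.mpr (pow_lt_one₀ (inv_pos.mpr hq).le (inv_lt_one_of_one_lt₀ h.one_lt) two_ne_zero)
  obtain _ | _ | n := n <;> unfold volC <;> positivity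

omit [ProperSpace k] [MeasurableSpace k] [BorelSpace k] in
theorem isType_oneX (h : BaseData u ϖ) : IsType 0 1 (oneX u ϖ) := by
  have h1 : ent₁ (oneX u ϖ) = 1 := by simp [ent₁, oneX]
  have h2 : ent₂ (oneX u ϖ) = 1 := by simp [ent₂, oneX]
  have h3 : off (oneX u ϖ) = 0 := by simp [off, oneX]
  have hq := h.q_pos
  refine ⟨⟨by simp [h1], by simp [h2], by simp [h3, hq.le]⟩, fun hl => ?_, by simp [disc, h1, h2, h3]⟩
  have := hl.1
  rw [h1, norm_one] at this
  norm_num at this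
  exact absurd this (not_le.mpr (inv_lt_one_of_one_lt₀ h.one_lt))

theorem measX_isType (h : BaseData u ϖ) (m : ℤ) (n : ℕ) :
    measX u ϖ {x | IsType m n x} = ENNReal.ofReal (volC (resCard k) n / volC (resCard k) 1) := by
  have hv := volO_pos h
  have h1 := volC_pos h 1
  rw [measX, Measure.smul_apply, (isType_oneX h).orbitK_eq h, measX₀_isType h, measX₀_isType h,
    smul_eq_mul, ← ENNReal.ofReal_inv_of_pos (by positivity), ← ENNReal.ofReal_mul (by positivity)]
  congr 1
  field_simp

theorem measX_real_isType (h : BaseData u ϖ) (m : ℤ) (n : ℕ) :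
    (measX u ϖ).real {x | IsType m n x} = volC (resCard k) n / volC (resCard k) 1 := by
  rw [Measure.real, measX_isType h, ENNReal.toReal_ofReal]
  exact (div_pos (volC_pos h n) (volC_pos h 1)).le

end Volume

/-! ### Moments along the path and the polynomials `P_n` -/

section Contour

variable {q : ℝ} {γ : ℝ → ℂ}

/-- The normalized integral over the path. -/
def pathInt (q : ℝ) (γ : ℝ → ℂ) (f : ℝ → ℂ) : ℂ :=
  (2 * Real.pi * Complex.I / Real.log q)⁻¹ * ∫ r in (0 : ℝ)..1, f r * deriv γ r

/-- The closed curve `q ^ γ`. -/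
def curve (q : ℝ) (γ : ℝ → ℂ) (r : ℝ) : ℂ := (q : ℂ) ^ γ r

theorem curve_ne_zero (hq : 1 < q) (r : ℝ) : curve q γ r ≠ 0 :=
  cpow_ne_zero (zero_lt_one.trans hq) _

theorem IsPath.hasDerivAt (hγ : IsPath q γ) (r : ℝ) : HasDerivAt γ (deriv γ r) r :=
  (hγ.smooth.differentiable one_ne_zero r).hasDerivAt

theorem IsPath.continuous_deriv (hγ : IsPath q γ) : Continuous (deriv γ) :=
  hγ.smooth.continuous_deriv le_rfl

theorem IsPath.hasDerivAt_curve (hγ : IsPath q γ) (hq : 1 < q) (r : ℝ) :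
    HasDerivAt (curve q γ) (curve q γ r * Real.log q * deriv γ r) r := by
  have hq0 : (0 : ℝ) < q := zero_lt_one.trans hq
  rw [Complex.ofReal_log hq0.le]
  have h1 := (hasDerivAt_id (γ r)).const_cpow (c := (q : ℂ)) (Or.inl (by exact_mod_cast hq0.ne'))
  have h2 := h1.comp r (hγ.hasDerivAt r)
  rw [mul_one] at h2
  exact h2

theorem IsPath.continuous_curve (hγ : IsPath q γ) (hq : 1 < q) : Continuous (curve q γ) :=
  continuous_iff_continuousAt.mpr fun r => (hγ.hasDerivAt_curve hq r).continuousAt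

theorem IsPath.curve_one (hγ : IsPath q γ) (hq : 1 < q) : curve q γ 1 = curve q γ 0 := by
  have hq0 : (0 : ℝ) < q := zero_lt_one.trans hq
  have hqc : (q : ℂ) ≠ 0 := by exact_mod_cast hq0.ne'
  have hl : (Real.log q : ℂ) ≠ 0 := by exact_mod_cast (Real.log_pos hq).ne'
  rw [curve, curve, hγ.period, Complex.cpow_add _ _ hqc, Complex.cpow_def_of_ne_zero hqc
    (2 * Real.pi * Complex.I / Real.log q), ← Complex.ofReal_log hq0.le, mul_div_cancel₀ _ hl,
    Complex.exp_two_pi_mul_I, mul_one]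

theorem pathInt_congr {f g : ℝ → ℂ} (hfg : ∀ r ∈ Set.Icc (0 : ℝ) 1, f r = g r) :
    pathInt q γ f = pathInt q γ g := by
  rw [pathInt, pathInt]
  congr 1
  refine intervalIntegral.integral_congr fun r hr => ?_
  rw [Set.uIcc_of_le zero_le_one] at hr
  simp only [hfg r hr]

theorem pathInt_const_mul (c : ℂ) (f : ℝ → ℂ) :
    pathInt q γ (fun r => c * f r) = c * pathInt q γ f := by
  simp only [pathInt, mul_assoc, intervalIntegral.integral_const_mul]
  ring

theorem IsPath.intervalIntegrable (hγ : IsPath q γ) {f : ℝ → ℂ}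
    (hf : ContinuousOn f (Set.Icc 0 1)) :
    IntervalIntegrable (fun r => f r * deriv γ r) volume 0 1 := by
  refine ContinuousOn.intervalIntegrable ?_
  rw [Set.uIcc_of_le zero_le_one]
  exact hf.mul hγ.continuous_deriv.continuousOn

theorem IsPath.pathInt_add (hγ : IsPath q γ) {f g : ℝ → ℂ} (hf : ContinuousOn f (Set.Icc 0 1))
    (hg : ContinuousOn g (Set.Icc 0 1)) :
    pathInt q γ (fun r => f r + g r) = pathInt q γ f + pathInt q γ g := by
  simp only [pathInt, add_mul]
  rw [intervalIntegral.integral_add (hγ.intervalIntegrable hf) (hγ.intervalIntegrable hg), mul_add]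

/-- A nonzero power of the curve has the primitive `Y ^ a / (a log q)`, with equal values at the two
ends; for `a = 0` only the period of the path remains. -/
theorem IsPath.pathInt_zpow (hγ : IsPath q γ) (hq : 1 < q) (a : ℤ) :
    pathInt q γ (fun r => curve q γ r ^ a) = if a = 0 then 1 else 0 := by
  have hl : (Real.log q : ℂ) ≠ 0 := by exact_mod_cast (Real.log_pos hq).ne'
  have hpi : (Real.pi : ℂ) ≠ 0 := by exact_mod_cast Real.pi_pos.ne'
  rw [pathInt]
  split_ifs with ha
  · simp only [ha, zpow_zero, one_mul]
    rw [intervalIntegral.integral_eq_sub_of_hasDerivAt (fun r _ => hγ.hasDerivAt r)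
      (hγ.continuous_deriv.intervalIntegrable _ _), hγ.period, add_sub_cancel_left,
      inv_mul_cancel₀]
    exact div_ne_zero (mul_ne_zero (mul_ne_zero two_ne_zero hpi) Complex.I_ne_zero) hl
  · have hac : (a : ℂ) ≠ 0 := by exact_mod_cast ha
    have hc : Continuous fun r => curve q γ r ^ a :=
      (hγ.continuous_curve hq).zpow₀ a fun r => Or.inl (curve_ne_zero hq r)
    have hder : ∀ r, HasDerivAt (fun r => ((a : ℂ) * Real.log q)⁻¹ * curve q γ r ^ a)
        (curve q γ r ^ a * deriv γ r) r := by
      intro r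
      have hY := curve_ne_zero (γ := γ) hq r
      have h1 := ((hasDerivAt_zpow a (curve q γ r) (Or.inl hY)).comp r
        (hγ.hasDerivAt_curve hq r)).const_mul ((a : ℂ) * Real.log q)⁻¹
      refine h1.congr_deriv ?_
      rw [zpow_sub_one₀ hY]
      field_simp
    rw [intervalIntegral.integral_eq_sub_of_hasDerivAt (fun r _ => hder r)
      ((hc.mul hγ.continuous_deriv).intervalIntegrable _ _), hγ.curve_one hq, sub_self, mul_zero]

theorem IsPath.pathInt_winding (hγ : IsPath q γ) (hq : 1 < q) {a : ℝ} {n : ℤ}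
    (ha : WindingEq q γ a n) : pathInt q γ (fun r => curve q γ r / (curve q γ r - a)) = n := by
  have hl : (Real.log q : ℂ) ≠ 0 := by exact_mod_cast (Real.log_pos hq).ne'
  have hpi : (Real.pi : ℂ) ≠ 0 := by exact_mod_cast Real.pi_pos.ne'
  have h1 := ha.2
  have h2 : ∀ r, deriv (fun t => (q : ℂ) ^ γ t) r = curve q γ r * Real.log q * deriv γ r :=
    fun r => (hγ.hasDerivAt_curve hq r).deriv
  simp only [h2] at h1
  have h3 : ∀ r, curve q γ r * Real.log q * deriv γ r / ((q : ℂ) ^ γ r - a) =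
      Real.log q * (curve q γ r / (curve q γ r - a) * deriv γ r) := by
    intro r; rw [← curve]; ring
  simp only [h3, intervalIntegral.integral_const_mul] at h1
  rw [pathInt]
  have hI := Complex.I_ne_zero
  rw [inv_mul_eq_iff_eq_mul₀ (div_ne_zero (mul_ne_zero (mul_ne_zero two_ne_zero hpi) hI) hl)]
  refine mul_left_cancel₀ hl (h1.trans ?_)
  field_simp

/-- The path does not meet the pole `±a`. -/
theorem WindingEq.sq_sub_ne {a : ℝ} {n n' : ℤ} (h1 : WindingEq q γ a n)
    (h2 : WindingEq q γ (-a) n') {r : ℝ} (hr : r ∈ Set.Icc (0 : ℝ) 1) :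
    curve q γ r - a ≠ 0 ∧ curve q γ r + a ≠ 0 := by
  refine ⟨sub_ne_zero.mpr (h1.1 r hr), fun h0 => h2.1 r hr ?_⟩
  rw [Complex.ofReal_neg]
  exact eq_neg_of_add_eq_zero_left h0

/-- Partial fractions in `Y` give half the sum of the winding numbers about `a` and `-a`. -/
theorem IsPath.pathInt_winding_pair (hγ : IsPath q γ) (hq : 1 < q) {a : ℝ} {n : ℤ}
    (h1 : WindingEq q γ a n) (h2 : WindingEq q γ (-a) n) :
    pathInt q γ (fun r => curve q γ r ^ 2 / (curve q γ r ^ 2 - a ^ 2)) = n ∧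
      ContinuousOn (fun r => curve q γ r ^ 2 / (curve q γ r ^ 2 - a ^ 2)) (Set.Icc 0 1) := by
  have hc := (hγ.continuous_curve hq).continuousOn (s := Set.Icc 0 1)
  have c1 : ContinuousOn (fun r => curve q γ r / (curve q γ r - a)) (Set.Icc 0 1) :=
    hc.div (hc.sub continuousOn_const) fun r hr => (h1.sq_sub_ne h2 hr).1
  have c2 : ContinuousOn (fun r => curve q γ r / (curve q γ r - ((-a : ℝ) : ℂ))) (Set.Icc 0 1) :=
    hc.div (hc.sub continuousOn_const) fun r hr => by
      rw [Complex.ofReal_neg, sub_neg_eq_add]; exact (h1.sq_sub_ne h2 hr).2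
  have e : ∀ r ∈ Set.Icc (0 : ℝ) 1, curve q γ r ^ 2 / (curve q γ r ^ 2 - a ^ 2) =
      1 / 2 * (curve q γ r / (curve q γ r - a) + curve q γ r / (curve q γ r - ((-a : ℝ) : ℂ))) := by
    intro r hr
    obtain ⟨g1, g2⟩ := h1.sq_sub_ne h2 hr
    have g3 : curve q γ r ^ 2 - (a : ℂ) ^ 2 ≠ 0 := by
      rw [show curve q γ r ^ 2 - (a : ℂ) ^ 2 = (curve q γ r - a) * (curve q γ r + a) by ring]
      exact mul_ne_zero g1 g2
    rw [Complex.ofReal_neg, sub_neg_eq_add]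
    field_simp
    ring
  constructor
  · rw [pathInt_congr e, pathInt_const_mul, hγ.pathInt_add c1 c2, hγ.pathInt_winding hq h1,
      hγ.pathInt_winding hq h2]
    ring
  · exact (continuousOn_const.mul (c1.add c2)).congr e

/-- A function with the same moments as the unit circle. -/
structure UnitMoments (q : ℝ) (γ : ℝ → ℂ) (T : ℝ → ℂ) (c : ℂ) : Prop where
  cont : ContinuousOn T (Set.Icc 0 1)
  pow : ∀ b : ℕ, pathInt q γ (fun r => T r ^ b) = if b = 0 then 1 else 0
  ne : ∀ r ∈ Set.Icc (0 : ℝ) 1, 1 - c * T r ≠ 0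
  inv : pathInt q γ (fun r => (1 - c * T r)⁻¹) = 1

/-- Poles outside the curve let `1 / (1 - c Y²)` integrate as its geometric series in `Y²` would,
whether or not that series converges on the curve. -/
theorem IsPath.unitMoments_outside (hγ : IsPath q γ) (hq : 1 < q) {a : ℝ} (ha : a ≠ 0)
    (h1 : WindingEq q γ a 0) (h2 : WindingEq q γ (-a) 0) {c : ℂ} (hc : c * (a : ℂ) ^ 2 = 1) :
    UnitMoments q γ (fun r => curve q γ r ^ 2) c := by
  have hac : (a : ℂ) ≠ 0 := by exact_mod_cast ha
  have hC := (hγ.continuous_curve hq).continuousOn (s := Set.Icc 0 1)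
  have hne : ∀ r ∈ Set.Icc (0 : ℝ) 1, curve q γ r ^ 2 - (a : ℂ) ^ 2 ≠ 0 := by
    intro r hr
    rw [show curve q γ r ^ 2 - (a : ℂ) ^ 2 = (curve q γ r - a) * (curve q γ r + a) by ring]
    exact mul_ne_zero (h1.sq_sub_ne h2 hr).1 (h1.sq_sub_ne h2 hr).2
  have hcv : c = ((a : ℂ) ^ 2)⁻¹ := eq_inv_of_mul_eq_one_left hc
  have hne' : ∀ r ∈ Set.Icc (0 : ℝ) 1, 1 - c * curve q γ r ^ 2 ≠ 0 := by
    intro r hr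
    rw [hcv, show 1 - ((a : ℂ) ^ 2)⁻¹ * curve q γ r ^ 2 =
      -((a : ℂ) ^ 2)⁻¹ * (curve q γ r ^ 2 - a ^ 2) by field_simp; ring]
    exact mul_ne_zero (neg_ne_zero.mpr (inv_ne_zero (pow_ne_zero 2 hac))) (hne r hr)
  refine ⟨hC.pow 2, fun b => ?_, hne', ?_⟩
  · have := hγ.pathInt_zpow hq (2 * b)
    simp only [zpow_mul, zpow_ofNat, zpow_natCast] at this
    rw [this]
    simp
  · obtain ⟨i1, i2⟩ := hγ.pathInt_winding_pair hq h1 h2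
    have e : ∀ r ∈ Set.Icc (0 : ℝ) 1, (1 - c * curve q γ r ^ 2)⁻¹ =
        curve q γ r ^ (0 : ℤ) + (-1) * (curve q γ r ^ 2 / (curve q γ r ^ 2 - a ^ 2)) := by
      intro r hr
      have g1 := hne r hr
      have g2 := hne' r hr
      rw [zpow_zero]
      refine (eq_inv_of_mul_eq_one_left ?_).symm
      rw [hcv]
      field_simp
      ring
    rw [pathInt_congr e, hγ.pathInt_add, hγ.pathInt_zpow hq, pathInt_const_mul, i1]
    · simp
    · simp only [zpow_zero]; exact continuousOn_const
    · exact continuousOn_const.mul i2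

/-- This is the mirror image of the preceding case under `Y ↦ Y⁻¹`: poles inside the curve
correspond to an expansion in powers of `Y⁻²`. -/
theorem IsPath.unitMoments_inside (hγ : IsPath q γ) (hq : 1 < q) {a : ℝ}
    (h1 : WindingEq q γ a 1) (h2 : WindingEq q γ (-a) 1) {c : ℂ} (hc : c = (a : ℂ) ^ 2) :
    UnitMoments q γ (fun r => (curve q γ r)⁻¹ ^ 2) c := by
  have hC := (hγ.continuous_curve hq).continuousOn (s := Set.Icc 0 1)
  have hne : ∀ r ∈ Set.Icc (0 : ℝ) 1, curve q γ r ^ 2 - (a : ℂ) ^ 2 ≠ 0 := by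
    intro r hr
    rw [show curve q γ r ^ 2 - (a : ℂ) ^ 2 = (curve q γ r - a) * (curve q γ r + a) by ring]
    exact mul_ne_zero (h1.sq_sub_ne h2 hr).1 (h1.sq_sub_ne h2 hr).2
  have e0 : ∀ r, 1 - c * (curve q γ r)⁻¹ ^ 2 = (curve q γ r ^ 2 - a ^ 2) / curve q γ r ^ 2 := by
    intro r
    have := curve_ne_zero (γ := γ) hq r
    rw [hc]
    field_simp
  refine ⟨(hC.inv₀ fun r _ => curve_ne_zero hq r).pow 2, fun b => ?_, fun r hr => ?_, ?_⟩
  · have := hγ.pathInt_zpow hq (-(2 * b))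
    simp only [zpow_neg, zpow_mul, zpow_ofNat, zpow_natCast] at this
    simp only [inv_pow, this]
    simp
  · rw [e0]
    exact div_ne_zero (hne r hr) (pow_ne_zero 2 (curve_ne_zero hq r))
  · simp only [e0, inv_div]
    rw [(hγ.pathInt_winding_pair hq h1 h2).1, Int.cast_one]

theorem UnitMoments.cont_inv {T : ℝ → ℂ} {c : ℂ} (hT : UnitMoments q γ T c) :
    ContinuousOn (fun r => (1 - c * T r)⁻¹) (Set.Icc 0 1) :=
  (continuousOn_const.sub (continuousOn_const.mul hT.cont)).inv₀ hT.ne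

/-- The recursion `T ^ (b + 1) / (1 - c T) = c⁻¹ (T ^ b / (1 - c T) - T ^ b)` reduces everything to
`b = 0`. -/
theorem UnitMoments.pow_mul_inv {T : ℝ → ℂ} {c : ℂ} (hT : UnitMoments q γ T c) (hγ : IsPath q γ)
    (hc : c ≠ 0) (b : ℕ) :
    pathInt q γ (fun r => T r ^ b * (1 - c * T r)⁻¹) = if b = 0 then 1 else 0 := by
  induction b with
  | zero => simpa using hT.inv
  | succ b ih =>
    have e : ∀ r ∈ Set.Icc (0 : ℝ) 1, T r ^ (b + 1) * (1 - c * T r)⁻¹ =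
        c⁻¹ * (T r ^ b * (1 - c * T r)⁻¹ + (-1) * T r ^ b) := by
      intro r hr
      have := hT.ne r hr
      field_simp
      ring
    rw [pathInt_congr e, pathInt_const_mul, hγ.pathInt_add, ih, pathInt_const_mul, hT.pow]
    · split_ifs <;> simp_all
    · exact (hT.cont.pow b).mul hT.cont_inv
    · exact continuousOn_const.mul (hT.cont.pow b)

/-- One factor of the weight, as a function of `q ^ (2 y)`. -/
def halfWeight (q : ℂ) (T : ℂ) : ℂ := (1 - T) / ((1 - q * T) * (1 - q⁻¹ ^ 2 * T))

/-- Partial fractions in `T`: the two coefficients add up to `1`, so the half weight behaves under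
integration like a power series in `T` with constant term `1`. -/
theorem pathInt_halfWeight (hγ : IsPath q γ) (hq : 1 < q) {T : ℝ → ℂ}
    (h1 : UnitMoments q γ T q) (h2 : UnitMoments q γ T ((q : ℂ)⁻¹ ^ 2)) (b : ℕ) :
    pathInt q γ (fun r => T r ^ b * halfWeight q (T r)) = if b = 0 then 1 else 0 := by
  have hq0 : (0 : ℝ) < q := zero_lt_one.trans hq
  have hqc : (q : ℂ) ≠ 0 := by exact_mod_cast hq0.ne'
  have hq3 : (q : ℂ) ^ 3 - 1 ≠ 0 := by
    have : ((q ^ 3 - 1 : ℝ) : ℂ) ≠ 0 :=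
      Complex.ofReal_ne_zero.mpr (sub_pos.mpr (one_lt_pow₀ hq three_ne_zero)).ne'
    exact_mod_cast this
  have e : ∀ r ∈ Set.Icc (0 : ℝ) 1, T r ^ b * halfWeight q (T r) =
      ((q : ℂ) ^ 3 - q ^ 2) / (q ^ 3 - 1) * (T r ^ b * (1 - q * T r)⁻¹) +
      ((q : ℂ) ^ 2 - 1) / (q ^ 3 - 1) * (T r ^ b * (1 - (q : ℂ)⁻¹ ^ 2 * T r)⁻¹) := by
    intro r hr
    have g1 := h1.ne r hr
    have g2 := h2.ne r hr
    rw [halfWeight]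
    generalize hu : (1 - (q : ℂ) * T r) = v at g1 ⊢
    generalize hw : (1 - (q : ℂ)⁻¹ ^ 2 * T r) = w at g2 ⊢
    have key : (1 - T r) * (q ^ 3 - 1) = ((q : ℂ) ^ 3 - q ^ 2) * w + ((q : ℂ) ^ 2 - 1) * v := by
      rw [← hu, ← hw]
      field_simp
      ring
    field_simp
    linear_combination T r ^ b * key
  rw [pathInt_congr e, hγ.pathInt_add, pathInt_const_mul, pathInt_const_mul,
    h1.pow_mul_inv hγ hqc, h2.pow_mul_inv hγ (pow_ne_zero 2 (inv_ne_zero hqc))]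
  · split_ifs
    · field_simp
      ring
    · simp
  · exact continuousOn_const.mul ((h1.cont.pow b).mul h1.cont_inv)
  · exact continuousOn_const.mul ((h2.cont.pow b).mul h2.cont_inv)

theorem continuousOn_halfWeight {T : ℝ → ℂ}
    (h1 : UnitMoments q γ T q) (h2 : UnitMoments q γ T ((q : ℂ)⁻¹ ^ 2)) :
    ContinuousOn (fun r => halfWeight q (T r)) (Set.Icc 0 1) :=
  (continuousOn_const.sub h1.cont).div ((continuousOn_const.sub (continuousOn_const.mul h1.cont)).mul
    (continuousOn_const.sub (continuousOn_const.mul h2.cont)))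
    fun r hr => mul_ne_zero (h1.ne r hr) (h2.ne r hr)

/-- The leading coefficients of the polynomials `sphPoly`. -/
def sphLead (q : ℂ) : ℕ → ℂ
  | 0 => (1 - q⁻¹) * (1 + q⁻¹ ^ 2)
  | 1 => 1 - q⁻¹
  | _ + 2 => 1

theorem continuousOn_sphPoly {q : ℂ} {a b : ℝ → ℂ} {s : Set ℝ} (ha : ContinuousOn a s)
    (hb : ContinuousOn b s) (n : ℕ) : ContinuousOn (fun r => sphPoly q n (a r) (b r)) s := by
  induction n using Nat.strong_induction_on with
  | _ n ih =>
    match n with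
    | 0 => exact continuousOn_const
    | 1 => exact continuousOn_const.mul (ha.add hb)
    | 2 => exact ((ha.pow 2).add (hb.pow 2)).add (continuousOn_const.mul (ha.mul hb))
    | n + 3 =>
      exact ((ha.add hb).mul (ih (n + 2) (by omega))).sub
        ((ha.mul hb).mul (ih (n + 1) (by omega)))

/-- The product `P_n(Z⁻¹, Z) Z ^ (n + 2 * d)` is a polynomial in `Z²` whose constant term is the
leading coefficient of `P_n` if `d = 0` and `0` otherwise; the moments of `e` extract that term. -/
theorem pathInt_sphPoly (hγ : IsPath q γ) {Z e : ℝ → ℂ} (hZ : ContinuousOn Z (Set.Icc 0 1))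
    (hZ0 : ∀ r, Z r ≠ 0) (he : ContinuousOn e (Set.Icc 0 1))
    (hmom : ∀ b : ℕ, pathInt q γ (fun r => (Z r ^ 2) ^ b * e r) = if b = 0 then 1 else 0)
    (Q : ℂ) (n d : ℕ) :
    pathInt q γ (fun r => sphPoly Q n (Z r)⁻¹ (Z r) * Z r ^ (n + 2 * d) * e r) =
      if d = 0 then sphLead Q n else 0 := by
  have hcm : ∀ b : ℕ, ContinuousOn (fun r => (Z r ^ 2) ^ b * e r) (Set.Icc 0 1) :=
    fun b => ((hZ.pow 2).pow b).mul he
  have hZi : ContinuousOn (fun r => (Z r)⁻¹) (Set.Icc 0 1) := hZ.inv₀ fun r _ => hZ0 r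
  have hcp : ∀ n j : ℕ, ContinuousOn (fun r => sphPoly Q n (Z r)⁻¹ (Z r) * Z r ^ j * e r)
      (Set.Icc 0 1) := fun n j => ((continuousOn_sphPoly hZi hZ n).mul (hZ.pow j)).mul he
  induction n using Nat.strong_induction_on generalizing d with
  | _ n ih =>
    match n with
    | 0 =>
      have e1 : ∀ r ∈ Set.Icc (0 : ℝ) 1, sphPoly Q 0 (Z r)⁻¹ (Z r) * Z r ^ (0 + 2 * d) * e r =
          sphLead Q 0 * ((Z r ^ 2) ^ d * e r) := by
        intro r _
        rw [sphPoly, sphLead, zero_add, pow_mul]; ring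
      rw [pathInt_congr e1, pathInt_const_mul, hmom]
      split_ifs <;> simp
    | 1 =>
      have e1 : ∀ r ∈ Set.Icc (0 : ℝ) 1, sphPoly Q 1 (Z r)⁻¹ (Z r) * Z r ^ (1 + 2 * d) * e r =
          sphLead Q 1 * ((Z r ^ 2) ^ d * e r + (Z r ^ 2) ^ (d + 1) * e r) := by
        intro r _
        have := hZ0 r
        rw [sphPoly, sphLead]; field_simp; ring
      rw [pathInt_congr e1, pathInt_const_mul, hγ.pathInt_add (hcm _) (hcm _), hmom, hmom]
      split_ifs <;> simp_all
    | 2 =>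
      have e1 : ∀ r ∈ Set.Icc (0 : ℝ) 1, sphPoly Q 2 (Z r)⁻¹ (Z r) * Z r ^ (2 + 2 * d) * e r =
          (Z r ^ 2) ^ d * e r + ((Z r ^ 2) ^ (d + 2) * e r +
            (1 - Q - Q⁻¹ - Q⁻¹ ^ 2) * ((Z r ^ 2) ^ (d + 1) * e r)) := by
        intro r _
        have := hZ0 r
        rw [sphPoly, inv_mul_cancel₀ this]; field_simp; ring
      rw [pathInt_congr e1, hγ.pathInt_add, hγ.pathInt_add, pathInt_const_mul, hmom, hmom, hmom,
        sphLead]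
      · simp
      · exact hcm _
      · exact continuousOn_const.mul (hcm _)
      · exact hcm _
      · exact (hcm _).add (continuousOn_const.mul (hcm _))
    | n + 3 =>
      have e1 : ∀ r ∈ Set.Icc (0 : ℝ) 1,
          sphPoly Q (n + 3) (Z r)⁻¹ (Z r) * Z r ^ (n + 3 + 2 * d) * e r =
          sphPoly Q (n + 2) (Z r)⁻¹ (Z r) * Z r ^ (n + 2 + 2 * d) * e r +
          (sphPoly Q (n + 2) (Z r)⁻¹ (Z r) * Z r ^ (n + 2 + 2 * (d + 1)) * e r +
          (-1) * (sphPoly Q (n + 1) (Z r)⁻¹ (Z r) * Z r ^ (n + 1 + 2 * (d + 1)) * e r)) := by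
        intro r _
        have := hZ0 r
        rw [sphPoly, inv_mul_cancel₀ this]
        generalize sphPoly Q (n + 2) (Z r)⁻¹ (Z r) = A
        generalize sphPoly Q (n + 1) (Z r)⁻¹ (Z r) = B
        field_simp
        ring
      rw [pathInt_congr e1, hγ.pathInt_add, hγ.pathInt_add, pathInt_const_mul,
        ih (n + 2) (by omega), ih (n + 2) (by omega), ih (n + 1) (by omega)]
      · simp [sphLead]
      · exact hcp _ _
      · exact continuousOn_const.mul (hcp _ _)
      · exact hcp _ _
      · exact (hcp _ _).add (continuousOn_const.mul (hcp _ _))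

/-- Both sides satisfy the recursion with characteristic roots `Y` and `Y⁻¹`, so the identity need
only be checked at the first two indices. -/
theorem sphPoly_mul_weight {Q Y : ℂ} (hQ : Q ≠ 0) (hY : Y ≠ 0) (n : ℕ) :
    sphPoly Q (n + 1) Y⁻¹ Y * ((1 - Y ^ 2) * (1 - Y⁻¹ ^ 2)) =
      Y ^ (n + 1) * ((1 - Y ^ 2) * ((1 - Q * Y⁻¹ ^ 2) * (1 - Q⁻¹ ^ 2 * Y⁻¹ ^ 2))) +
      Y⁻¹ ^ (n + 1) * ((1 - Y⁻¹ ^ 2) * ((1 - Q * Y ^ 2) * (1 - Q⁻¹ ^ 2 * Y ^ 2))) := by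
  induction n using Nat.strong_induction_on with
  | _ n ih =>
    match n with
    | 0 => rw [sphPoly, zero_add, pow_one, pow_one]; field_simp; ring
    | 1 => rw [sphPoly, inv_mul_cancel₀ hY, one_add_one_eq_two]; field_simp; ring
    | n + 2 =>
      have h1 := ih (n + 1) (by omega)
      have h2 := ih n (by omega)
      rw [sphPoly, inv_mul_cancel₀ hY]
      have e1 : Y ^ (n + 2 + 1) = (Y⁻¹ + Y) * Y ^ (n + 1 + 1) - Y ^ (n + 1) := by
        field_simp; ring
      have e2 : Y⁻¹ ^ (n + 2 + 1) = (Y⁻¹ + Y) * Y⁻¹ ^ (n + 1 + 1) - Y⁻¹ ^ (n + 1) := by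
        have hY1 : Y * Y⁻¹ = 1 := mul_inv_cancel₀ hY
        generalize Y⁻¹ = V at hY1 ⊢
        linear_combination -V ^ (n + 1) * hY1
      rw [e1, e2]
      linear_combination (Y⁻¹ + Y) * h1 - h2

/-- Multiplication by the full weight splits `P_(n+1)` into two terms, each carrying only one half
weight. This is the source of the orthogonality. -/
theorem sphPoly_mul_halfWeight {Q Y : ℂ} (hQ : Q ≠ 0) (hY : Y ≠ 0) (h1 : 1 - Q * Y ^ 2 ≠ 0)
    (h2 : 1 - Q⁻¹ ^ 2 * Y ^ 2 ≠ 0) (h3 : 1 - Q * Y⁻¹ ^ 2 ≠ 0) (h4 : 1 - Q⁻¹ ^ 2 * Y⁻¹ ^ 2 ≠ 0)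
    (n : ℕ) : sphPoly Q (n + 1) Y⁻¹ Y * (halfWeight Q (Y ^ 2) * halfWeight Q (Y⁻¹ ^ 2)) =
      Y ^ (n + 1) * halfWeight Q (Y ^ 2) + Y⁻¹ ^ (n + 1) * halfWeight Q (Y⁻¹ ^ 2) := by
  have key := sphPoly_mul_weight hQ hY n
  rw [halfWeight, halfWeight]
  generalize 1 - Q * Y ^ 2 = a at *
  generalize 1 - Q⁻¹ ^ 2 * Y ^ 2 = b at *
  generalize 1 - Q * Y⁻¹ ^ 2 = c at *
  generalize 1 - Q⁻¹ ^ 2 * Y⁻¹ ^ 2 = d at *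
  generalize sphPoly Q (n + 1) Y⁻¹ Y = p at *
  generalize 1 - Y ^ 2 = e at *
  generalize 1 - Y⁻¹ ^ 2 = f at *
  generalize Y ^ (n + 1) = g at *
  generalize Y⁻¹ ^ (n + 1) = l at *
  field_simp
  linear_combination key

/-- The constant `P_0` admits no such splitting. This relation expresses the weight through the half
weights and `P_2` instead, which gives its total mass. -/
theorem halfWeight_add {Q Y : ℂ} (hQ : Q ≠ 0) (hY : Y ≠ 0) (h1 : 1 - Q * Y ^ 2 ≠ 0)
    (h2 : 1 - Q⁻¹ ^ 2 * Y ^ 2 ≠ 0) (h3 : 1 - Q * Y⁻¹ ^ 2 ≠ 0) (h4 : 1 - Q⁻¹ ^ 2 * Y⁻¹ ^ 2 ≠ 0) :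
    halfWeight Q (Y ^ 2) + halfWeight Q (Y⁻¹ ^ 2) =
      (Q - Q⁻¹ ^ 3) * (halfWeight Q (Y ^ 2) * halfWeight Q (Y⁻¹ ^ 2)) -
      Q⁻¹ * (sphPoly Q 2 Y⁻¹ Y * (halfWeight Q (Y ^ 2) * halfWeight Q (Y⁻¹ ^ 2))) := by
  have key : (1 - Y ^ 2) * ((1 - Q * Y⁻¹ ^ 2) * (1 - Q⁻¹ ^ 2 * Y⁻¹ ^ 2)) +
      (1 - Y⁻¹ ^ 2) * ((1 - Q * Y ^ 2) * (1 - Q⁻¹ ^ 2 * Y ^ 2)) =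
      (Q - Q⁻¹ ^ 3) * ((1 - Y ^ 2) * (1 - Y⁻¹ ^ 2)) -
      Q⁻¹ * (sphPoly Q 2 Y⁻¹ Y * ((1 - Y ^ 2) * (1 - Y⁻¹ ^ 2))) := by
    rw [sphPoly]; field_simp; ring
  rw [halfWeight, halfWeight]
  generalize 1 - Q * Y ^ 2 = a at *
  generalize 1 - Q⁻¹ ^ 2 * Y ^ 2 = b at *
  generalize 1 - Q * Y⁻¹ ^ 2 = c at *
  generalize 1 - Q⁻¹ ^ 2 * Y⁻¹ ^ 2 = d at *
  generalize sphPoly Q 2 Y⁻¹ Y = p at *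
  generalize 1 - Y ^ 2 = e at *
  generalize 1 - Y⁻¹ ^ 2 = f at *
  field_simp at key ⊢
  linear_combination key

end Contour

/-! ### Orthogonality of the spherical functions -/

section Pairing

variable {q : ℝ} {γ : ℝ → ℂ}

theorem IsPath.unitMoments (hγ : IsPath q γ) (hq : 1 < q) :
    (UnitMoments q γ (fun r => curve q γ r ^ 2) q ∧
      UnitMoments q γ (fun r => curve q γ r ^ 2) ((q : ℂ)⁻¹ ^ 2)) ∧
    (UnitMoments q γ (fun r => (curve q γ r)⁻¹ ^ 2) q ∧
      UnitMoments q γ (fun r => (curve q γ r)⁻¹ ^ 2) ((q : ℂ)⁻¹ ^ 2)) := by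
  have hq0 : (0 : ℝ) < q := zero_lt_one.trans hq
  have hqc : (q : ℂ) ≠ 0 := by exact_mod_cast hq0.ne'
  have hs : (Real.sqrt q : ℂ) ^ 2 = q := by
    rw [← Complex.ofReal_pow, Real.sq_sqrt hq0.le]
  refine ⟨⟨?_, ?_⟩, ?_, ?_⟩
  · refine hγ.unitMoments_outside hq (inv_ne_zero (Real.sqrt_pos.mpr hq0).ne')
      hγ.outside_inv_sqrt.1 hγ.outside_inv_sqrt.2 ?_
    rw [Complex.ofReal_inv, inv_pow, hs, mul_inv_cancel₀ hqc]
  · refine hγ.unitMoments_outside hq hq0.ne' hγ.outside_self.1 hγ.outside_self.2 ?_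
    rw [inv_pow, inv_mul_cancel₀ (pow_ne_zero 2 hqc)]
  · exact hγ.unitMoments_inside hq hγ.inside_sqrt.1 hγ.inside_sqrt.2 hs.symm
  · refine hγ.unitMoments_inside hq hγ.inside_inv.1 hγ.inside_inv.2 ?_
    rw [Complex.ofReal_inv]

theorem weight_eq (hq : 1 < q) (r : ℝ) : weight q (γ r) =
    halfWeight q (curve q γ r ^ 2) * halfWeight q ((curve q γ r)⁻¹ ^ 2) := by
  have hqc : (q : ℂ) ≠ 0 := by exact_mod_cast (zero_lt_one.trans hq).ne'
  have e1 : (q : ℂ) ^ (2 * γ r) = curve q γ r ^ 2 := by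
    rw [mul_comm, show (2 : ℂ) = ((2 : ℕ) : ℂ) by norm_num, Complex.cpow_mul_nat, curve]
  have e2 : (q : ℂ) ^ (-2 * γ r) = (curve q γ r)⁻¹ ^ 2 := by
    rw [neg_mul, Complex.cpow_neg, e1, inv_pow]
  have e3 : (q : ℂ) ^ (2 : ℂ) = (q : ℂ) ^ 2 := by
    rw [show (2 : ℂ) = ((2 : ℕ) : ℂ) by norm_num, Complex.cpow_natCast]
  rw [weight, Complex.cpow_add _ _ hqc, Complex.cpow_sub _ _ hqc, Complex.cpow_add _ _ hqc,
    Complex.cpow_sub _ _ hqc, e1, e2, Complex.cpow_one, e3, halfWeight, halfWeight]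
  have e4 : ∀ t : ℂ, t / (q : ℂ) ^ 2 = (q : ℂ)⁻¹ ^ 2 * t := fun t => by rw [inv_pow]; ring
  rw [e4, e4, mul_comm _ (q : ℂ), mul_comm _ (q : ℂ)]

/-- The values of the polynomials `sphPoly` along the path. -/
def curvePoly (q : ℝ) (γ : ℝ → ℂ) (n : ℕ) (r : ℝ) : ℂ :=
  sphPoly q n (curve q γ r)⁻¹ (curve q γ r)

/-- The square norms of the polynomials `sphPoly`. -/
def sphNorm (q : ℂ) : ℕ → ℂ
  | 0 => sphLead q 0 ^ 2 * (2 / (q - q⁻¹ ^ 3))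
  | n + 1 => 2 * sphLead q (n + 1)

theorem IsPath.continuousOn_curvePoly (hγ : IsPath q γ) (hq : 1 < q) (n : ℕ) :
    ContinuousOn (curvePoly q γ n) (Set.Icc 0 1) := by
  have hC := (hγ.continuous_curve hq).continuousOn (s := Set.Icc 0 1)
  exact continuousOn_sphPoly (hC.inv₀ fun r _ => curve_ne_zero hq r) hC n

theorem IsPath.continuousOn_weight (hγ : IsPath q γ) (hq : 1 < q) :
    ContinuousOn (fun r => weight q (γ r)) (Set.Icc 0 1) := by
  obtain ⟨⟨h1, h2⟩, h3, h4⟩ := hγ.unitMoments hq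
  simp only [weight_eq hq]
  exact (continuousOn_halfWeight h1 h2).mul (continuousOn_halfWeight h3 h4)

/-- The polynomial of larger index is combined with the weight and split in two; each part, times
the other polynomial, has a constant term only if the indices agree. The integrals of the two parts
are equal, whence the factor `2` in `sphNorm`. The case of both indices `0` is separate. -/
theorem IsPath.pathInt_curvePoly (hγ : IsPath q γ) (hq : 1 < q) (n d : ℕ) :
    pathInt q γ (fun r => curvePoly q γ (n + 2 * d) r * curvePoly q γ n r * weight q (γ r)) =
      if d = 0 then sphNorm q n else 0 := by
  have hq0 : (0 : ℝ) < q := zero_lt_one.trans hq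
  have hqc : (q : ℂ) ≠ 0 := by exact_mod_cast hq0.ne'
  obtain ⟨⟨h1, h2⟩, h3, h4⟩ := hγ.unitMoments hq
  have hY0 : ∀ r, curve q γ r ≠ 0 := fun r => curve_ne_zero hq r
  have hY := (hγ.continuous_curve hq).continuousOn (s := Set.Icc 0 1)
  have hYi := hY.inv₀ fun r _ => hY0 r
  have c1 := continuousOn_halfWeight h1 h2
  have c2 := continuousOn_halfWeight h3 h4
  have cp := hγ.continuousOn_curvePoly hq
  have cW := hγ.continuousOn_weight hq
  have half : ∀ n d : ℕ,
      pathInt q γ (fun r => curvePoly q γ n r * curve q γ r ^ (n + 2 * d) *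
        halfWeight q (curve q γ r ^ 2)) = (if d = 0 then sphLead q n else 0) ∧
      pathInt q γ (fun r => curvePoly q γ n r * (curve q γ r)⁻¹ ^ (n + 2 * d) *
        halfWeight q ((curve q γ r)⁻¹ ^ 2)) = (if d = 0 then sphLead q n else 0) := by
    intro n d
    refine ⟨pathInt_sphPoly hγ hY hY0 c1 (pathInt_halfWeight hγ hq h1 h2) q n d, ?_⟩
    have := pathInt_sphPoly hγ (Z := fun r => (curve q γ r)⁻¹) hYi (fun r => inv_ne_zero (hY0 r)) c2
      (pathInt_halfWeight hγ hq h3 h4) q n d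
    have e : ∀ r, sphPoly q n (curve q γ r)⁻¹⁻¹ (curve q γ r)⁻¹ = curvePoly q γ n r := by
      intro r; rw [inv_inv, sphPoly_comm, curvePoly]
    simp only [e] at this
    exact this
  have pos : ∀ n d : ℕ, 0 < n + 2 * d →
      pathInt q γ (fun r => curvePoly q γ (n + 2 * d) r * curvePoly q γ n r * weight q (γ r)) =
        if d = 0 then 2 * sphLead q n else 0 := by
    intro n d hpos
    have e : ∀ r ∈ Set.Icc (0 : ℝ) 1,
        curvePoly q γ (n + 2 * d) r * curvePoly q γ n r * weight q (γ r) =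
        curvePoly q γ n r * curve q γ r ^ (n + 2 * d) * halfWeight q (curve q γ r ^ 2) +
        curvePoly q γ n r * (curve q γ r)⁻¹ ^ (n + 2 * d) * halfWeight q ((curve q γ r)⁻¹ ^ 2) := by
      intro r hr
      obtain ⟨j, hj⟩ := Nat.exists_eq_add_of_lt hpos
      rw [zero_add] at hj
      have := sphPoly_mul_halfWeight hqc (hY0 r) (h1.ne r hr) (h2.ne r hr) (h3.ne r hr)
        (h4.ne r hr) j
      rw [weight_eq hq, hj]
      rw [← curvePoly] at this
      linear_combination curvePoly q γ n r * this
    rw [pathInt_congr e, hγ.pathInt_add, (half n d).1, (half n d).2]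
    · split_ifs <;> ring
    · exact ((cp n).mul (hY.pow _)).mul c1
    · exact ((cp n).mul (hYi.pow _)).mul c2
  obtain _ | n := n
  swap
  · exact pos _ _ (by omega)
  obtain _ | d := d
  swap
  · rw [pos _ _ (by omega)]; rfl
  rw [if_pos rfl, sphNorm]
  have hA : (q : ℂ) - (q : ℂ)⁻¹ ^ 3 ≠ 0 := by
    have : ((q - q⁻¹ ^ 3 : ℝ) : ℂ) ≠ 0 := by
      refine Complex.ofReal_ne_zero.mpr (sub_pos.mpr ?_).ne'
      exact (pow_lt_one₀ (inv_pos.mpr hq0).le (inv_lt_one_of_one_lt₀ hq) three_ne_zero).trans hq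
    push_cast at this
    exact this
  have hl : sphLead q 0 ≠ 0 := by
    have : (((1 - q⁻¹) * (1 + q⁻¹ ^ 2) : ℝ) : ℂ) ≠ 0 := by
      refine Complex.ofReal_ne_zero.mpr (mul_pos ?_ (by positivity)).ne'
      exact sub_pos.mpr (inv_lt_one_of_one_lt₀ hq)
    push_cast at this
    exact this
  -- This is `halfWeight_add` solved for the weight. The half weights each integrate to `1`, and the
  -- term with `P_2` is orthogonal to the constants by the case already treated.
  have e : ∀ r ∈ Set.Icc (0 : ℝ) 1,
      curvePoly q γ (0 + 2 * 0) r * curvePoly q γ 0 r * weight q (γ r) =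
      sphLead q 0 ^ 2 * ((q : ℂ) - (q : ℂ)⁻¹ ^ 3)⁻¹ * (halfWeight q (curve q γ r ^ 2) +
        halfWeight q ((curve q γ r)⁻¹ ^ 2)) +
      sphLead q 0 * ((q : ℂ) - (q : ℂ)⁻¹ ^ 3)⁻¹ * (q : ℂ)⁻¹ *
        (curvePoly q γ (0 + 2 * 1) r * curvePoly q γ 0 r * weight q (γ r)) := by
    intro r hr
    have := halfWeight_add hqc (hY0 r) (h1.ne r hr) (h2.ne r hr) (h3.ne r hr) (h4.ne r hr)
    rw [← weight_eq hq] at this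
    have e0 : curvePoly q γ 0 r = sphLead q 0 := by rw [curvePoly, sphPoly, sphLead]
    rw [this, mul_zero, zero_add, mul_one, zero_add, e0, curvePoly]
    generalize (q : ℂ) - (q : ℂ)⁻¹ ^ 3 = a at *
    field_simp
    ring
  have m1 := pathInt_halfWeight hγ hq h1 h2 0
  have m2 := pathInt_halfWeight hγ hq h3 h4 0
  simp only [pow_zero, one_mul, if_true] at m1 m2
  rw [pathInt_congr e, hγ.pathInt_add, pathInt_const_mul, pathInt_const_mul, hγ.pathInt_add c1 c2,
    m1, m2, pos 0 1 (by norm_num)]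
  · simp only [one_ne_zero, if_false]
    field_simp
    ring
  · exact continuousOn_const.mul (c1.add c2)
  · exact continuousOn_const.mul (((cp _).mul (cp 0)).mul cW)

theorem sphPoly_homog (Q c a b : ℂ) (n : ℕ) :
    sphPoly Q n (c * a) (c * b) = c ^ n * sphPoly Q n a b := by
  induction n using Nat.strong_induction_on with
  | _ n ih =>
    match n with
    | 0 => simp only [sphPoly]; ring
    | 1 => simp only [sphPoly]; ring
    | 2 => simp only [sphPoly]; ring
    | n + 3 => rw [sphPoly, sphPoly, ih (n + 2) (by omega), ih (n + 1) (by omega)]; ring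

theorem conj_sphPoly (q : ℝ) (a b : ℂ) (n : ℕ) : starRingEnd ℂ (sphPoly q n a b) =
    sphPoly q n (starRingEnd ℂ a) (starRingEnd ℂ b) := by
  induction n using Nat.strong_induction_on with
  | _ n ih =>
    match n with
    | 0 => simp [sphPoly]
    | 1 => simp [sphPoly]
    | 2 => simp [sphPoly]
    | n + 3 => rw [sphPoly, sphPoly, map_sub, map_mul, map_mul, ih (n + 2) (by omega),
        ih (n + 1) (by omega), map_add, map_mul]

/-- The normalizing factor of the spherical functions. -/
def sphC (q : ℂ) (n : ℕ) : ℂ := q ^ (1 - n : ℤ) / (1 + q⁻¹ ^ 2)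

theorem sphFun_zOfXY (hq : 1 < q) (m : ℤ) (n : ℕ) (x : ℂ) (r : ℝ) :
    sphFun q m n (zOfXY x (γ r)) =
      sphC q n * ((q : ℂ) ^ x) ^ ((n : ℤ) - 2 * m) * curvePoly q γ n r := by
  have hq0 : (0 : ℝ) < q := zero_lt_one.trans hq
  have hqc : (q : ℂ) ≠ 0 := by exact_mod_cast hq0.ne'
  have hA := cpow_ne_zero hq0 x
  have hY := curve_ne_zero (γ := γ) hq r
  have e1 : (q : ℂ) ^ (zOfXY x (γ r)) 0 = (q : ℂ) ^ x * (curve q γ r)⁻¹ := by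
    simp [zOfXY, Complex.cpow_sub _ _ hqc, curve, div_eq_mul_inv]
  have e2 : (q : ℂ) ^ (zOfXY x (γ r)) 1 = (q : ℂ) ^ x * curve q γ r := by
    simp [zOfXY, Complex.cpow_add _ _ hqc, curve]
  rw [sphFun, e1, e2, sphPoly_homog, ← sphC, ← curvePoly, zpow_sub₀ hA, zpow_natCast]
  have e3 : (q : ℂ) ^ x * (curve q γ r)⁻¹ * ((q : ℂ) ^ x * curve q γ r) = ((q : ℂ) ^ x) ^ 2 := by
    field_simp
  rw [e3, zpow_neg, ← zpow_natCast, ← zpow_mul]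
  push_cast
  ring

/-- The coefficients are real, so `conjExt` amounts to `z ↦ -z`. By symmetry in `z₁, z₂` this
changes the sign of `x` and leaves `y` alone. -/
theorem conjExt_sphFun (hq : 1 < q) (m : ℤ) (n : ℕ) (x : ℂ) (r : ℝ) :
    conjExt (sphFun q m n) (zOfXY x (γ r)) =
      sphC q n * ((q : ℂ) ^ x) ^ (-((n : ℤ) - 2 * m)) * curvePoly q γ n r := by
  have hq0 : (0 : ℝ) < q := zero_lt_one.trans hq
  have hconj : ∀ w : ℂ, starRingEnd ℂ ((q : ℂ) ^ w) = (q : ℂ) ^ (starRingEnd ℂ w) := by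
    intro w
    rw [Complex.cpow_conj, Complex.conj_ofReal]
    rw [Complex.arg_ofReal_of_nonneg hq0.le]
    exact Real.pi_pos.ne
  have e1 : ∀ w : ℂ, starRingEnd ℂ ((q : ℂ) ^ (-starRingEnd ℂ w)) = (q : ℂ) ^ (-w) := by
    intro w; rw [hconj, map_neg, Complex.conj_conj]
  have e2 : conjExt (sphFun q m n) (zOfXY x (γ r)) = sphFun q m n (fun i => -zOfXY x (γ r) i) := by
    simp only [conjExt, sphFun, map_mul, map_div₀, map_zpow₀, conj_sphPoly, e1, map_add, map_one,
      map_pow, map_inv₀, Complex.conj_ofReal]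
  have e3 : (fun i => -zOfXY x (γ r) i) = ![(zOfXY (-x) (γ r)) 1, (zOfXY (-x) (γ r)) 0] := by
    funext i
    fin_cases i <;> simp [zOfXY] <;> ring
  have e4 : sphFun q m n ![(zOfXY (-x) (γ r)) 1, (zOfXY (-x) (γ r)) 0] =
      sphFun q m n (zOfXY (-x) (γ r)) := by
    simp only [sphFun, Matrix.cons_val_zero, Matrix.cons_val_one]
    rw [sphPoly_comm, mul_comm ((q : ℂ) ^ (zOfXY (-x) (γ r)) 1)]
  rw [e2, e3, e4, sphFun_zOfXY hq, Complex.cpow_neg, inv_zpow, ← zpow_neg]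

theorem integral_circle (hq : 1 < q) (N : ℤ) :
    ∫ t in (0 : ℝ)..(2 * Real.pi / Real.log q), ((q : ℂ) ^ ((t : ℂ) * Complex.I)) ^ N =
      if N = 0 then (2 * Real.pi / Real.log q : ℂ) else 0 := by
  have hq0 : (0 : ℝ) < q := zero_lt_one.trans hq
  have hqc : (q : ℂ) ≠ 0 := by exact_mod_cast hq0.ne'
  have hl : (Real.log q : ℂ) ≠ 0 := by exact_mod_cast (Real.log_pos hq).ne'
  split_ifs with hN
  · simp [hN]
  · have e : ∀ t : ℝ, ((q : ℂ) ^ ((t : ℂ) * Complex.I)) ^ N =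
        Complex.exp ((N * Real.log q * Complex.I) * t) := by
      intro t
      rw [Complex.cpow_def_of_ne_zero hqc, ← Complex.exp_int_mul, ← Complex.ofReal_log hq0.le]
      congr 1
      ring
    have hc : (N : ℂ) * Real.log q * Complex.I ≠ 0 :=
      mul_ne_zero (mul_ne_zero (by exact_mod_cast hN) hl) Complex.I_ne_zero
    simp only [e]
    rw [integral_exp_mul_complex hc]
    have e1 : (N : ℂ) * Real.log q * Complex.I * ((2 * Real.pi / Real.log q : ℝ) : ℂ) =
        N * (2 * Real.pi * Complex.I) := by
      push_cast
      field_simp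
    rw [e1, Complex.exp_int_mul_two_pi_mul_I]
    simp

/-- The pairing of a linear combination of spherical functions with a spherical function. -/
theorem pairing_sum (hγ : IsPath q γ) (hq : 1 < q) {ι : Type*} (s : Finset ι) (a : ι → ℂ)
    (m : ι → ℤ) (n : ι → ℕ) (b : ℝ) (m' : ℤ) (n' : ℕ) :
    pairing q γ (fun z => ∑ i ∈ s, a i * sphFun q (m i) (n i) z)
      (fun z => b * sphFun q m' n' z) =
    ∑ i ∈ s, if (n i : ℤ) - 2 * m i = n' - 2 * m' then
      (1 + (q : ℂ)⁻¹ ^ 2) ^ 2 / (2 * (1 - (q : ℂ)⁻¹)) * (a i * b * sphC q (n i) * sphC q n' *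
        pathInt q γ (fun r => curvePoly q γ (n i) r * curvePoly q γ n' r * weight q (γ r))) else 0 := by
  have hq0 : (0 : ℝ) < q := zero_lt_one.trans hq
  have hl : (Real.log q : ℂ) ≠ 0 := by exact_mod_cast (Real.log_pos hq).ne'
  have hpi : (Real.pi : ℂ) ≠ 0 := by exact_mod_cast Real.pi_pos.ne'
  have hI := Complex.I_ne_zero
  have cp := hγ.continuousOn_curvePoly hq
  have cW := hγ.continuousOn_weight hq
  set κ : ℂ := 2 * Real.pi * Complex.I / Real.log q with hκ
  have hκ0 : κ ≠ 0 := div_ne_zero (mul_ne_zero (mul_ne_zero two_ne_zero hpi) hI) hl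
  have hin : ∀ i, ∫ r in (0 : ℝ)..1, curvePoly q γ (n i) r * curvePoly q γ n' r * weight q (γ r) *
      deriv γ r = κ * pathInt q γ
        (fun r => curvePoly q γ (n i) r * curvePoly q γ n' r * weight q (γ r)) := by
    intro i
    rw [pathInt, ← hκ, mul_inv_cancel_left₀ hκ0]
  have hint : ∀ t : ℝ, ∫ r in (0 : ℝ)..1,
      (∑ i ∈ s, a i * sphFun q (m i) (n i) (zOfXY (t * Complex.I) (γ r))) *
        conjExt (fun z => b * sphFun q m' n' z) (zOfXY (t * Complex.I) (γ r)) *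
        weight q (γ r) * deriv γ r =
      ∑ i ∈ s, (κ * (a i * b * sphC q (n i) * sphC q n' * pathInt q γ
        (fun r => curvePoly q γ (n i) r * curvePoly q γ n' r * weight q (γ r)))) *
        ((q : ℂ) ^ ((t : ℂ) * Complex.I)) ^ ((n i : ℤ) - 2 * m i - (n' - 2 * m')) := by
    intro t
    have hA := cpow_ne_zero hq0 ((t : ℂ) * Complex.I)
    have e : ∀ r, (∑ i ∈ s, a i * sphFun q (m i) (n i) (zOfXY (t * Complex.I) (γ r))) *
        conjExt (fun z => b * sphFun q m' n' z) (zOfXY (t * Complex.I) (γ r)) *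
        weight q (γ r) * deriv γ r =
      ∑ i ∈ s, (a i * b * sphC q (n i) * sphC q n' *
        ((q : ℂ) ^ ((t : ℂ) * Complex.I)) ^ ((n i : ℤ) - 2 * m i - (n' - 2 * m'))) *
        (curvePoly q γ (n i) r * curvePoly q γ n' r * weight q (γ r) * deriv γ r) := by
      intro r
      have e1 : conjExt (fun z => b * sphFun q m' n' z) (zOfXY (t * Complex.I) (γ r)) =
          b * conjExt (sphFun q m' n') (zOfXY (t * Complex.I) (γ r)) := by
        simp only [conjExt, map_mul, Complex.conj_ofReal]
      rw [e1, conjExt_sphFun hq, Finset.sum_mul, Finset.sum_mul, Finset.sum_mul]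
      refine Finset.sum_congr rfl fun i _ => ?_
      rw [sphFun_zOfXY hq, sub_eq_add_neg _ ((n' : ℤ) - 2 * m'), zpow_add₀ hA]
      ring
    simp only [e]
    rw [intervalIntegral.integral_finsetSum]
    · refine Finset.sum_congr rfl fun i _ => ?_
      rw [intervalIntegral.integral_const_mul, hin]
      ring
    · intro i _
      exact (hγ.intervalIntegrable (((cp (n i)).mul (cp n')).mul cW)).const_mul _
  rw [pairing]
  simp only [hint]
  rw [intervalIntegral.integral_finsetSum, Finset.mul_sum]
  · refine Finset.sum_congr rfl fun i _ => ?_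
    rw [intervalIntegral.integral_const_mul, integral_circle hq]
    by_cases hi : (n i : ℤ) - 2 * m i = n' - 2 * m'
    · rw [if_pos hi, if_pos (sub_eq_zero.mpr hi), ← hκ]
      have h2 : (2 * Real.pi / Real.log q : ℂ) ≠ 0 := div_ne_zero (mul_ne_zero two_ne_zero hpi) hl
      generalize (2 * Real.pi / Real.log q : ℂ) = l at *
      field_simp
    · rw [if_neg hi, if_neg (fun h0 => hi (sub_eq_zero.mp h0)), mul_zero, mul_zero]
  · intro i _
    refine Continuous.intervalIntegrable ?_ _ _
    refine continuous_const.mul (Continuous.zpow₀ ?_ _ fun t => Or.inl (cpow_ne_zero hq0 _))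
    refine Continuous.const_cpow (by fun_prop) (Or.inl (by exact_mod_cast hq0.ne'))

end Pairing

/-! ### Volumes against norms, and the inversion formula -/

section Inversion

theorem IsPath.pathInt_curvePoly_eq {q : ℝ} {γ : ℝ → ℂ} (hγ : IsPath q γ) (hq : 1 < q) (n n' : ℕ)
    (hn : Even ((n : ℤ) - n')) :
    pathInt q γ (fun r => curvePoly q γ n r * curvePoly q γ n' r * weight q (γ r)) =
      if n = n' then sphNorm q n else 0 := by
  obtain ⟨j, hj⟩ := hn
  rcases le_total n' n with hle | hle
  · have := hγ.pathInt_curvePoly hq n' j.toNat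
    rw [show n' + 2 * j.toNat = n by omega] at this
    rw [this]
    by_cases h0 : n = n'
    · rw [if_pos h0, if_pos (by omega), h0]
    · rw [if_neg h0, if_neg (by omega)]
  · have := hγ.pathInt_curvePoly hq n (-j).toNat
    rw [show n + 2 * (-j).toNat = n' by omega] at this
    simp only [mul_comm (curvePoly q γ n' _)] at this
    rw [this]
    by_cases h0 : n = n'
    · rw [if_pos h0, if_pos (by omega)]
    · rw [if_neg h0, if_neg (by omega)]

/-- The volume of an orbit is inverse to the square norm of its spherical function. This identity is
what dictates the total mass in the normalization of the pairing. -/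
theorem volC_mul_sphNorm {q : ℝ} (hq : 1 < q) (n : ℕ) :
    ((volC q n / volC q 1 : ℝ) : ℂ) * ((1 + (q : ℂ)⁻¹ ^ 2) ^ 2 / (2 * (1 - (q : ℂ)⁻¹)) *
      (sphC q n * sphC q n * sphNorm q n)) = 1 := by
  have hq0 : (0 : ℝ) < q := zero_lt_one.trans hq
  have hqc : (q : ℂ) ≠ 0 := by exact_mod_cast hq0.ne'
  have h1 : (1 : ℂ) - (q : ℂ)⁻¹ ≠ 0 := by
    have : ((1 - q⁻¹ : ℝ) : ℂ) ≠ 0 :=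
      Complex.ofReal_ne_zero.mpr (sub_pos.mpr (inv_lt_one_of_one_lt₀ hq)).ne'
    push_cast at this
    exact this
  have h2 : 1 + (q : ℂ)⁻¹ ^ 2 ≠ 0 := by
    have : ((1 + q⁻¹ ^ 2 : ℝ) : ℂ) ≠ 0 := Complex.ofReal_ne_zero.mpr (by positivity)
    push_cast at this
    exact this
  have h3 : 1 + (q : ℂ)⁻¹ ≠ 0 := by
    have : ((1 + q⁻¹ : ℝ) : ℂ) ≠ 0 := Complex.ofReal_ne_zero.mpr (by positivity)
    push_cast at this
    exact this
  obtain _ | _ | n := n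
  · simp only [sphC, sphNorm, volC, sphLead]
    push_cast
    have e1 : (q : ℂ) - (q : ℂ)⁻¹ ^ 3 = q * ((1 - (q : ℂ)⁻¹) * (1 + (q : ℂ)⁻¹) * (1 + (q : ℂ)⁻¹ ^ 2)) := by
      field_simp; ring
    have e2 : 1 - (q : ℂ)⁻¹ ^ 2 = (1 - (q : ℂ)⁻¹) * (1 + (q : ℂ)⁻¹) := by ring
    simp only [e1, e2, zpow_one]
    generalize 1 - (q : ℂ)⁻¹ = a at *
    generalize 1 + (q : ℂ)⁻¹ = b at *
    generalize 1 + (q : ℂ)⁻¹ ^ 2 = c at *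
    field_simp
  · simp only [sphC, sphNorm, volC, sphLead, zero_add]
    push_cast
    simp only [zpow_zero]
    generalize 1 - (q : ℂ)⁻¹ = a at *
    generalize 1 + (q : ℂ)⁻¹ ^ 2 = c at *
    field_simp
  · simp only [sphC, sphNorm, volC, sphLead]
    push_cast
    have e1 : (q : ℂ) ^ (1 - ((n : ℤ) + 1 + 1)) = ((q : ℂ) ^ (n + 1))⁻¹ := by
      rw [show 1 - ((n : ℤ) + 1 + 1) = -((n + 1 : ℕ) : ℤ) by push_cast; ring, zpow_neg, zpow_natCast]
    rw [e1, mul_comm 2 (n + 1), pow_mul]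
    have h4 : (q : ℂ) ^ (n + 1) ≠ 0 := pow_ne_zero _ hqc
    generalize (q : ℂ) ^ (n + 1) = d at *
    generalize 1 - (q : ℂ)⁻¹ = a at *
    generalize 1 + (q : ℂ)⁻¹ ^ 2 = c at *
    field_simp

variable {k : Type*} [NontriviallyNormedField k] [IsUltrametricDist k] {u ϖ : Valued.integer k}

/-- A function in the Schwartz space takes finitely many values, given by the invariants. -/
theorem exists_values (h : BaseData u ϖ) {φ : X u ϖ → ℂ} (hφ : φ ∈ schwartz u ϖ) :
    ∃ (s : Finset (ℤ × ℕ)) (c : ℤ × ℕ → ℂ), (∀ m n x, IsType m n x → φ x = c (m, n)) ∧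
      ∀ p ∉ s, c p = 0 := by
  classical
  obtain ⟨hinv, hcomp⟩ := hφ
  -- The orbits are open, so finitely many cover the compact support.
  obtain ⟨s, hs⟩ := IsCompact.elim_finite_subcover hcomp
    (fun p : ℤ × ℕ => {x : X u ϖ | IsType p.1 p.2 x}) (fun p => (isClopen_isType h p.1 p.2).isOpen)
    (fun x _ => by
      obtain ⟨m, n, hx⟩ := IsType.exists h x
      exact Set.mem_iUnion.mpr ⟨(m, n), hx⟩)
  refine ⟨s, fun p => if hp : ∃ x : X u ϖ, IsType p.1 p.2 x then φ hp.choose else 0, ?_, ?_⟩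
  · intro m n x hx
    have hp : ∃ x : X u ϖ, IsType m n x := ⟨x, hx⟩
    refine Eq.trans ?_ (dif_pos hp).symm
    obtain ⟨κ, hκ⟩ := hp.choose_spec.kEq h hx
    rw [← hinv κ hp.choose, hκ]
  · intro p hp
    simp only
    split_ifs with hex
    · by_contra hne
      have hx := subset_tsupport φ (Function.mem_support.mpr hne)
      obtain ⟨p', hp', hx'⟩ := Set.mem_iUnion₂.mp (hs hx)
      have := IsType.unique h hx' hex.choose_spec
      exact hp (by rwa [show p = p' from Prod.ext this.1.symm this.2.symm])
    · rfl

variable [ProperSpace k] [MeasurableSpace k] [BorelSpace k]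

/-- The integrand is constant on each orbit, so each contributes its volume times one spherical
function; the index `p.2 - 1 - p.1` is the first invariant of the inverse form. -/
theorem sphTransform_eq (h : BaseData u ϖ) {φ : X u ϖ → ℂ} {s : Finset (ℤ × ℕ)} {c : ℤ × ℕ → ℂ}
    (hc : ∀ m n x, IsType m n x → φ x = c (m, n)) (hs : ∀ p ∉ s, c p = 0) :
    sphTransform φ = fun z => ∑ p ∈ s,
      (c p * (volC (resCard k) p.2 / volC (resCard k) 1 : ℝ)) *
        sphFun (resCard k) (p.2 - 1 - p.1) p.2 z := by
  classical
  funext z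
  have hms : ∀ p : ℤ × ℕ, MeasurableSet {x : X u ϖ | IsType p.1 p.2 x} := fun p =>
    (isClopen_isType h p.1 p.2).isClosed.measurableSet
  have e : ∀ x : X u ϖ, φ x * Psi (inv x) z = ∑ p ∈ s, {x : X u ϖ | IsType p.1 p.2 x}.indicator
      (fun _ => c p * sphFun (resCard k) (p.2 - 1 - p.1) p.2 z) x := by
    intro x
    obtain ⟨m, n, hx⟩ := IsType.exists h x
    rw [hc m n x hx, Psi_eq h (hx.inv h), Finset.sum_eq_single (m, n)]
    · exact (Set.indicator_of_mem (s := {x : X u ϖ | IsType m n x}) hx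
        fun _ => c (m, n) * sphFun (resCard k) (n - 1 - m) n z).symm
    · intro p _ hp
      refine Set.indicator_of_notMem (s := {x : X u ϖ | IsType p.1 p.2 x}) (fun hx' => hp ?_)
        (fun _ : X u ϖ => c p * sphFun (resCard k) (p.2 - 1 - p.1) p.2 z)
      have := IsType.unique h hx' hx
      exact Prod.ext this.1 this.2
    · intro hp
      rw [Set.indicator_of_mem (s := {x : X u ϖ | IsType m n x}) hx, hs _ hp, zero_mul]
  rw [sphTransform]
  simp only [e]
  rw [integral_finsetSum]
  · refine Finset.sum_congr rfl fun p _ => ?_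
    rw [integral_indicator_const _ (hms p), measX_real_isType h, Complex.real_smul]
    ring
  · intro p _
    refine (integrable_indicator_iff (hms p)).mpr (integrableOn_const ?_)
    rw [measX_isType h]
    exact ENNReal.ofReal_ne_top

theorem sphTransform_ch (h : BaseData u ϖ) {m : ℤ} {n : ℕ} {x : X u ϖ} (hx : IsType m n x) :
    sphTransform (ch x) = fun z => ((volC (resCard k) n / volC (resCard k) 1 : ℝ) : ℂ) *
      sphFun (resCard k) (n - 1 - m) n z := by
  classical
  rw [sphTransform_eq h (s := {(m, n)}) (c := fun p => if p = (m, n) then 1 else 0)]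
  · funext z
    simp
  · intro m' n' y hy
    rw [ch, hx.orbitK_eq h, Set.indicator_apply]
    by_cases hp : (m', n') = (m, n)
    · rw [if_pos hp, if_pos]
      · rfl
      · obtain ⟨rfl, rfl⟩ := Prod.mk.inj hp
        exact hy
    · rw [if_neg hp, if_neg]
      intro hy'
      have := IsType.unique h hy hy'
      exact hp (Prod.ext this.1 this.2)
  · intro p hp
    rw [if_neg (by simpa using hp)]

theorem inversion (h : BaseData u ϖ) {γ : ℝ → ℂ} (hγ : IsPath (resCard k) γ) {φ : X u ϖ → ℂ}
    (hφ : φ ∈ schwartz u ϖ) (x : X u ϖ) :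
    φ x = 1 / ((measX u ϖ).real (orbitK x) : ℂ) *
      pairing (resCard k) γ (sphTransform φ) (sphTransform (ch x)) := by
  classical
  obtain ⟨m, n, hx⟩ := IsType.exists h x
  obtain ⟨s, c, hc, hs⟩ := exists_values h hφ
  have hv : 0 < volC (resCard k) n / volC (resCard k) 1 := div_pos (volC_pos h n) (volC_pos h 1)
  have hvc : ((volC (resCard k) n / volC (resCard k) 1 : ℝ) : ℂ) ≠ 0 :=
    Complex.ofReal_ne_zero.mpr hv.ne'
  rw [hx.orbitK_eq h, measX_real_isType h, sphTransform_eq h hc hs, sphTransform_ch h hx,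
    pairing_sum hγ h.one_lt s (fun p => c p * (volC (resCard k) p.2 / volC (resCard k) 1 : ℝ))
    (fun p => p.2 - 1 - p.1) (fun p => p.2), Finset.sum_eq_single (m, n), if_pos rfl,
    hγ.pathInt_curvePoly_eq h.one_lt n n (by simp), if_pos rfl, hc m n x hx]
  · have := volC_mul_sphNorm h.one_lt n
    generalize ((volC (resCard k) n / volC (resCard k) 1 : ℝ) : ℂ) = v at *
    rw [one_div]
    refine mul_left_cancel₀ hvc ?_
    rw [mul_inv_cancel_left₀ hvc]
    linear_combination (-v * c (m, n)) * this
  · intro p _ hp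
    by_cases hd : (p.2 : ℤ) - 2 * (p.2 - 1 - p.1) = n - 2 * (n - 1 - m)
    -- Equality of the exponents in `x` says `p.2 - n = 2 * (p.1 - m)`: the indices have equal
    -- parity, and `p.2 = n` would force `p = (m, n)`.
    · rw [if_pos hd, hγ.pathInt_curvePoly_eq h.one_lt _ _ ⟨p.1 - m, by omega⟩, if_neg]
      · ring
      · intro hn
        exact hp (Prod.ext (by simp only; omega) hn)
    · rw [if_neg hd]
  · intro hp
    rw [if_pos rfl, hs _ hp]
    ring

end Inversion

end QHerm

end

theorem mainTheorem8 {k : Type*} [NontriviallyNormedField k] [IsUltrametricDist k] [ProperSpace k]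
    [CharZero k] [MeasurableSpace k] [BorelSpace k]
    (hodd : ringChar (IsLocalRing.ResidueField (Valued.integer k)) ≠ 2)
    (ϖ : Valued.integer k) (hϖ : Irreducible ϖ)
    (hnorm : ‖(ϖ : k)‖ = (QHerm.resCard k : ℝ)⁻¹)
    (u : Valued.integer k) (hu : IsUnit u) (hu' : ¬ IsSquare (u : k)) :
    (∀ x : QHerm.X u ϖ, ∃! f, QHerm.IsNormalizedSpherical x f) ∧
    ∀ γ : ℝ → ℂ, QHerm.IsPath (QHerm.resCard k) γ →
      ∀ φ ∈ QHerm.schwartz u ϖ, ∀ x : QHerm.X u ϖ,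
        φ x = 1 / ((QHerm.measX u ϖ).real (QHerm.orbitK x) : ℂ) *
          QHerm.pairing (QHerm.resCard k) γ (QHerm.sphTransform φ)
            (QHerm.sphTransform (QHerm.ch x)) := by
  have h := QHerm.BaseData.of_hyp hodd hϖ hnorm hu hu'
  refine ⟨fun x => ?_, fun γ hγ φ hφ x => QHerm.inversion h hγ hφ x⟩
  obtain ⟨m, n, hx⟩ := QHerm.IsType.exists h x
  have hf := QHerm.isNormalizedSpherical_sphFun h hx
  exact ⟨_, hf, fun g hg => hg.unique h hf⟩
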